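/- **Setting.** Let $G$ be a connected semisimple real algebraic group (the identity component of the group of real points of a semisimple linear algebraic group over $\mathbb R$) and $\Gamma<G$ a torsion-free discrete subgroup. Fix a maximal compact subgroup $K<G$ with Cartan involution $\theta$ and Cartan decomposition $\mathfrak g=\mathfrak k\oplus\mathfrak p$, a maximal abelian subspace $\mathfrak a\subset\mathfrak p$, a closed positive Weyl chamber $\mathfrak a^+\subset\mathfrak a$, and an element $w_0\in K$ normalizing $\mathfrak a$ with $\mathrm{Ad}_{w_0}\mathfrak a^+=-\mathfrak a^+$. Let $A=\exp\mathfrak a$, $N=\exp\mathfrak n$ with $\mathfrak n$ the sum of the positive root spaces, $M$ the centralizer of $A$ in $K$, and $P=MAN$. Let $X=G/K$ with $o=[K]$, with the Riemannian distance $d$ induced by the Killing form and the Riemannian volume $\mathrm{vol}$; let $d$ and $\mathrm{vol}$ also denote the induced distance and volume on $\Gamma\backslash X$. Let $\mathcal F=G/P$, and $g^+=gP$, $g^-=gw_0P$ for $g\in G$. Let $H:G\to\mathfrak a$ be the Iwasawa cocycle, $g\in K\exp(H(g))N$, and let $\beta_{hP}(go,g'o)=H(g^{-1}h)-H(g'^{-1}h)\in\mathfrak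 a$ be the Busemann map. For $\psi\in\mathfrak a^*$, a $(\Gamma,\psi)$-conformal density is a family $\nu=\{\nu_x:x\in X\}$ of finite Borel measures on $\mathcal F$ with $\frac{d\nu_x}{d\nu_y}(\xi)=e^{-\psi(\beta_\xi(x,y))}$ and $\gamma_*\nu_x=\nu_{\gamma x}$ for all $x,y\in X$, $\xi\in\mathcal F$, $\gamma\in\Gamma$. It defines the function $E_\nu([x])=|\nu_x|=\nu_x(\mathcal F)$ on $\Gamma\backslash X$. Given a $(\Gamma,\psi_1)$-conformal density $\nu$ and a $(\Gamma,\psi_2)$-conformal density $\bar\nu$, let $\tilde m_{\nu,\bar\nu}$ be the measure on $G/M$ which, in the Hopf coordinates $gM\mapsto(g^+,g^-,v=\beta_{g^-}(o,go))$, is given by $$d\tilde m_{\nu,\bar\nu}(gM)=e^{\psi_1(\beta_{g^+}(o,go))+\psi_2(\beta_{g^-}(o,go))}\,d\nu_o(g^+)\,d\bar\nu_o(g^-)\,dv,$$ where $dv$ is Lebesgue measure on $\mathfrak a$. Lift it to a right $M$-invariant measure on $G$ by means of the Haar probability measure of $M$, and let $m_{\nu,\bar\nu}$ be the measure on $\Gamma\backslash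 G$ induced by this left $\Gamma$-invariant measure (the generalized Bowen–Margulis–Sullivan measure). **Theorem (Smearing theorem).** For any $\psi_1,\psi_2\in\mathfrak a^*$, any $(\Gamma,\psi_1)$-conformal density $\nu$ and any $(\Gamma,\psi_2)$-conformal density $\bar\nu$ on $\mathcal F$, there exists $c>0$ such that $$m_{\nu,\bar\nu}(\Gamma\backslash G)\le c\int_{\mathcal N} E_\nu(x)\,E_{\bar\nu}(x)\,d\mathrm{vol}(x),$$ where $\mathcal N\subset\Gamma\backslash X$ is the one-neighborhood of $\operatorname{supp} m_{\nu,\bar\nu}$, that is, the set of points of $\Gamma\backslash X$ at distance less than $1$ from the image of $\operatorname{supp} m_{\nu,\bar\nu}$ in $\Gamma\backslash X$. Both sides may be infinite. -/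

import Mathlib

open MeasureTheory Topology
open scoped ENNReal Matrix

attribute [local instance] LieRing.ofAssociativeRing

noncomputable section

namespace Smearing

/-! ### Connected semisimple real algebraic groups -/

variable {n : ℕ}

/-- `H` is the group of real points of a linear algebraic group: it is cut out in `GL_n(ℝ)` by
polynomial equations in the matrix entries. -/
def IsRealAlgebraic (H : Subgroup (GL (Fin n) ℝ)) : Prop :=
  ∃ S : Set (MvPolynomial (Fin n × Fin n) ℝ), ∀ g : GL (Fin n) ℝ,
    g ∈ H ↔ ∀ p ∈ S, MvPolynomial.eval (fun ij => (g : Matrix (Fin n) (Fin n) ℝ) ij.1 ij.2) p = 0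

/-- The identity component of a subgroup of `GL_n(ℝ)`. -/
def identityComponent (H : Subgroup (GL (Fin n) ℝ)) : Subgroup (GL (Fin n) ℝ) :=
  (Subgroup.connectedComponentOfOne H).map H.subtype

/-- The Lie algebra of `G ≤ GL_n(ℝ)`: all `X` with `exp (tX) ∈ G` for every real `t`. (For closed
`G` these matrices already form a Lie algebra, so that taking the span adds nothing.) -/
def lieAlg (G : Subgroup (GL (Fin n) ℝ)) : LieSubalgebra ℝ (Matrix (Fin n) (Fin n) ℝ) :=
  LieSubalgebra.lieSpan ℝ _
    {X | ∀ t : ℝ, ∃ g ∈ G, (g : Matrix (Fin n) (Fin n) ℝ) = NormedSpace.exp (t • X)}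

/-- `G` is a connected semisimple real algebraic group: the identity component of the group of
real points of a linear algebraic group over `ℝ`, with semisimple Lie algebra. -/
def IsConnectedSemisimpleAlgebraic (G : Subgroup (GL (Fin n) ℝ)) : Prop :=
  (∃ H : Subgroup (GL (Fin n) ℝ), IsRealAlgebraic H ∧ G = identityComponent H) ∧
    LieAlgebra.IsSemisimple ℝ (lieAlg G)

instance (G : Subgroup (GL (Fin n) ℝ)) : MeasurableSpace G := borel G

instance (G : Subgroup (GL (Fin n) ℝ)) : BorelSpace G := ⟨rfl⟩

/-- The matrix underlying an element of `G`. -/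
def toMat {G : Subgroup (GL (Fin n) ℝ)} (g : G) : Matrix (Fin n) (Fin n) ℝ :=
  ((g : GL (Fin n) ℝ) : Matrix (Fin n) (Fin n) ℝ)

/-! ### The choices: maximal compact subgroup, split torus, Weyl chamber, longest Weyl element -/

/-- The restricted root space of a linear form `α` on a subspace `𝔞` of a Lie algebra. -/
def rootSpace {𝔤 : Type*} [LieRing 𝔤] [LieAlgebra ℝ 𝔤] (𝔞 : Submodule ℝ 𝔤)
    (α : Module.Dual ℝ 𝔞) : Submodule ℝ 𝔤 where
  carrier := {X | ∀ H : 𝔞, ⁅(H : 𝔤), X⁆ = α H • X}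
  add_mem' := by
    intro X Y hX hY H
    rw [lie_add, hX H, hY H, smul_add]
  zero_mem' := by
    intro H
    rw [lie_zero, smul_zero]
  smul_mem' := by
    intro c X hX H
    rw [lie_smul, hX H, smul_comm]

/-- `α` is a restricted root of `(𝔤, 𝔞)`. -/
def IsRoot {𝔤 : Type*} [LieRing 𝔤] [LieAlgebra ℝ 𝔤] (𝔞 : Submodule ℝ 𝔤)
    (α : Module.Dual ℝ 𝔞) : Prop :=
  α ≠ 0 ∧ rootSpace 𝔞 α ≠ ⊥

/-- The closed Weyl chamber containing the regular element `H₀`: the positive roots are those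
which are positive at `H₀`. -/
def weylChamber {𝔤 : Type*} [LieRing 𝔤] [LieAlgebra ℝ 𝔤] (𝔞 : Submodule ℝ 𝔤) (H₀ : 𝔞) : Set 𝔞 :=
  {v | ∀ α : Module.Dual ℝ 𝔞, IsRoot 𝔞 α → 0 < α H₀ → 0 ≤ α v}

/-- The data fixed once and for all in a connected semisimple real algebraic group `G`. -/
structure CartanData (G : Subgroup (GL (Fin n) ℝ)) where
  /-- the maximal compact subgroup `K` -/
  K : Subgroup G
  isCompact_K : IsCompact (K : Set G)
  maximal_K : ∀ L : Subgroup G, IsCompact (L : Set G) → K ≤ L → L = K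
  /-- the Cartan involution whose fixed algebra is the Lie algebra of `K` -/
  θ : lieAlg G →ₗ⁅ℝ⁆ lieAlg G
  θ_θ : ∀ X, θ (θ X) = X
  killing_θ_neg : ∀ X, X ≠ 0 → killingForm ℝ (lieAlg G) X (θ X) < 0
  θ_fixed_iff : ∀ X : lieAlg G, θ X = X ↔ ∀ t : ℝ, ∃ k ∈ K,
    toMat k = NormedSpace.exp (t • (X : Matrix (Fin n) (Fin n) ℝ))
  /-- the maximal abelian subspace `𝔞` of `𝔭 = {X | θ X = -X}`, the Lie algebra of `A` -/
  𝔞 : Submodule ℝ (lieAlg G)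
  𝔞_le_𝔭 : ∀ X ∈ 𝔞, θ X = -X
  𝔞_abelian : ∀ X ∈ 𝔞, ∀ Y ∈ 𝔞, ⁅X, Y⁆ = 0
  𝔞_maximal : ∀ 𝔟 : Submodule ℝ (lieAlg G), (∀ X ∈ 𝔟, θ X = -X) →
    (∀ X ∈ 𝔟, ∀ Y ∈ 𝔟, ⁅X, Y⁆ = 0) → 𝔞 ≤ 𝔟 → 𝔟 = 𝔞
  /-- a regular element, singling out the positive Weyl chamber -/
  H₀ : 𝔞
  H₀_regular : ∀ α : Module.Dual ℝ 𝔞, IsRoot 𝔞 α → α H₀ ≠ 0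
  /-- an element of `K` which normalizes `𝔞` and maps `𝔞⁺` to `-𝔞⁺` -/
  w₀ : G
  w₀_mem : w₀ ∈ K
  w₀_normalizes : ∀ v : 𝔞, ∃ u : 𝔞,
    toMat w₀ * ((v : lieAlg G) : Matrix (Fin n) (Fin n) ℝ) * toMat w₀⁻¹ = ((u : lieAlg G) : _)
  w₀_chamber : ∀ v u : 𝔞,
    toMat w₀ * ((v : lieAlg G) : Matrix (Fin n) (Fin n) ℝ) * toMat w₀⁻¹ = ((u : lieAlg G) : _) →
      (v ∈ weylChamber 𝔞 H₀ ↔ -u ∈ weylChamber 𝔞 H₀)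

namespace CartanData

variable {G : Subgroup (GL (Fin n) ℝ)} (D : CartanData G)

instance : MeasurableSpace D.𝔞 := borel D.𝔞

instance : BorelSpace D.𝔞 := ⟨rfl⟩

/-- `A = exp 𝔞`. -/
def A : Subgroup G :=
  Subgroup.closure {g | ∃ X ∈ D.𝔞, toMat g = NormedSpace.exp (X : Matrix (Fin n) (Fin n) ℝ)}

/-- The sum `𝔫` of the positive root spaces. -/
def 𝔫 : Submodule ℝ (lieAlg G) :=
  ⨆ α ∈ {α : Module.Dual ℝ D.𝔞 | IsRoot D.𝔞 α ∧ 0 < α D.H₀}, rootSpace D.𝔞 α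

/-- `N = exp 𝔫`. -/
def N : Subgroup G :=
  Subgroup.closure {g | ∃ X ∈ D.𝔫, toMat g = NormedSpace.exp (X : Matrix (Fin n) (Fin n) ℝ)}

/-- `M`, the centralizer of `𝔞` (equivalently, of `A`) in `K`. -/
def M : Subgroup G where
  carrier := {k | k ∈ D.K ∧ ∀ X ∈ D.𝔞,
    toMat k * (X : Matrix (Fin n) (Fin n) ℝ) = (X : Matrix (Fin n) (Fin n) ℝ) * toMat k}
  mul_mem' := by
    rintro a b ⟨ha, ha'⟩ ⟨hb, hb'⟩
    refine ⟨D.K.mul_mem ha hb, fun X hX => ?_⟩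
    have e : toMat (a * b) = toMat a * toMat b := rfl
    rw [e, mul_assoc, hb' X hX, ← mul_assoc, ha' X hX, mul_assoc]
  one_mem' := by
    refine ⟨D.K.one_mem, fun X _ => ?_⟩
    have e : toMat (1 : G) = 1 := rfl
    rw [e, one_mul, mul_one]
  inv_mem' := by
    rintro a ⟨ha, ha'⟩
    refine ⟨D.K.inv_mem ha, fun X hX => ?_⟩
    have e1 : toMat a⁻¹ * toMat a = 1 := by
      change toMat (a⁻¹ * a) = 1
      rw [inv_mul_cancel]
      rfl
    have e2 : toMat a * toMat a⁻¹ = 1 := by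
      change toMat (a * a⁻¹) = 1
      rw [mul_inv_cancel]
      rfl
    calc toMat a⁻¹ * (X : Matrix (Fin n) (Fin n) ℝ)
        = toMat a⁻¹ * ((X : Matrix (Fin n) (Fin n) ℝ) * toMat a) * toMat a⁻¹ := by
          rw [mul_assoc, mul_assoc, e2, mul_one]
      _ = (X : Matrix (Fin n) (Fin n) ℝ) * toMat a⁻¹ := by
          rw [← ha' X hX, ← mul_assoc, e1, one_mul]

/-- The minimal parabolic subgroup `P = MAN`. -/
def P : Subgroup G := D.M ⊔ D.A ⊔ D.N

lemma continuous_toMat : Continuous (toMat : G → Matrix (Fin n) (Fin n) ℝ) :=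
  Units.continuous_val.comp continuous_subtype_val

instance : CompactSpace D.M := by
  refine isCompact_iff_compactSpace.mp (?_ : IsCompact (D.M : Set G))
  have h : IsClosed {k : G | ∀ X ∈ D.𝔞,
      toMat k * (X : Matrix (Fin n) (Fin n) ℝ) = (X : Matrix (Fin n) (Fin n) ℝ) * toMat k} := by
    simp only [Set.ofPred_forall]
    refine isClosed_iInter fun X => isClosed_iInter fun _ => isClosed_eq ?_ ?_
    · exact continuous_toMat.mul continuous_const
    · exact continuous_const.mul continuous_toMat
  exact D.isCompact_K.inter_right h

/-- The Iwasawa cocycle: `H g` is the element of `𝔞` with `g ∈ K exp (H g) N`. -/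
def H (g : G) : D.𝔞 :=
  open Classical in
  if h : ∃ v : D.𝔞, ∃ k ∈ D.K, ∃ a : G, ∃ u ∈ D.N,
      toMat a = NormedSpace.exp ((v : lieAlg G) : Matrix (Fin n) (Fin n) ℝ) ∧ g = k * a * u
  then h.choose else 0

/-! ### The symmetric space, the Furstenberg boundary and the space `G/M` -/

/-- The Riemannian symmetric space `X = G/K`. -/
def X : Type := G ⧸ D.K

/-- The Furstenberg boundary `𝓕 = G/P`. -/
def F : Type := G ⧸ D.P

/-- The homogeneous space `G/M`. -/
def GM : Type := G ⧸ D.M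

instance : TopologicalSpace D.X := inferInstanceAs (TopologicalSpace (G ⧸ D.K))
instance : MulAction G D.X := inferInstanceAs (MulAction G (G ⧸ D.K))
instance : MeasurableSpace D.X := borel D.X
instance : BorelSpace D.X := ⟨rfl⟩

instance : TopologicalSpace D.F := inferInstanceAs (TopologicalSpace (G ⧸ D.P))
instance : MulAction G D.F := inferInstanceAs (MulAction G (G ⧸ D.P))
instance : ContinuousConstSMul G D.F := inferInstanceAs (ContinuousConstSMul G (G ⧸ D.P))
instance : MeasurableSpace D.F := borel D.F
instance : BorelSpace D.F := ⟨rfl⟩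

instance : TopologicalSpace D.GM := inferInstanceAs (TopologicalSpace (G ⧸ D.M))
instance : MeasurableSpace D.GM := borel D.GM
instance : BorelSpace D.GM := ⟨rfl⟩

/-- The orbit map `g ↦ g o`, where `o = [K]`. -/
def toX (g : G) : D.X := (QuotientGroup.mk g : G ⧸ D.K)

/-- The base point `o = [K]`. -/
def o : D.X := D.toX 1

/-- The visual map `g ↦ g⁺ = gP`. -/
def plus (g : G) : D.F := (QuotientGroup.mk g : G ⧸ D.P)

/-- The visual map `g ↦ g⁻ = g w₀ P`. -/
def minus (g : G) : D.F := (QuotientGroup.mk (g * D.w₀) : G ⧸ D.P)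

/-- A representative in `G` of a point of `X`. -/
def repX (x : D.X) : G := Quotient.out (s := QuotientGroup.leftRel D.K) x

/-- A representative in `G` of a point of `𝓕`. -/
def repF (ξ : D.F) : G := Quotient.out (s := QuotientGroup.leftRel D.P) ξ

/-- A representative in `G` of a point of `G/M`. -/
def repGM (q : D.GM) : G := Quotient.out (s := QuotientGroup.leftRel D.M) q

/-- The `𝔞`-valued Busemann map: `β_{hP}(g o, g' o) = H(g⁻¹h) - H(g'⁻¹h)`. The right-hand side does
not depend on the representatives, and for `h ∈ K` it is the usual formula. -/
def busemann (ξ : D.F) (x y : D.X) : D.𝔞 :=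
  D.H ((D.repX x)⁻¹ * D.repF ξ) - D.H ((D.repX y)⁻¹ * D.repF ξ)

/-! ### The Riemannian distance on `X` -/

/-- The norm, with respect to the Killing form, of the `𝔭`-component of `Z ∈ 𝔤 = 𝔨 ⊕ 𝔭`. For
`g ∈ G` this is the Riemannian norm of the tangent vector to `t ↦ g exp(tZ) o` at `t = 0`. -/
def pNorm (Z : lieAlg G) : ℝ :=
  Real.sqrt (killingForm ℝ (lieAlg G) ((1 / 2 : ℝ) • (Z - D.θ Z)) ((1 / 2 : ℝ) • (Z - D.θ Z)))

/-- `L` is the length of a `C¹` curve in `X` from `x` to `y`. The curve is `t ↦ c(t) o`,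
`0 ≤ t ≤ 1`, for a `C¹` curve `c` in `G` with continuous logarithmic derivative `u = c⁻¹ c'`. -/
def IsCurveLength (x y : D.X) (L : ℝ) : Prop :=
  ∃ (c : ℝ → G) (u : ℝ → lieAlg G), Continuous u ∧
    (∀ (t : ℝ) (i j : Fin n), HasDerivAt (fun s => toMat (c s) i j)
      ((toMat (c t) * (u t : Matrix (Fin n) (Fin n) ℝ)) i j) t) ∧
    D.toX (c 0) = x ∧ D.toX (c 1) = y ∧ L = ∫ t in (0 : ℝ)..1, D.pNorm (u t)

/-- The Riemannian distance on `X`, for the metric induced by the Killing form. -/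
def dist (x y : D.X) : ℝ := sInf {L | D.IsCurveLength x y L}

end CartanData

/-! ### Quotients by `Γ` and induced measures -/

/-- The quotient `Γ\Y`, with the quotient topology and its Borel `σ`-algebra. -/
def LeftQuot (Γ : Type*) [Group Γ] (Y : Type*) [MulAction Γ Y] : Type _ :=
  MulAction.orbitRel.Quotient Γ Y

section LeftQuot

variable (Γ : Type*) [Group Γ] {Y : Type*} [MulAction Γ Y] [TopologicalSpace Y]

instance : TopologicalSpace (LeftQuot Γ Y) :=
  inferInstanceAs (TopologicalSpace (Quotient (MulAction.orbitRel Γ Y)))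
instance : MeasurableSpace (LeftQuot Γ Y) := borel _
instance : BorelSpace (LeftQuot Γ Y) := ⟨rfl⟩

/-- The projection `Y → Γ\Y`. -/
def LeftQuot.mk (y : Y) : LeftQuot Γ Y := Quotient.mk (MulAction.orbitRel Γ Y) y

/-- The measure on `Γ\Y` induced by a `Γ`-invariant measure `μ` on `Y`: the least measure for which
the projection does not decrease the measure of the Borel sets on which it is injective. If `B` is
a Borel fundamental domain, this is the image of the restriction of `μ` to `B`. -/
def inducedMeasure [MeasurableSpace Y] (μ : Measure Y) : Measure (LeftQuot Γ Y) :=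
  ⨆ B : {B : Set Y // MeasurableSet B ∧ Set.InjOn (LeftQuot.mk Γ) B},
    (μ.restrict B.1).map (LeftQuot.mk Γ)

end LeftQuot

/-! ### Conformal densities and Bowen-Margulis-Sullivan measures -/

variable {G : Subgroup (GL (Fin n) ℝ)}

/-- A `(Γ, ψ)`-conformal density on `𝓕`. -/
structure ConformalDensity (D : CartanData G) (Γ : Subgroup G) (ψ : Module.Dual ℝ D.𝔞) where
  meas : D.X → Measure D.F
  finite : ∀ x, IsFiniteMeasure (meas x)
  density : ∀ x y, meas x =
    (meas y).withDensity fun ξ => ENNReal.ofReal (Real.exp (-ψ (D.busemann ξ x y)))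
  equivariant : ∀ (γ : Γ) (x : D.X), (meas x).map (fun ξ => (γ : G) • ξ) = meas ((γ : G) • x)

variable {D : CartanData G} {Γ : Subgroup G} {ψ ψ₁ ψ₂ : Module.Dual ℝ D.𝔞}

/-- The function `E_ν([x]) = |ν_x|` on `Γ\X`. -/
def ConformalDensity.E (ν : ConformalDensity D Γ ψ) : LeftQuot Γ D.X → ℝ≥0∞ :=
  Quotient.lift (s := MulAction.orbitRel Γ D.X) (fun x => ν.meas x Set.univ) (by
    intro x y h
    obtain ⟨γ, rfl⟩ := MulAction.orbitRel_apply.mp h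
    change ν.meas ((γ : G) • y) Set.univ = _
    rw [← ν.equivariant γ y, Measure.map_apply (continuous_const_smul (γ : G)).measurable
      MeasurableSet.univ, Set.preimage_univ])

/-- The Hopf parametrization `gM ↦ (g⁺, g⁻, β_{g⁻}(o, g o))`, which identifies `G/M` with
`𝓕⁽²⁾ × 𝔞 ⊆ 𝓕 × 𝓕 × 𝔞`. -/
def hopf (D : CartanData G) (q : D.GM) : D.F × D.F × D.𝔞 :=
  (D.plus (D.repGM q), D.minus (D.repGM q),
    D.busemann (D.minus (D.repGM q)) D.o (D.toX (D.repGM q)))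

/-- The measure on `G/M` given in Hopf coordinates by
`exp (ψ₁ (β_{g⁺}(o, g o)) + ψ₂ (β_{g⁻}(o, g o))) dν_o(g⁺) dν̄_o(g⁻) dv`, where `dv` is the Lebesgue
measure `ℓ` on `𝔞`. -/
def bmsGM (ℓ : Measure D.𝔞) (ν : ConformalDensity D Γ ψ₁) (ν' : ConformalDensity D Γ ψ₂) :
    Measure D.GM :=
  (((ν.meas D.o).prod ((ν'.meas D.o).prod ℓ)).comap (hopf D)).withDensity fun q =>
    ENNReal.ofReal (Real.exp
      (ψ₁ (D.busemann (D.plus (D.repGM q)) D.o (D.toX (D.repGM q))) +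
        ψ₂ (D.busemann (D.minus (D.repGM q)) D.o (D.toX (D.repGM q)))))

/-- Its right `M`-invariant lift to `G`: integrate over the fibres `gM` with respect to the Haar
probability measure of `M`. -/
def bmsG (ℓ : Measure D.𝔞) (ν : ConformalDensity D Γ ψ₁) (ν' : ConformalDensity D Γ ψ₂) :
    Measure G :=
  (bmsGM ℓ ν ν').bind fun q =>
    (Measure.haarMeasure (⊤ : TopologicalSpace.PositiveCompacts D.M)).map
      fun m : D.M => D.repGM q * (m : G)

/-- The generalized Bowen-Margulis-Sullivan measure `m_{ν,ν̄}` on `Γ\G`. -/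
def bms (ℓ : Measure D.𝔞) (ν : ConformalDensity D Γ ψ₁) (ν' : ConformalDensity D Γ ψ₂) :
    Measure (LeftQuot Γ G) :=
  inducedMeasure Γ (bmsG ℓ ν ν')

/-- The points of `Γ\X` at distance less than one from (the image in `Γ\X` of) `S ⊆ Γ\G`. -/
def oneNeighborhood (D : CartanData G) (Γ : Subgroup G) (S : Set (LeftQuot Γ G)) :
    Set (LeftQuot Γ D.X) :=
  {p | ∃ (x : D.X) (g : G), LeftQuot.mk Γ x = p ∧ LeftQuot.mk Γ g ∈ S ∧ D.dist x (D.toX g) < 1}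

end Smearing

end

/-! The mass of `Γ\G` is smeared over `Γ\X`. Let `V = B o` be a small open set around `o`. For fixed
`g` the set of `x` with `x ∈ gV` has volume `vol V`. Fubini and unfolding over a Borel fundamental
domain `F` of `Γ` in `X` then bound `vol V` times the total mass by the integral over `x ∈ F` of the
mass of those `g`, lying over the support, with `x ∈ gV` (`inducedMeasure_le_lintegral`). Such an
`x` is at distance less than one from `g o`, so only points of the one-neighborhood contribute.

The inner mass is at most a constant times `E_ν(x) E_ν̄(x)` (`bmsG_inv_smul_mem_le`). Conformality
and the cocycle identity `β_ξ(o, go) = β_ξ(o, x) + β_ξ(x, go)` allow the measure to be rewritten in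
Hopf coordinates based at `x` as `exp(ψ₁ β_{g⁺}(x, go) + ψ₂ β_{g⁻}(x, go)) dν_x dν̄_x dv`. When `x ∈
gV`, both Busemann vectors lie in a compact set `L ⊂ 𝔞` independent of `g` and `x`
(`exists_isCompact_busemann_mem`). The exponential is therefore bounded, the `𝔞`-coordinate ranges
over a translate of `L`, and the two boundary integrals are at most `|ν_x|` and `|ν̄_x|`. The
resulting constant depends on `ψ₁`, `ψ₂`, `B`, `L` and the normalizations, but not on the densities.

Two foundations carry this. The Iwasawa decomposition `G = KAN`, with a unique `A`-part and a
continuous `H`, makes `β` a continuous equivariant cocycle; it is built from the Lie algebra of a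
closed linear group. The `Γ`-invariance of the measure on `G` comes from comparing the Jacobian of
the action in Hopf coordinates with the density (`map_smulGM_bmsGM`). The Hopf map is never shown to
be injective: only an upper bound for its pulled-back measure is needed. -/

noncomputable section

namespace Smearing

open Filter

variable {n : ℕ}

/-! ### One-parameter subgroups of closed linear groups -/

section ClosedSubgroups

open scoped Matrix.Norms.Operator

/-- A sequence of matrices tending to `1` with velocity `X` has powers tending to `exp (s X)`. -/
lemma tendsto_pow_floor_exp {x : ℕ → Matrix (Fin n) (Fin n) ℝ} {t : ℕ → ℝ}
    {X : Matrix (Fin n) (Fin n) ℝ} (ht : ∀ i, 0 < t i) (ht0 : Tendsto t atTop (𝓝 0))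
    (hx : Tendsto (fun i => (t i)⁻¹ • (x i - 1)) atTop (𝓝 X)) {s : ℝ} (hs : 0 ≤ s) :
    Tendsto (fun i => x i ^ ⌊s / t i⌋₊) atTop (𝓝 (NormedSpace.exp (s • X))) := by
  have hexp : HasStrictFDerivAt (NormedSpace.exp : Matrix (Fin n) (Fin n) ℝ → _)
      ((ContinuousLinearEquiv.refl ℝ (Matrix (Fin n) (Fin n) ℝ) :
        Matrix (Fin n) (Fin n) ℝ →L[ℝ] Matrix (Fin n) (Fin n) ℝ)) 0 :=
    hasStrictFDerivAt_exp_zero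
  -- A local logarithm turns the power into `exp (m • lg (x i))` with `m = ⌊s / t i⌋₊`. Here `lg (x
  -- i) / t i` tends to `X` and `m * t i` tends to `s`.
  set lg := hexp.localInverse with hlg
  have hlg1 : HasFDerivAt lg
      (ContinuousLinearMap.id ℝ (Matrix (Fin n) (Fin n) ℝ)) 1 := by
    have := hexp.to_localInverse.hasFDerivAt
    rw [NormedSpace.exp_zero] at this
    exact this
  have hlg0 : lg 1 = 0 := by
    have := hexp.localInverse_apply_image
    rwa [NormedSpace.exp_zero] at this
  have hd : Tendsto (fun i => x i - 1) atTop (𝓝 0) := by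
    have := ht0.smul hx
    rw [zero_smul] at this
    refine this.congr fun i => ?_
    rw [smul_smul, mul_inv_cancel₀ (ht i).ne', one_smul]
  have hx1 : Tendsto x atTop (𝓝 1) := by
    simpa using hd.add_const 1
  have hev : ∀ᶠ i in atTop, NormedSpace.exp (lg (x i)) = x i := by
    have := hexp.eventually_right_inverse
    rw [NormedSpace.exp_zero] at this
    exact hx1.eventually this
  have hlim : Tendsto (fun i => (t i)⁻¹ • lg (x i)) atTop (𝓝 X) := by
    have := (hasFDerivWithinAt_univ.2 hlg1).lim (l := atTop) (c := fun i => (t i)⁻¹)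
      (d := fun i => x i - 1) (v := X) hd (Eventually.of_forall fun _ => Set.mem_univ _) hx
    simpa [hlg0] using this
  have hfl : Tendsto (fun i => (⌊s / t i⌋₊ : ℝ) * t i) atTop (𝓝 s) := by
    have h1 : Tendsto (fun i => s - t i) atTop (𝓝 s) := by simpa using ht0.const_sub s
    refine tendsto_of_tendsto_of_tendsto_of_le_of_le h1 tendsto_const_nhds (fun i => ?_)
      (fun i => ?_)
    · have := Nat.lt_floor_add_one (s / t i)
      rw [div_lt_iff₀ (ht i)] at this
      simp only
      nlinarith [ht i]
    · have := Nat.floor_le (div_nonneg hs (ht i).le)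
      rwa [le_div_iff₀ (ht i)] at this
  have hfin := (NormedSpace.exp_continuous (𝔸 := Matrix (Fin n) (Fin n) ℝ)).continuousAt.tendsto.comp
    (hfl.smul hlim)
  refine hfin.congr' ?_
  filter_upwards [hev] with i hi
  simp only [Function.comp]
  rw [smul_smul, mul_assoc, mul_inv_cancel₀ (ht i).ne', mul_one, Nat.cast_smul_eq_nsmul]
  exact (NormedSpace.exp_nsmul _ _).trans (congrArg (· ^ ⌊s / t i⌋₊) hi)

variable {G : Subgroup (GL (Fin n) ℝ)}

/-- The matrices `X` which generate a one-parameter subgroup of `G`. -/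
def oneParamSet (G : Subgroup (GL (Fin n) ℝ)) : Set (Matrix (Fin n) (Fin n) ℝ) :=
  {X | ∀ t : ℝ, ∃ g ∈ G, (g : Matrix (Fin n) (Fin n) ℝ) = NormedSpace.exp (t • X)}

lemma exists_mem_of_tendsto (hG : IsClosed (G : Set (GL (Fin n) ℝ)))
    {x : ℕ → Matrix (Fin n) (Fin n) ℝ} {u : GL (Fin n) ℝ}
    (hx : ∀ i, ∃ g ∈ G, (g : Matrix (Fin n) (Fin n) ℝ) = x i)
    (h : Tendsto x atTop (𝓝 (u : Matrix (Fin n) (Fin n) ℝ))) : u ∈ G := by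
  choose g hg hgx using hx
  have h1 : Tendsto g atTop (𝓝 u) := by
    refine (Units.isOpenEmbedding_val (R := Matrix (Fin n) (Fin n) ℝ)).isEmbedding.tendsto_nhds_iff.2 ?_
    exact h.congr fun i => (hgx i).symm
  exact hG.mem_of_tendsto h1 (Eventually.of_forall hg)

/-- The powers `x i ^ ⌊s / t i⌋₊` stay in the closed group `G` and converge to `exp (s X)`; negative
times follow by inversion. -/
lemma mem_oneParamSet_of_tendsto (hG : IsClosed (G : Set (GL (Fin n) ℝ)))
    {x : ℕ → Matrix (Fin n) (Fin n) ℝ} {t : ℕ → ℝ} {X : Matrix (Fin n) (Fin n) ℝ}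
    (hxG : ∀ i, ∃ g ∈ G, (g : Matrix (Fin n) (Fin n) ℝ) = x i)
    (ht : ∀ i, 0 < t i) (ht0 : Tendsto t atTop (𝓝 0))
    (hx : Tendsto (fun i => (t i)⁻¹ • (x i - 1)) atTop (𝓝 X)) : X ∈ oneParamSet G := by
  have key : ∀ s : ℝ, 0 ≤ s → ∃ g ∈ G, (g : Matrix (Fin n) (Fin n) ℝ) = NormedSpace.exp (s • X) := by
    intro s hs
    refine ⟨(Matrix.isUnit_exp (s • X)).unit, ?_, rfl⟩
    refine exists_mem_of_tendsto hG (x := fun i => x i ^ ⌊s / t i⌋₊) (fun i => ?_)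
      (tendsto_pow_floor_exp ht ht0 hx hs)
    obtain ⟨g, hg, hgx⟩ := hxG i
    exact ⟨g ^ ⌊s / t i⌋₊, G.pow_mem hg _, by rw [Units.val_pow_eq_pow_val, hgx]⟩
  intro s
  rcases le_total 0 s with hs | hs
  · exact key s hs
  · obtain ⟨g, hg, hgs⟩ := key (-s) (by linarith)
    refine ⟨g⁻¹, G.inv_mem hg, ?_⟩
    rw [Matrix.coe_units_inv, hgs, neg_smul, Matrix.exp_neg, Matrix.nonsing_inv_nonsing_inv]
    exact (Matrix.isUnit_iff_isUnit_det _).1 (Matrix.isUnit_exp _)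

lemma mem_oneParamSet_of_hasDerivAt (hG : IsClosed (G : Set (GL (Fin n) ℝ)))
    {c : ℝ → Matrix (Fin n) (Fin n) ℝ} {X : Matrix (Fin n) (Fin n) ℝ}
    (hcG : ∀ t, ∃ g ∈ G, (g : Matrix (Fin n) (Fin n) ℝ) = c t) (hc0 : c 0 = 1)
    (hc : HasDerivAt c X 0) : X ∈ oneParamSet G := by
  have h0 : Tendsto (fun i : ℕ => (1 / ((i : ℝ) + 1))) atTop (𝓝 0) :=
    tendsto_one_div_add_atTop_nhds_zero_nat
  refine mem_oneParamSet_of_tendsto hG (x := fun i : ℕ => c (1 / ((i : ℝ) + 1)))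
    (fun i => hcG _) (fun i => by positivity) h0 ?_
  have h1 := hasDerivAt_iff_tendsto_slope_zero.1 hc
  have h2 : Tendsto (fun i : ℕ => (1 / ((i : ℝ) + 1))) atTop (𝓝[≠] 0) :=
    tendsto_nhdsWithin_iff.2 ⟨h0, Eventually.of_forall fun i => by
      simp only [Set.mem_compl_iff, Set.mem_singleton_iff]; positivity⟩
  have h3 := h1.comp h2
  simp only [Function.comp_def, zero_add, hc0] at h3
  exact h3

lemma hasDerivAt_exp_smul_zero (X : Matrix (Fin n) (Fin n) ℝ) :
    HasDerivAt (fun t : ℝ => NormedSpace.exp (t • X)) X 0 := by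
  have h := hasDerivAt_exp_smul_const (𝕂 := ℝ) X (0 : ℝ)
  rw [zero_smul, NormedSpace.exp_zero, one_mul] at h
  exact h

lemma conj_mem_oneParamSet {g : GL (Fin n) ℝ} (hg : g ∈ G) {X : Matrix (Fin n) (Fin n) ℝ}
    (hX : X ∈ oneParamSet G) :
    (g : Matrix (Fin n) (Fin n) ℝ) * X * ((g⁻¹ : GL (Fin n) ℝ) : Matrix (Fin n) (Fin n) ℝ)
      ∈ oneParamSet G := by
  intro t
  obtain ⟨h, hh, hht⟩ := hX t
  refine ⟨g * h * g⁻¹, G.mul_mem (G.mul_mem hg hh) (G.inv_mem hg), ?_⟩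
  rw [Units.val_mul, Units.val_mul, hht, ← Matrix.exp_units_conj, mul_smul_comm, smul_mul_assoc]

/-- For closed `G` the generators of one-parameter subgroups form a linear subspace. -/
def tangentSpace (hG : IsClosed (G : Set (GL (Fin n) ℝ))) :
    Submodule ℝ (Matrix (Fin n) (Fin n) ℝ) where
  carrier := oneParamSet G
  zero_mem' t := ⟨1, G.one_mem, by simp⟩
  add_mem' := by
    intro X Y hX hY
    refine mem_oneParamSet_of_hasDerivAt hG
      (c := fun t => NormedSpace.exp (t • X) * NormedSpace.exp (t • Y)) (fun t => ?_) (by simp) ?_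
    · obtain ⟨g, hg, h1⟩ := hX t
      obtain ⟨h, hh, h2⟩ := hY t
      exact ⟨g * h, G.mul_mem hg hh, by rw [Units.val_mul, h1, h2]⟩
    · have h := (hasDerivAt_exp_smul_zero X).mul (hasDerivAt_exp_smul_zero Y)
      simp only [zero_smul, NormedSpace.exp_zero, one_mul, mul_one] at h
      exact h
  smul_mem' := by
    intro c X hX t
    rw [smul_smul]
    exact hX _

/-- The bracket is the derivative at `0` of `exp (tX) Y exp (-tX)`, a curve in a finite-dimensional,
hence closed, subspace. -/
lemma lie_mem_tangentSpace (hG : IsClosed (G : Set (GL (Fin n) ℝ)))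
    {X Y : Matrix (Fin n) (Fin n) ℝ} (hX : X ∈ tangentSpace hG) (hY : Y ∈ tangentSpace hG) :
    ⁅X, Y⁆ ∈ tangentSpace hG := by
  have hd : HasDerivAt (fun t : ℝ => NormedSpace.exp (t • X) * Y * NormedSpace.exp (t • (-X)))
      (X * Y - Y * X) 0 := by
    have := ((hasDerivAt_exp_smul_zero X).mul_const Y).mul (hasDerivAt_exp_smul_zero (-X))
    simp only [zero_smul, NormedSpace.exp_zero, one_mul, mul_one, mul_neg, ← sub_eq_add_neg]
      at this
    exact this
  have hcl : IsClosed (tangentSpace hG : Set (Matrix (Fin n) (Fin n) ℝ)) :=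
    Submodule.closed_of_finiteDimensional _
  have hmem : ∀ t : ℝ,
      NormedSpace.exp (t • X) * Y * NormedSpace.exp (t • (-X)) ∈ tangentSpace hG := by
    intro t
    obtain ⟨g, hg, hgt⟩ := hX t
    have h := conj_mem_oneParamSet hg hY
    rw [Matrix.coe_units_inv, hgt, ← Matrix.exp_neg, ← smul_neg] at h
    exact h
  rw [LieRing.of_associative_ring_bracket]
  have h1 := hasDerivAt_iff_tendsto_slope_zero.1 hd
  refine hcl.mem_of_tendsto h1 (Eventually.of_forall fun t => ?_)
  refine (tangentSpace hG).smul_mem _ ((tangentSpace hG).sub_mem (hmem _) (hmem _))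

lemma mem_lieAlg_iff (hG : IsClosed (G : Set (GL (Fin n) ℝ))) {X : Matrix (Fin n) (Fin n) ℝ} :
    X ∈ lieAlg G ↔ X ∈ oneParamSet G := by
  refine ⟨fun h => ?_, fun h => LieSubalgebra.subset_lieSpan h⟩
  let T : LieSubalgebra ℝ (Matrix (Fin n) (Fin n) ℝ) :=
    { tangentSpace hG with lie_mem' := fun hX hY => lie_mem_tangentSpace hG hX hY }
  have : lieAlg G ≤ T := LieSubalgebra.lieSpan_le.2 fun X hX => hX
  exact this h

/-- Otherwise there are nonzero `w i → 0` in `C` with `exp (w i) ∈ G`. By compactness of the unit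
sphere their directions accumulate at a unit vector of `C`, which generates a one-parameter subgroup
of `G` and so lies in `lieAlg G ∩ C = 0`. -/
lemma exists_nhds_exp_mem_imp_eq_zero (hG : IsClosed (G : Set (GL (Fin n) ℝ)))
    {C : Submodule ℝ (Matrix (Fin n) (Fin n) ℝ)} (hC : Disjoint (lieAlg G).toSubmodule C) :
    ∀ᶠ w : C in 𝓝 0, (∃ g ∈ G, (g : Matrix (Fin n) (Fin n) ℝ) =
      NormedSpace.exp (w : Matrix (Fin n) (Fin n) ℝ)) → w = 0 := by
  by_contra hcon
  rw [not_eventually] at hcon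
  have : (𝓝 (0 : C)).IsCountablyGenerated :=
    (Metric.nhds_basis_ball_inv_nat_succ (x := (0 : C))).isCountablyGenerated
  obtain ⟨w, hw0, hw⟩ := exists_seq_forall_of_frequently hcon
  have hw' : ∀ i, (∃ g ∈ G, (g : Matrix (Fin n) (Fin n) ℝ) =
      NormedSpace.exp (w i : Matrix (Fin n) (Fin n) ℝ)) ∧ w i ≠ 0 := fun i => by
    have := hw i
    push Not at this
    exact this
  have hpos : ∀ i, 0 < ‖w i‖ := fun i => norm_pos_iff.2 (hw' i).2
  have hs : ∀ i, ‖w i‖⁻¹ • w i ∈ Metric.sphere (0 : C) 1 := fun i => by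
    rw [mem_sphere_zero_iff_norm, norm_smul, norm_inv, norm_norm, inv_mul_cancel₀ (hpos i).ne']
  obtain ⟨W, hW, φ, hφ, hlim⟩ := (isCompact_sphere (0 : C) 1).tendsto_subseq hs
  have hnorm : Tendsto (fun i => ‖w (φ i)‖) atTop (𝓝 0) := by
    have := (hw0.comp hφ.tendsto_atTop).norm
    simpa using this
  have hexp : HasFDerivAt (NormedSpace.exp : Matrix (Fin n) (Fin n) ℝ → _)
      (ContinuousLinearMap.id ℝ (Matrix (Fin n) (Fin n) ℝ)) 0 := hasFDerivAt_exp_zero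
  have hlimW : Tendsto (fun i => ‖w (φ i)‖⁻¹ • (w (φ i) : Matrix (Fin n) (Fin n) ℝ)) atTop
      (𝓝 (W : Matrix (Fin n) (Fin n) ℝ)) :=
    (continuous_subtype_val.tendsto W).comp hlim
  have hw0' : Tendsto (fun i => (w (φ i) : Matrix (Fin n) (Fin n) ℝ)) atTop (𝓝 0) :=
    (continuous_subtype_val.tendsto (0 : C)).comp (hw0.comp hφ.tendsto_atTop)
  have hmem : (W : Matrix (Fin n) (Fin n) ℝ) ∈ oneParamSet G := by
    refine mem_oneParamSet_of_tendsto hG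
      (x := fun i => NormedSpace.exp (w (φ i) : Matrix (Fin n) (Fin n) ℝ))
      (fun i => (hw' (φ i)).1) (fun i => hpos (φ i)) hnorm ?_
    have := (hasFDerivWithinAt_univ.2 hexp).lim (l := atTop) (c := fun i => ‖w (φ i)‖⁻¹)
      (d := fun i => (w (φ i) : Matrix (Fin n) (Fin n) ℝ))
      (v := (W : Matrix (Fin n) (Fin n) ℝ)) hw0' (Eventually.of_forall fun _ => Set.mem_univ _)
      hlimW
    simpa using this
  have h0 : (W : Matrix (Fin n) (Fin n) ℝ) = 0 :=
    Submodule.disjoint_def.1 hC _ ((mem_lieAlg_iff hG).2 hmem) W.2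
  have : W = 0 := Subtype.ext h0
  rw [this] at hW
  simp at hW

/-- A map into a closed linear group `G` whose differential at a point over `1` is onto the Lie
algebra covers a neighbourhood of `1` in `G`. -/
lemma image_mem_nhds_one (hG : IsClosed (G : Set (GL (Fin n) ℝ)))
    {E : Type*} [NormedAddCommGroup E] [NormedSpace ℝ E] [CompleteSpace E] {f : E → G}
    (hf0 : f 0 = 1) {f' : E →L[ℝ] Matrix (Fin n) (Fin n) ℝ}
    (hf : HasStrictFDerivAt (fun e => toMat (f e)) f' 0)
    (hf' : ∀ X ∈ lieAlg G, ∃ e, f' e = X) {U : Set E} (hU : U ∈ 𝓝 0) : f '' U ∈ 𝓝 (1 : G) := by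
  -- The map `(e, w) ↦ f e * exp w`, with `w` in a complement of the Lie algebra, is a submersion
  -- onto the matrices and so covers a neighbourhood of `1`. A value in `G` has `exp w ∈ G`, which
  -- forces `w = 0` when `w` is small.
  obtain ⟨C, hC⟩ := Submodule.exists_isCompl (lieAlg G).toSubmodule
  have h1 : HasStrictFDerivAt (fun p : E × C => toMat (f p.1))
      (f'.comp (ContinuousLinearMap.fst ℝ E C)) (0 : E × C) :=
    HasStrictFDerivAt.comp (g := fun e => toMat (f e)) (f := Prod.fst) (0 : E × C) hf
      hasStrictFDerivAt_fst
  have h2 : HasStrictFDerivAt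
      (fun p : E × C => NormedSpace.exp (p.2 : Matrix (Fin n) (Fin n) ℝ))
      (C.subtypeL.comp (ContinuousLinearMap.snd ℝ E C)) (0 : E × C) := by
    have := HasStrictFDerivAt.comp (g := (NormedSpace.exp : Matrix (Fin n) (Fin n) ℝ → _))
      (f := fun p : E × C => (p.2 : Matrix (Fin n) (Fin n) ℝ)) (0 : E × C)
      (hasStrictFDerivAt_exp_zero (𝕂 := ℝ))
      (C.subtypeL.comp (ContinuousLinearMap.snd ℝ E C)).hasStrictFDerivAt
    exact this
  have h3 := h1.mul' h2
  have hm := h3.map_nhds_eq_of_surj (by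
    rw [LinearMap.range_eq_top]
    intro Y
    obtain ⟨X, hX, W, hW, rfl⟩ := Submodule.mem_sup.1
      (hC.codisjoint.eq_top ▸ Submodule.mem_top : Y ∈ (lieAlg G).toSubmodule ⊔ C)
    obtain ⟨e, rfl⟩ := hf' X hX
    refine ⟨(e, ⟨W, hW⟩), ?_⟩
    have e1 : toMat (1 : G) = 1 := rfl
    simp only [Prod.fst_zero, hf0, e1, Prod.snd_zero, ZeroMemClass.coe_zero,
      NormedSpace.exp_zero, MulOpposite.op_one]
    change (1 : Matrix (Fin n) (Fin n) ℝ) * W + f' e * 1 = f' e + W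
    rw [one_mul, mul_one, add_comm])
  have e1 : toMat (1 : G) = 1 := rfl
  have hval : toMat (f (0 : E × C).1) *
      NormedSpace.exp (((0 : E × C).2 : C) : Matrix (Fin n) (Fin n) ℝ) = 1 := by
    simp [hf0, e1]
  have hZ := exists_nhds_exp_mem_imp_eq_zero hG hC.disjoint
  have hUZ : U ×ˢ {w : C | (∃ g ∈ G, (g : Matrix (Fin n) (Fin n) ℝ) =
      NormedSpace.exp (w : Matrix (Fin n) (Fin n) ℝ)) → w = 0} ∈ 𝓝 (0 : E × C) :=
    prod_mem_nhds hU hZ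
  have himg := image_mem_map (m := fun p : E × C => toMat (f p.1) *
      NormedSpace.exp (p.2 : Matrix (Fin n) (Fin n) ℝ)) hUZ
  replace himg := (hm.trans (congrArg 𝓝 (hval.trans e1.symm))).ge himg
  have hpre := (CartanData.continuous_toMat (G := G)).continuousAt (x := 1)
    himg
  refine mem_of_superset hpre ?_
  rintro g ⟨⟨e, w⟩, ⟨he, hw⟩, hg⟩
  refine ⟨e, he, ?_⟩
  simp only at hg
  have hw0 : w = 0 := by
    refine hw ⟨((f e)⁻¹ * g : G), ((f e)⁻¹ * g : G).2, ?_⟩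
    have e2 : toMat ((f e)⁻¹ * g) = toMat (f e)⁻¹ * toMat g := rfl
    have e3 : toMat (f e)⁻¹ * toMat (f e) = 1 := by
      change toMat ((f e)⁻¹ * f e) = 1
      rw [inv_mul_cancel]; rfl
    change toMat ((f e)⁻¹ * g) = _
    rw [e2, ← hg, ← mul_assoc, e3, one_mul]
  rw [hw0, ZeroMemClass.coe_zero, NormedSpace.exp_zero, mul_one] at hg
  exact Subtype.ext (Units.ext hg)

end ClosedSubgroups

/-! ### Topology of connected algebraic groups -/

lemma IsRealAlgebraic.isClosed {H : Subgroup (GL (Fin n) ℝ)} (h : IsRealAlgebraic H) :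
    IsClosed (H : Set (GL (Fin n) ℝ)) := by
  obtain ⟨S, hS⟩ := h
  have : (H : Set (GL (Fin n) ℝ)) = ⋂ p ∈ S, {g : GL (Fin n) ℝ |
      MvPolynomial.eval (fun ij => (g : Matrix (Fin n) (Fin n) ℝ) ij.1 ij.2) p = 0} := by
    ext g
    simp [hS g]
  rw [this]
  refine isClosed_biInter fun p _ => isClosed_eq ?_ continuous_const
  refine (MvPolynomial.continuous_eval p).comp (continuous_pi fun ij => ?_)
  exact (Units.continuous_val (M := Matrix (Fin n) (Fin n) ℝ)).matrix_elem ij.1 ij.2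

lemma IsConnectedSemisimpleAlgebraic.isClosed {G : Subgroup (GL (Fin n) ℝ)}
    (hG : IsConnectedSemisimpleAlgebraic G) : IsClosed (G : Set (GL (Fin n) ℝ)) := by
  obtain ⟨⟨H, hH, rfl⟩, -⟩ := hG
  rw [identityComponent, Subgroup.coe_map]
  exact hH.isClosed.isClosedEmbedding_subtypeVal.isClosedMap _ isClosed_connectedComponent

lemma IsConnectedSemisimpleAlgebraic.connectedSpace {G : Subgroup (GL (Fin n) ℝ)}
    (hG : IsConnectedSemisimpleAlgebraic G) : ConnectedSpace G := by
  obtain ⟨⟨H, hH, rfl⟩, -⟩ := hG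
  refine isConnected_iff_connectedSpace.1
    (?_ : IsConnected (identityComponent H : Set (GL (Fin n) ℝ)))
  rw [identityComponent, Subgroup.coe_map]
  exact isConnected_connectedComponent.image _ continuous_subtype_val.continuousOn

end Smearing

namespace Smearing

open Filter

variable {n : ℕ}

/-! ### The adjoint action -/

section ConjExp

variable {𝔸 : Type*} [NormedRing 𝔸] [NormedAlgebra ℝ 𝔸] [CompleteSpace 𝔸]

open scoped Nat in
/-- `exp Z · Y · exp (-Z) = exp (ad Z) Y`. -/
lemma hasSum_conj_exp (Z Y : 𝔸) :
    HasSum (fun k : ℕ => ((k ! : ℝ)⁻¹) • ((fun W => Z * W - W * Z)^[k] Y))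
      (NormedSpace.exp Z * Y * NormedSpace.exp (-Z)) := by
  set Lm : 𝔸 →L[ℝ] 𝔸 := ContinuousLinearMap.mul ℝ 𝔸 Z with hL
  set Rm : 𝔸 →L[ℝ] 𝔸 := (ContinuousLinearMap.mul ℝ 𝔸).flip (-Z) with hR
  have hev : ∀ (T : 𝔸 →L[ℝ] 𝔸) (W : 𝔸),
      HasSum (fun k : ℕ => ((k ! : ℝ)⁻¹) • (T ^ k) W) (NormedSpace.exp T W) := fun T W => by
    have := (NormedSpace.exp_series_hasSum_exp' (𝕂 := ℝ) T).mapL (ContinuousLinearMap.apply ℝ 𝔸 W)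
    simpa using this
  have hLk : ∀ (k : ℕ) (W : 𝔸), (Lm ^ k) W = Z ^ k * W := fun k W => by
    induction k with
    | zero => simp
    | succ k ih => rw [pow_succ', mul_apply_eq_comp, ih, pow_succ', mul_assoc]; rfl
  have hRk : ∀ (k : ℕ) (W : 𝔸), (Rm ^ k) W = W * (-Z) ^ k := fun k W => by
    induction k with
    | zero => simp
    | succ k ih => rw [pow_succ', mul_apply_eq_comp, ih, pow_succ, ← mul_assoc]; rfl
  have hLe : ∀ W, NormedSpace.exp Lm W = NormedSpace.exp Z * W := fun W => by
    refine (hev Lm W).unique ?_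
    have := (NormedSpace.exp_series_hasSum_exp' (𝕂 := ℝ) Z).mul_right W
    simpa [hLk] using this
  have hRe : ∀ W, NormedSpace.exp Rm W = W * NormedSpace.exp (-Z) := fun W => by
    refine (hev Rm W).unique ?_
    have := (NormedSpace.exp_series_hasSum_exp' (𝕂 := ℝ) (-Z)).mul_left W
    simpa only [hRk, mul_smul_comm] using this
  -- Left multiplication by `Z` and right multiplication by `-Z` commute and add up to `ad Z`, so
  -- `exp (ad Z)` is the product of their exponentials.
  have hcomm : Commute Lm Rm := by
    ext W
    simp [hL, hR, mul_assoc]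
  have hsum := hev (Lm + Rm) Y
  let _ := NormedAlgebra.restrictScalars ℚ ℝ (𝔸 →L[ℝ] 𝔸)
  rw [NormedSpace.exp_add_of_commute hcomm, mul_apply_eq_comp, hRe, hLe,
    ← mul_assoc] at hsum
  convert hsum using 3 with k
  induction k with
  | zero => simp
  | succ k ih =>
    rw [Function.iterate_succ', Function.comp, ih, pow_succ', mul_apply_eq_comp]
    simp [hL, hR, sub_eq_add_neg]

end ConjExp

variable {G : Subgroup (GL (Fin n) ℝ)}

lemma toMat_mul (g h : G) : toMat (g * h) = toMat g * toMat h := rfl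

lemma toMat_one : toMat (1 : G) = 1 := rfl

lemma toMat_mul_inv (g : G) : toMat g * toMat g⁻¹ = 1 := by
  rw [← toMat_mul, mul_inv_cancel, toMat_one]

lemma toMat_inv_mul (g : G) : toMat g⁻¹ * toMat g = 1 := by
  rw [← toMat_mul, inv_mul_cancel, toMat_one]

lemma toMat_injective : Function.Injective (toMat : G → Matrix (Fin n) (Fin n) ℝ) :=
  fun _ _ h => Subtype.ext (Units.ext h)

lemma toMat_inv_of_exp {g : G} {X : Matrix (Fin n) (Fin n) ℝ} (h : toMat g = NormedSpace.exp X) :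
    toMat g⁻¹ = NormedSpace.exp (-X) := by
  rw [Matrix.exp_neg, ← h]
  exact Matrix.coe_units_inv _

section Adjoint

variable (hG : IsClosed (G : Set (GL (Fin n) ℝ)))

lemma conj_mem_lieAlg (hG : IsClosed (G : Set (GL (Fin n) ℝ))) (g : G) {X : Matrix (Fin n) (Fin n) ℝ} (hX : X ∈ lieAlg G) :
    toMat g * X * toMat g⁻¹ ∈ lieAlg G :=
  (mem_lieAlg_iff hG).2 (conj_mem_oneParamSet g.2 ((mem_lieAlg_iff hG).1 hX))

/-- The adjoint action of `G` on its Lie algebra. -/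
def Ad (g : G) : lieAlg G ≃ₗ⁅ℝ⁆ lieAlg G where
  toFun X := ⟨toMat g * X * toMat g⁻¹, conj_mem_lieAlg hG g X.2⟩
  invFun X := ⟨toMat g⁻¹ * X * toMat g, by
    have := conj_mem_lieAlg hG g⁻¹ X.2
    rwa [inv_inv] at this⟩
  map_add' X Y := Subtype.ext (by simp [mul_add, add_mul])
  map_smul' c X := Subtype.ext (by simp)
  map_lie' := by
    intro X Y
    refine Subtype.ext ?_
    simp only [LieSubalgebra.coe_bracket, LieRing.of_associative_ring_bracket]
    have h := toMat_inv_mul g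
    simp only [mul_sub, sub_mul, mul_assoc]
    simp only [← mul_assoc (toMat g⁻¹) (toMat g), h, one_mul]
  left_inv X := Subtype.ext (by
    have h := toMat_inv_mul g
    simp only [mul_assoc, h, mul_one]
    simp only [← mul_assoc (toMat g⁻¹) (toMat g), h, one_mul])
  right_inv X := Subtype.ext (by
    have h := toMat_mul_inv g
    simp only [mul_assoc, h, mul_one]
    simp only [← mul_assoc (toMat g) (toMat g⁻¹), h, one_mul])

lemma coe_Ad (g : G) (X : lieAlg G) :
    (Ad hG g X : Matrix (Fin n) (Fin n) ℝ) = toMat g * X * toMat g⁻¹ := rfl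

lemma Ad_mul (g h : G) (X : lieAlg G) : Ad hG (g * h) X = Ad hG g (Ad hG h X) :=
  Subtype.ext (by simp only [coe_Ad, toMat_mul, mul_inv_rev, mul_assoc])

lemma continuous_Ad (X : lieAlg G) : Continuous fun g : G => Ad hG g X := by
  refine Continuous.subtype_mk ?_ _
  exact (CartanData.continuous_toMat.mul continuous_const).mul
    (CartanData.continuous_toMat.comp continuous_inv)

/-- The exponential map of `G`. -/
def expG (X : lieAlg G) : G :=
  ⟨((mem_lieAlg_iff hG).1 X.2 1).choose, ((mem_lieAlg_iff hG).1 X.2 1).choose_spec.1⟩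

lemma toMat_expG (X : lieAlg G) :
    toMat (expG hG X) = NormedSpace.exp (X : Matrix (Fin n) (Fin n) ℝ) := by
  exact ((mem_lieAlg_iff hG).1 X.2 1).choose_spec.2.trans (by rw [one_smul])

lemma eq_expG {g : G} {X : lieAlg G}
    (h : toMat g = NormedSpace.exp (X : Matrix (Fin n) (Fin n) ℝ)) : g = expG hG X :=
  toMat_injective (h.trans (toMat_expG hG X).symm)

lemma expG_zero : expG hG 0 = 1 := (eq_expG hG (by simp [toMat_one])).symm

lemma expG_add {X Y : lieAlg G} (h : ⁅X, Y⁆ = 0) :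
    expG hG (X + Y) = expG hG X * expG hG Y := by
  refine (eq_expG hG ?_).symm
  rw [toMat_mul, toMat_expG, toMat_expG]
  refine (Matrix.exp_add_of_commute _ _ ?_).symm
  have := congrArg (Subtype.val) h
  simp only [LieSubalgebra.coe_bracket, LieRing.of_associative_ring_bracket] at this
  exact sub_eq_zero.1 this

lemma expG_neg (X : lieAlg G) : expG hG (-X) = (expG hG X)⁻¹ := by
  refine (eq_expG hG ?_).symm
  rw [toMat_inv_of_exp (toMat_expG hG X)]
  rfl

lemma conj_expG (g : G) (X : lieAlg G) : g * expG hG X * g⁻¹ = expG hG (Ad hG g X) := by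
  refine eq_expG hG ?_
  rw [toMat_mul, toMat_mul, toMat_expG, coe_Ad]
  exact (Matrix.exp_units_conj (g : GL (Fin n) ℝ) _).symm

open scoped Matrix.Norms.Operator Nat in
lemma hasSum_Ad_expG (Z Y : lieAlg G) :
    HasSum (fun k : ℕ => ((k ! : ℝ)⁻¹) •
      (((fun W : lieAlg G => ⁅Z, W⁆)^[k] Y : lieAlg G) : Matrix (Fin n) (Fin n) ℝ))
      (Ad hG (expG hG Z) Y : Matrix (Fin n) (Fin n) ℝ) := by
  have h := hasSum_conj_exp (Z : Matrix (Fin n) (Fin n) ℝ) (Y : Matrix (Fin n) (Fin n) ℝ)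
  have e : (Ad hG (expG hG Z) Y : Matrix (Fin n) (Fin n) ℝ) =
      NormedSpace.exp (Z : Matrix (Fin n) (Fin n) ℝ) * Y *
        NormedSpace.exp (-(Z : Matrix (Fin n) (Fin n) ℝ)) := by
    rw [coe_Ad, toMat_expG, toMat_inv_of_exp (toMat_expG hG Z)]
  have e2 : ∀ k : ℕ, (((fun W : lieAlg G => ⁅Z, W⁆)^[k] Y : lieAlg G) :
      Matrix (Fin n) (Fin n) ℝ) = (fun W => (Z : Matrix (Fin n) (Fin n) ℝ) * W - W * Z)^[k] (Y : Matrix (Fin n) (Fin n) ℝ) := by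
    intro k
    induction k with
    | zero => rfl
    | succ k ih =>
      rw [Function.iterate_succ', Function.comp, Function.iterate_succ', Function.comp, ← ih]
      rfl
  rw [e]
  simp only [e2]
  exact h

/-- Every term of order at least one in the series for `exp (ad Z) Y` lies in `W`, and `W` is
closed. -/
lemma Ad_expG_sub_mem {V W : Submodule ℝ (lieAlg G)} (hWV : W ≤ V) {Z : lieAlg G}
    (h : ∀ Y ∈ V, ⁅Z, Y⁆ ∈ W) {Y : lieAlg G} (hY : Y ∈ V) : Ad hG (expG hG Z) Y - Y ∈ W := by
  have hs := (hasSum_nat_add_iff' 1).2 (hasSum_Ad_expG hG Z Y)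
  simp only [Finset.range_one, Finset.sum_singleton, Nat.factorial_zero, Nat.cast_one, inv_one,
    one_smul, Function.iterate_zero, id_eq] at hs
  set W' : Submodule ℝ (Matrix (Fin n) (Fin n) ℝ) := W.map (lieAlg G).toSubmodule.subtype with hW'
  have hcl : IsClosed (W' : Set (Matrix (Fin n) (Fin n) ℝ)) :=
    Submodule.closed_of_finiteDimensional _
  have hit : ∀ k : ℕ, (fun W : lieAlg G => ⁅Z, W⁆)^[k + 1] Y ∈ W := by
    intro k
    induction k with
    | zero => exact h Y hY
    | succ k ih =>
      rw [Function.iterate_succ']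
      exact h _ (hWV ih)
  have hmem : (Ad hG (expG hG Z) Y : Matrix (Fin n) (Fin n) ℝ) - Y ∈ W' := by
    refine hcl.mem_of_tendsto hs (Eventually.of_forall fun s => ?_)
    exact W'.sum_mem fun k _ => W'.smul_mem _ ⟨_, hit k, rfl⟩
  obtain ⟨w, hw, hwe⟩ := hmem
  have : w = Ad hG (expG hG Z) Y - Y := Subtype.ext hwe
  rwa [← this]

lemma Ad_expG_of_lie_eq_smul {Z Y : lieAlg G} {c : ℝ} (h : ⁅Z, Y⁆ = c • Y) :
    Ad hG (expG hG Z) Y = Real.exp c • Y := by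
  have hs := hasSum_Ad_expG hG Z Y
  have hit : ∀ k : ℕ, (fun W : lieAlg G => ⁅Z, W⁆)^[k] Y = c ^ k • Y := by
    intro k
    induction k with
    | zero => simp
    | succ k ih => rw [Function.iterate_succ', Function.comp, ih, lie_smul, h, smul_smul, pow_succ]
  refine Subtype.ext (hs.unique ?_)
  have h1 := NormedSpace.exp_series_hasSum_exp' (𝕂 := ℝ) c
  rw [← Real.exp_eq_exp_ℝ] at h1
  have h2 := h1.smul_const (Y : Matrix (Fin n) (Fin n) ℝ)
  simp only [hit]
  simpa [smul_smul] using h2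

end Adjoint

end Smearing

namespace Smearing

open Filter

/-! ### Restricted root spaces -/

/-- A commuting family of operators which are symmetric for a positive definite form is
simultaneously diagonalizable. -/
lemma iSup_iInf_eigenspace_eq_top {V ι : Type*} [AddCommGroup V] [Module ℝ V]
    [FiniteDimensional ℝ V] (B : V →ₗ[ℝ] V →ₗ[ℝ] ℝ) (hsymm : ∀ x y, B x y = B y x)
    (hpos : ∀ x, x ≠ 0 → 0 < B x x) (T : ι → Module.End ℝ V)
    (hT : ∀ i x y, B (T i x) y = B x (T i y)) (hc : ∀ i j, Commute (T i) (T j)) :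
    ⨆ χ : ι → ℝ, ⨅ i, Module.End.eigenspace (T i) (χ i) = ⊤ := by
  let c : InnerProductSpace.Core ℝ V :=
    { inner := fun x y => B x y
      conj_inner_symm := fun x y => by simp [hsymm x y]
      re_inner_nonneg := fun x => by
        by_cases hx : x = 0
        · simp [hx]
        · simpa using (hpos x hx).le
      add_left := fun x y z => by simp
      smul_left := fun x y r => by simp
      definite := fun x hx => by
        by_contra h
        exact (hpos x h).ne' hx }
  let _ : NormedAddCommGroup V := c.toNormedAddCommGroup
  let _ : InnerProductSpace ℝ V := InnerProductSpace.ofCore c.toCore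
  exact LinearMap.IsSymmetric.iSup_iInf_eq_top_of_commute (fun i x y => hT i x y)
    fun i j _ => hc i j

variable {n : ℕ} {G : Subgroup (GL (Fin n) ℝ)}

instance : IsTopologicalAddGroup (lieAlg G) :=
  inferInstanceAs (IsTopologicalAddGroup (lieAlg G).toSubmodule)

instance : ContinuousSMul ℝ (lieAlg G) :=
  inferInstanceAs (ContinuousSMul ℝ (lieAlg G).toSubmodule)

namespace CartanData

variable (D : CartanData G)

/-- The Cartan involution as an automorphism. -/
def θEquiv : lieAlg G ≃ₗ⁅ℝ⁆ lieAlg G :=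
  { D.θ with
    invFun := D.θ
    left_inv := D.θ_θ
    right_inv := D.θ_θ }

lemma killing_θ_θ (X Y : lieAlg G) :
    killingForm ℝ (lieAlg G) (D.θ X) (D.θ Y) = killingForm ℝ (lieAlg G) X Y :=
  LieAlgebra.killingForm_of_equiv_apply D.θEquiv X Y

lemma killing_lie (X Y Z : lieAlg G) :
    killingForm ℝ (lieAlg G) ⁅X, Y⁆ Z = -killingForm ℝ (lieAlg G) Y ⁅X, Z⁆ := by
  rw [← lie_skew, map_neg, LinearMap.neg_apply]
  exact congrArg _ (LieModule.traceForm_apply_lie_apply ℝ (lieAlg G) (lieAlg G) Y X Z)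

lemma lie_eq_zero {X Y : lieAlg G} (hX : X ∈ D.𝔞) (hY : Y ∈ D.𝔞) : ⁅X, Y⁆ = 0 :=
  D.𝔞_abelian X hX Y hY

/-- The operators `ad v`, `v ∈ 𝔞`, commute and are symmetric for the positive definite form `-κ(X,
θY)`, because `θ v = -v`. The spectral theorem diagonalizes them simultaneously. -/
lemma iSup_rootSpace : ⨆ α : Module.Dual ℝ D.𝔞, rootSpace D.𝔞 α = ⊤ := by
  let B : lieAlg G →ₗ[ℝ] lieAlg G →ₗ[ℝ] ℝ :=
    -((killingForm ℝ (lieAlg G)).compl₂ (D.θ : lieAlg G →ₗ[ℝ] lieAlg G))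
  have hB : ∀ X Y, B X Y = -killingForm ℝ (lieAlg G) X (D.θ Y) := fun X Y => rfl
  have htop := iSup_iInf_eigenspace_eq_top B
    (fun X Y => by
      rw [hB, hB, ← D.killing_θ_θ X, D.θ_θ, LieModule.traceForm_comm])
    (fun X hX => by rw [hB]; exact neg_pos.2 (D.killing_θ_neg X hX))
    (fun v : D.𝔞 => LieAlgebra.ad ℝ (lieAlg G) (v : lieAlg G))
    (fun v X Y => by
      rw [hB, hB, LieAlgebra.ad_apply, LieAlgebra.ad_apply, killing_lie, LieHom.map_lie,
        D.𝔞_le_𝔭 _ v.2, neg_lie, map_neg])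
    (fun v w => by
      change _ = _
      rw [← sub_eq_zero, ← LieRing.of_associative_ring_bracket, ← LieHom.map_lie,
        D.lie_eq_zero v.2 w.2, map_zero])
  rw [eq_top_iff, ← htop]
  refine iSup_le fun χ => ?_
  by_cases hbot : (⨅ v : D.𝔞, Module.End.eigenspace
      (LieAlgebra.ad ℝ (lieAlg G) (v : lieAlg G)) (χ v)) = ⊥
  · rw [hbot]
    exact bot_le
  obtain ⟨X, hX, hX0⟩ := Submodule.exists_mem_ne_zero_of_ne_bot hbot
  have hXe : ∀ v : D.𝔞, ⁅(v : lieAlg G), X⁆ = χ v • X := fun v => by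
    have := (Submodule.mem_iInf _).1 hX v
    rwa [Module.End.mem_eigenspace_iff] at this
  -- A joint eigenvalue function is linear as soon as it has a nonzero eigenvector.
  let α : Module.Dual ℝ D.𝔞 :=
    { toFun := χ
      map_add' := fun v w => by
        have : (χ (v + w) - (χ v + χ w)) • X = 0 := by
          rw [sub_smul, add_smul, ← hXe, ← hXe, ← hXe, Submodule.coe_add, add_lie, sub_self]
        exact sub_eq_zero.1 ((smul_eq_zero.1 this).resolve_right hX0)
      map_smul' := fun c v => by
        have : (χ (c • v) - c * χ v) • X = 0 := by
          rw [sub_smul, mul_smul, ← hXe, ← hXe, Submodule.coe_smul, smul_lie, sub_self]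
        exact sub_eq_zero.1 ((smul_eq_zero.1 this).resolve_right hX0) }
  refine le_trans (fun Y hY => ?_) (le_iSup _ α)
  intro v
  have := (Submodule.mem_iInf _).1 hY v
  rwa [Module.End.mem_eigenspace_iff] at this

lemma θ_mem_rootSpace {α : Module.Dual ℝ D.𝔞} {X : lieAlg G} (hX : X ∈ rootSpace D.𝔞 α) :
    D.θ X ∈ rootSpace D.𝔞 (-α) := by
  intro v
  have := congrArg D.θ (hX v)
  rw [LieHom.map_lie, D.𝔞_le_𝔭 _ v.2, neg_lie, map_smul] at this
  rw [LinearMap.neg_apply, neg_smul, ← this, neg_neg]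

lemma rootSpace_le_𝔫 {α : Module.Dual ℝ D.𝔞} (hα : 0 < α D.H₀) : rootSpace D.𝔞 α ≤ D.𝔫 := by
  by_cases h : rootSpace D.𝔞 α = ⊥
  · rw [h]
    exact bot_le
  · refine le_iSup₂_of_le (f := fun (α : Module.Dual ℝ D.𝔞)
      (_ : α ∈ {α : Module.Dual ℝ D.𝔞 | IsRoot D.𝔞 α ∧ 0 < α D.H₀}) => rootSpace D.𝔞 α)
      α ⟨⟨?_, h⟩, hα⟩ le_rfl
    rintro rfl
    simp at hα

/-- The Lie algebra `𝔨` of `K`. -/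
def 𝔨 : Submodule ℝ (lieAlg G) := LinearMap.eqLocus (D.θ : lieAlg G →ₗ[ℝ] lieAlg G) LinearMap.id

lemma mem_𝔨 {X : lieAlg G} : X ∈ D.𝔨 ↔ D.θ X = X := Iff.rfl

/-- The Iwasawa decomposition of the Lie algebra. -/
lemma iwasawa_lieAlg : D.𝔨 ⊔ D.𝔞 ⊔ D.𝔫 = ⊤ := by
  rw [eq_top_iff, ← D.iSup_rootSpace]
  refine iSup_le fun α X hX => ?_
  have hk : ∀ Y : lieAlg G, Y + D.θ Y ∈ D.𝔨 := fun Y => by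
    rw [mem_𝔨, map_add, D.θ_θ, add_comm]
  by_cases h0 : α = 0
  · subst h0
    -- The `𝔭`-part of an element centralizing `𝔞` still centralizes `𝔞`; adjoining it to `𝔞` keeps
    -- the space abelian, so maximality puts it in `𝔞`.
    set Y : lieAlg G := X - D.θ X with hY
    have hθY : D.θ Y = -Y := by rw [hY, map_sub, D.θ_θ, neg_sub]
    have hvY : ∀ v ∈ D.𝔞, ⁅v, Y⁆ = 0 := fun v hv => by
      have h1 := hX ⟨v, hv⟩
      have h2 := D.θ_mem_rootSpace hX ⟨v, hv⟩
      simp only [LinearMap.zero_apply, neg_zero, zero_smul] at h1 h2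
      rw [hY, lie_sub, h1, h2, sub_zero]
    have hmax := D.𝔞_maximal (D.𝔞 ⊔ Submodule.span ℝ {Y})
      (fun Z hZ => by
        obtain ⟨v, hv, w, hw, rfl⟩ := Submodule.mem_sup.1 hZ
        obtain ⟨c, rfl⟩ := Submodule.mem_span_singleton.1 hw
        rw [map_add, map_smul, D.𝔞_le_𝔭 v hv, hθY, smul_neg, neg_add])
      (fun Z hZ Z' hZ' => by
        obtain ⟨v, hv, w, hw, rfl⟩ := Submodule.mem_sup.1 hZ
        obtain ⟨c, rfl⟩ := Submodule.mem_span_singleton.1 hw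
        obtain ⟨v', hv', w', hw', rfl⟩ := Submodule.mem_sup.1 hZ'
        obtain ⟨c', rfl⟩ := Submodule.mem_span_singleton.1 hw'
        have h3 : ⁅Y, v'⁆ = 0 := by rw [← lie_skew, hvY v' hv', neg_zero]
        simp [D.lie_eq_zero hv hv', hvY v hv, h3]) le_sup_left
    have hYa : Y ∈ D.𝔞 := hmax ▸ (Submodule.mem_sup_right (Submodule.mem_span_singleton_self Y))
    have hXe : X = (1 / 2 : ℝ) • (X + D.θ X) + (1 / 2 : ℝ) • Y := by
      rw [hY, ← smul_add, add_add_sub_cancel, ← two_smul ℝ X, smul_smul]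
      norm_num
    rw [hXe]
    exact Submodule.mem_sup_left (Submodule.add_mem_sup (D.𝔨.smul_mem _ (hk X))
      (D.𝔞.smul_mem _ hYa))
  · rcases lt_trichotomy (α D.H₀) 0 with hlt | heq | hgt
    -- For a negative root, `θ X` lies in a positive root space and `X + θ X` in `𝔨`.
    · have h1 : D.θ X ∈ D.𝔫 := D.rootSpace_le_𝔫 (α := -α) (by simpa using hlt)
        (D.θ_mem_rootSpace hX)
      have hXe : X = (X + D.θ X) + -D.θ X := by abel
      rw [hXe]
      exact Submodule.add_mem_sup (Submodule.mem_sup_left (hk X)) (D.𝔫.neg_mem h1)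
    · have hX0 : X = 0 := by
        by_contra hX0
        exact D.H₀_regular α ⟨h0, fun hb => hX0 ((Submodule.eq_bot_iff _).1 hb X hX)⟩ heq
      rw [hX0]
      exact Submodule.zero_mem _
    · exact Submodule.mem_sup_right (D.rootSpace_le_𝔫 hgt hX)

/-! ### The filtration of the Lie algebra by eigenvalues of `ad H₀`, and unipotence of `N`. -/

/-- The sum of the eigenspaces of `ad H₀` with eigenvalue in `s`. -/
def eigenSum (s : Set ℝ) : Submodule ℝ (lieAlg G) :=
  ⨆ c ∈ s, Module.End.eigenspace (LieAlgebra.ad ℝ (lieAlg G) (D.H₀ : lieAlg G)) c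

lemma mem_eigenSum_of_lie {s : Set ℝ} {c : ℝ} (hc : c ∈ s) {X : lieAlg G}
    (hX : ⁅(D.H₀ : lieAlg G), X⁆ = c • X) : X ∈ D.eigenSum s :=
  (le_iSup₂_of_le (f := fun (c : ℝ) (_ : c ∈ s) => Module.End.eigenspace
    (LieAlgebra.ad ℝ (lieAlg G) (D.H₀ : lieAlg G)) c) c hc le_rfl)
    (Module.End.mem_eigenspace_iff.2 hX)

lemma eigenSum_induction {s : Set ℝ} {p : Submodule ℝ (lieAlg G)}
    (h : ∀ c ∈ s, ∀ X, ⁅(D.H₀ : lieAlg G), X⁆ = c • X → X ∈ p) : D.eigenSum s ≤ p :=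
  iSup₂_le fun c hc X hX => h c hc X (Module.End.mem_eigenspace_iff.1 hX)

lemma eigenSum_mono {s t : Set ℝ} (h : s ⊆ t) : D.eigenSum s ≤ D.eigenSum t :=
  D.eigenSum_induction fun _ hc _ hX => D.mem_eigenSum_of_lie (h hc) hX

/-- Bracketing with a positive root vector raises the `H₀`-eigenvalue by the positive number `α H₀`.
-/
lemma lie_𝔫_eigenSum {Z Y : lieAlg G} (hZ : Z ∈ D.𝔫) {c : ℝ} (hY : Y ∈ D.eigenSum (Set.Ici c)) :
    ⁅Z, Y⁆ ∈ D.eigenSum (Set.Ioi c) := by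
  have h1 : D.eigenSum (Set.Ici c) ≤ (D.eigenSum (Set.Ioi c)).comap
      ((LieAlgebra.ad ℝ (lieAlg G) Z : Module.End ℝ (lieAlg G)) : lieAlg G →ₗ[ℝ] lieAlg G) := by
    refine D.eigenSum_induction fun d hd Y hY => ?_
    change ⁅Z, Y⁆ ∈ D.eigenSum _
    have h2 : D.𝔫 ≤ (D.eigenSum (Set.Ioi c)).comap
        ((LieAlgebra.ad ℝ (lieAlg G) Y : Module.End ℝ (lieAlg G)) : lieAlg G →ₗ[ℝ] lieAlg G) := by
      refine iSup₂_le fun α hα Z hZ => ?_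
      change ⁅Y, Z⁆ ∈ D.eigenSum _
      refine D.mem_eigenSum_of_lie (c := d + α D.H₀) ?_ ?_
      · have := hα.2
        simp only [Set.mem_Ioi, Set.mem_Ici] at hd ⊢
        linarith
      · rw [leibniz_lie, hY, hZ D.H₀, smul_lie, lie_smul, add_smul]
    have := h2 hZ
    rw [← lie_skew]
    exact Submodule.neg_mem _ this
  exact h1 hY

lemma lie_𝔞_eigenSum {v Y : lieAlg G} (hv : v ∈ D.𝔞) {s : Set ℝ} (hY : Y ∈ D.eigenSum s) :
    ⁅v, Y⁆ ∈ D.eigenSum s := by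
  have h1 : D.eigenSum s ≤ (D.eigenSum s).comap
      ((LieAlgebra.ad ℝ (lieAlg G) v : Module.End ℝ (lieAlg G)) : lieAlg G →ₗ[ℝ] lieAlg G) := by
    refine D.eigenSum_induction fun d hd Y hY => ?_
    change ⁅v, Y⁆ ∈ D.eigenSum _
    refine D.mem_eigenSum_of_lie hd ?_
    rw [leibniz_lie, D.lie_eq_zero D.H₀.2 hv, zero_lie, zero_add, hY, lie_smul]
  exact h1 hY

/-- `θ X` has eigenvalue `-c`, and invariance of the Killing form makes eigenvectors orthogonal
unless their eigenvalues sum to zero. -/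
lemma killing_θ_eigenSum {X Y : lieAlg G} {c : ℝ} (hX : ⁅(D.H₀ : lieAlg G), X⁆ = c • X)
    (hY : Y ∈ D.eigenSum (Set.Ioi c)) : killingForm ℝ (lieAlg G) (D.θ X) Y = 0 := by
  have h1 : D.eigenSum (Set.Ioi c) ≤ LinearMap.ker (killingForm ℝ (lieAlg G) (D.θ X)) := by
    refine D.eigenSum_induction fun d hd Y hY => ?_
    have h2 := congrArg D.θ hX
    rw [LieHom.map_lie, D.𝔞_le_𝔭 _ D.H₀.2, neg_lie, map_smul, neg_eq_iff_eq_neg] at h2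
    have h3 := killing_lie (D.H₀ : lieAlg G) (D.θ X) Y
    rw [h2, hY, map_neg, map_smul, map_smul, LinearMap.neg_apply, LinearMap.smul_apply,
      smul_eq_mul, smul_eq_mul, neg_inj] at h3
    have h4 : (d - c) * killingForm ℝ (lieAlg G) (D.θ X) Y = 0 := by linarith
    have hdc : d - c ≠ 0 := (sub_pos.2 hd).ne'
    exact (mul_eq_zero.1 h4).resolve_left hdc
  exact h1 hY

variable (hG : IsClosed (G : Set (GL (Fin n) ℝ)))

lemma Ad_N_sub_mem {u : G} (hu : u ∈ D.N) {c : ℝ} {Y : lieAlg G}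
    (hY : Y ∈ D.eigenSum (Set.Ici c)) : Ad hG u Y - Y ∈ D.eigenSum (Set.Ioi c) := by
  let p : G → Prop := fun u => ∀ Y ∈ D.eigenSum (Set.Ici c), Ad hG u Y - Y ∈ D.eigenSum (Set.Ioi c)
  have hle : D.eigenSum (Set.Ioi c) ≤ D.eigenSum (Set.Ici c) :=
    D.eigenSum_mono Set.Ioi_subset_Ici_self
  have hexp : ∀ Z ∈ D.𝔫, p (expG hG Z) := fun Z hZ Y hY =>
    Ad_expG_sub_mem hG hle (fun Y hY => D.lie_𝔫_eigenSum hZ hY) hY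
  have hmul : ∀ a b : G, p a → p b → p (a * b) := fun a b ha hb Y hY => by
    have h1 := hb Y hY
    have h2 : Ad hG b Y ∈ D.eigenSum (Set.Ici c) := by
      simpa using (D.eigenSum (Set.Ici c)).add_mem (hle h1) hY
    have h3 := (D.eigenSum (Set.Ioi c)).add_mem (ha _ h2) h1
    rwa [sub_add_sub_cancel, ← Ad_mul] at h3
  -- `N` is only known as a generated subgroup, so the property is carried together with its inverse
  -- version through the closure induction.
  have key : p u ∧ p u⁻¹ := by
    refine Subgroup.closure_induction (p := fun u _ => p u ∧ p u⁻¹) ?_ ?_ ?_ ?_ hu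
    · rintro g ⟨Z, hZ, hg⟩
      rw [eq_expG hG hg, ← expG_neg]
      exact ⟨hexp Z hZ, hexp _ (D.𝔫.neg_mem hZ)⟩
    · rw [inv_one, and_self, ← expG_zero hG]
      exact hexp 0 D.𝔫.zero_mem
    · intro a b _ _ ha hb
      rw [mul_inv_rev]
      exact ⟨hmul _ _ ha.1 hb.1, hmul _ _ hb.2 ha.2⟩
    · intro a _ ha
      rw [inv_inv]
      exact ha.symm
  exact key.1 Y hY

/-- This matrix coefficient detects the `A`-part of an element of `AN`: `u` changes `X` only by
terms of larger `H₀`-eigenvalue, which `exp w` preserves and the pairing with `θ X` kills, while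
`exp w` scales `X` by `exp (α w)`. -/
lemma killing_θ_Ad_exp_mul {α : Module.Dual ℝ D.𝔞} {X : lieAlg G} (hX : X ∈ rootSpace D.𝔞 α)
    (w : D.𝔞) {u : G} (hu : u ∈ D.N) :
    killingForm ℝ (lieAlg G) (D.θ X) (Ad hG (expG hG w * u) X) =
      Real.exp (α w) * killingForm ℝ (lieAlg G) (D.θ X) X := by
  have hXH := hX D.H₀
  have h1 := D.Ad_N_sub_mem hG hu (D.mem_eigenSum_of_lie (Set.self_mem_Ici (a := α D.H₀)) hXH)
  set Y := Ad hG u X - X with hY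
  have h2 : Ad hG u X = X + Y := by rw [hY]; abel
  have h3 := Ad_expG_sub_mem hG le_rfl
    (fun Y hY => D.lie_𝔞_eigenSum w.2 (s := Set.Ioi (α D.H₀)) hY) h1
  have h4 : Ad hG (expG hG w) Y ∈ D.eigenSum (Set.Ioi (α D.H₀)) := by
    simpa using Submodule.add_mem _ h3 h1
  rw [Ad_mul, h2, map_add, map_add, D.killing_θ_eigenSum hXH h4, add_zero,
    Ad_expG_of_lie_eq_smul hG (hX w), map_smul, smul_eq_mul]

/-! ### The Iwasawa decomposition -/

lemma conj_mem_N (hG : IsClosed (G : Set (GL (Fin n) ℝ))) {g : G} (hg : ∀ X ∈ D.𝔞, toMat g * (X : Matrix (Fin n) (Fin n) ℝ) =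
      (X : Matrix (Fin n) (Fin n) ℝ) * toMat g) {u : G} (hu : u ∈ D.N) :
    g * u * g⁻¹ ∈ D.N := by
  have hAd : ∀ X ∈ D.𝔞, Ad hG g X = X := fun X hX => Subtype.ext (by
    rw [coe_Ad, hg X hX, mul_assoc, toMat_mul_inv, mul_one])
  have hn : D.𝔫 ≤ D.𝔫.comap ((Ad hG g : lieAlg G →ₗ⁅ℝ⁆ lieAlg G) : lieAlg G →ₗ[ℝ] lieAlg G) := by
    refine iSup₂_le fun α hα X hX => ?_
    refine D.rootSpace_le_𝔫 hα.2 (fun v => ?_)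
    change ⁅(v : lieAlg G), Ad hG g X⁆ = α v • Ad hG g X
    rw [← map_smul, ← hX v, LieEquiv.map_lie, hAd _ v.2]
  have : D.N ≤ D.N.comap (MulAut.conj g).toMonoidHom := by
    refine (Subgroup.closure_le _).2 ?_
    rintro h ⟨Z, hZ, hh⟩
    change g * h * g⁻¹ ∈ D.N
    rw [eq_expG hG hh, conj_expG]
    exact Subgroup.subset_closure ⟨_, hn hZ, toMat_expG hG _⟩
  exact this hu

lemma expG_commutes (v : D.𝔞) : ∀ X ∈ D.𝔞,
    toMat (expG hG v) * (X : Matrix (Fin n) (Fin n) ℝ) =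
      (X : Matrix (Fin n) (Fin n) ℝ) * toMat (expG hG v) := by
  intro X hX
  have h := Ad_expG_of_lie_eq_smul hG (Z := (v : lieAlg G)) (Y := X) (c := 0)
    (by rw [D.lie_eq_zero v.2 hX, zero_smul])
  rw [Real.exp_zero, one_smul] at h
  have h1 := congrArg Subtype.val h
  rw [coe_Ad] at h1
  conv_rhs => rw [← h1]
  rw [mul_assoc, toMat_inv_mul, mul_one]

lemma expG_𝔞_add (v w : D.𝔞) : expG hG ((v + w : D.𝔞) : lieAlg G) = expG hG v * expG hG w := by
  rw [Submodule.coe_add]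
  exact expG_add hG (D.lie_eq_zero v.2 w.2)

lemma expG_mul_comm_N (v : D.𝔞) {u : G} (hu : u ∈ D.N) :
    ∃ u' ∈ D.N, u * expG hG v = expG hG v * u' := by
  refine ⟨(expG hG v)⁻¹ * u * expG hG v, ?_, by group⟩
  have := D.conj_mem_N hG (D.expG_commutes hG (-v)) hu
  rwa [Submodule.coe_neg, expG_neg, inv_inv] at this

lemma exists_pow_exp_mul (w : D.𝔞) {u : G} (hu : u ∈ D.N) (j : ℕ) :
    ∃ u' ∈ D.N, (expG hG w * u) ^ j = expG hG (((j : ℝ) • w : D.𝔞) : lieAlg G) * u' := by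
  induction j with
  | zero => exact ⟨1, D.N.one_mem, by simp [expG_zero]⟩
  | succ j ih =>
    obtain ⟨u', hu', hj⟩ := ih
    obtain ⟨u'', hu'', h2⟩ := D.expG_mul_comm_N hG w hu'
    refine ⟨u'' * u, D.N.mul_mem hu'' hu, ?_⟩
    rw [pow_succ, hj, Nat.cast_succ, add_smul, one_smul, expG_𝔞_add, mul_assoc, ← mul_assoc u',
      h2]
    simp only [mul_assoc]

/-- The powers of an element of `K` stay in a compact set, so its matrix coefficients are bounded;
here the coefficient of the `j`-th power is a nonzero multiple of `exp (j α(w))`. -/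
lemma root_le_zero_of_exp_mul_mem_K {w : D.𝔞} {u : G} (hu : u ∈ D.N) (hK : expG hG w * u ∈ D.K)
    {α : Module.Dual ℝ D.𝔞} (hα : rootSpace D.𝔞 α ≠ ⊥) : α w ≤ 0 := by
  obtain ⟨X, hX, hX0⟩ := Submodule.exists_mem_ne_zero_of_ne_bot hα
  by_contra hpos
  rw [not_le] at hpos
  have hcont : Continuous fun g : G => killingForm ℝ (lieAlg G) (D.θ X) (Ad hG g X) :=
    (LinearMap.continuous_of_finiteDimensional (killingForm ℝ (lieAlg G) (D.θ X))).comp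
      (continuous_Ad hG X)
  obtain ⟨C, hC⟩ := (D.isCompact_K.image hcont).isBounded.exists_norm_le
  have hneg : killingForm ℝ (lieAlg G) (D.θ X) X ≠ 0 := by
    rw [LieModule.traceForm_comm]
    exact (D.killing_θ_neg X hX0).ne
  have hb : ∀ j : ℕ, Real.exp (j * α w) * |killingForm ℝ (lieAlg G) (D.θ X) X| ≤ C := by
    intro j
    obtain ⟨u', hu', hj⟩ := D.exists_pow_exp_mul hG w hu j
    have h1 := hC _ ⟨_, D.K.pow_mem hK j, rfl⟩
    simp only at h1
    rw [hj, D.killing_θ_Ad_exp_mul hG hX _ hu', map_smul, smul_eq_mul, norm_mul,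
      Real.norm_of_nonneg (Real.exp_nonneg _)] at h1
    exact h1
  have htend : Tendsto (fun j : ℕ => Real.exp (j * α w) *
      |killingForm ℝ (lieAlg G) (D.θ X) X|) atTop atTop :=
    (Real.tendsto_exp_atTop.comp (tendsto_natCast_atTop_atTop.atTop_mul_const hpos)).atTop_mul_const
      (abs_pos.2 hneg)
  obtain ⟨j, hj⟩ := (htend.eventually_gt_atTop C).exists
  exact absurd (hb j) (not_le.2 hj)

/-- The bound applied to `α` and `-α` shows that all roots vanish at `w`. Hence `ad w = 0`, and
negativity of `κ(w, θ w)` for nonzero `w` gives `w = 0`. -/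
lemma eq_zero_of_exp_mul_mem_K {w : D.𝔞} {u : G} (hu : u ∈ D.N) (hK : expG hG w * u ∈ D.K) :
    w = 0 := by
  have hroot : ∀ α : Module.Dual ℝ D.𝔞, rootSpace D.𝔞 α ≠ ⊥ → α w = 0 := by
    intro α hα
    refine le_antisymm (D.root_le_zero_of_exp_mul_mem_K hG hu hK hα) ?_
    have hα' : rootSpace D.𝔞 (-α) ≠ ⊥ := by
      obtain ⟨X, hX, hX0⟩ := Submodule.exists_mem_ne_zero_of_ne_bot hα
      intro hb
      have := (Submodule.eq_bot_iff _).1 hb _ (D.θ_mem_rootSpace hX)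
      apply hX0
      rw [← D.θ_θ X, this, map_zero]
    simpa using D.root_le_zero_of_exp_mul_mem_K hG hu hK hα'
  have had : LieAlgebra.ad ℝ (lieAlg G) (w : lieAlg G) = 0 := by
    have hle : (⊤ : Submodule ℝ (lieAlg G)) ≤ LinearMap.ker
        ((LieAlgebra.ad ℝ (lieAlg G) (w : lieAlg G) : Module.End ℝ (lieAlg G)) :
          lieAlg G →ₗ[ℝ] lieAlg G) := by
      rw [← D.iSup_rootSpace]
      refine iSup_le fun α X hX => ?_
      rw [LinearMap.mem_ker, LieAlgebra.ad_apply, hX w]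
      by_cases hα : rootSpace D.𝔞 α = ⊥
      · rw [(Submodule.eq_bot_iff _).1 hα X hX, smul_zero]
      · rw [hroot α hα, zero_smul]
    ext1 X
    exact hle Submodule.mem_top
  by_contra hw
  have h1 := D.killing_θ_neg w (fun h => hw (Subtype.ext h))
  rw [killingForm_apply_apply, had, LinearMap.zero_comp, map_zero] at h1
  exact lt_irrefl _ h1

lemma iwasawa_unique {k k' u u' : G} {v v' : D.𝔞} (hk : k ∈ D.K) (hk' : k' ∈ D.K) (hu : u ∈ D.N)
    (hu' : u' ∈ D.N) (h : k * expG hG v * u = k' * expG hG v' * u') : v = v' := by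
  have h1 : k'⁻¹ * k = expG hG v' * (u' * u⁻¹) * expG hG (-v : D.𝔞) := by
    rw [Submodule.coe_neg, expG_neg]
    have : k = k' * expG hG v' * u' * u⁻¹ * (expG hG v)⁻¹ := by rw [← h]; group
    rw [this]
    group
  obtain ⟨u'', hu'', h2⟩ := D.expG_mul_comm_N hG (-v) (D.N.mul_mem hu' (D.N.inv_mem hu))
  rw [mul_assoc, h2, ← mul_assoc, ← expG_𝔞_add] at h1
  have h3 := D.eq_zero_of_exp_mul_mem_K hG hu'' (h1 ▸ D.K.mul_mem (D.K.inv_mem hk') hk)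
  rw [← sub_eq_add_neg, sub_eq_zero] at h3
  exact h3.symm

/-- Uniqueness of the `A`-part lets any decomposition compute the value that `H` selects by choice.
-/
lemma H_eq {g k u : G} {v : D.𝔞} (hk : k ∈ D.K) (hu : u ∈ D.N) (h : g = k * expG hG v * u) :
    D.H g = v := by
  have hex : ∃ v : D.𝔞, ∃ k ∈ D.K, ∃ a : G, ∃ u ∈ D.N,
      toMat a = NormedSpace.exp ((v : lieAlg G) : Matrix (Fin n) (Fin n) ℝ) ∧ g = k * a * u :=
    ⟨v, k, hk, expG hG v, u, hu, toMat_expG hG _, h⟩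
  have hH : D.H g = hex.choose := dif_pos hex
  obtain ⟨k', hk', a, u', hu', ha, hg⟩ := hex.choose_spec
  rw [eq_expG hG ha] at hg
  rw [hH]
  exact D.iwasawa_unique hG hk' hk hu' hu (hg.symm.trans h)

end CartanData

end Smearing

namespace Smearing

open Filter

variable {n : ℕ} {G : Subgroup (GL (Fin n) ℝ)}

/-! ### Local coordinates on `G` and existence of the Iwasawa decomposition. -/

section LocalProduct

open scoped Matrix.Norms.Operator

lemma hasStrictFDerivAt_exp_clm {E : Type*} [NormedAddCommGroup E] [NormedSpace ℝ E]
    (L : E →L[ℝ] Matrix (Fin n) (Fin n) ℝ) :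
    HasStrictFDerivAt (fun e => NormedSpace.exp (L e)) L 0 := by
  have h0 : HasStrictFDerivAt (NormedSpace.exp : Matrix (Fin n) (Fin n) ℝ → _)
      (ContinuousLinearMap.id ℝ (Matrix (Fin n) (Fin n) ℝ)) (L 0) := by
    rw [map_zero]
    exact hasStrictFDerivAt_exp_zero
  exact h0.comp (0 : E) L.hasStrictFDerivAt

lemma hasStrictFDerivAt_mul_one {E : Type*} [NormedAddCommGroup E] [NormedSpace ℝ E]
    {a b : E → Matrix (Fin n) (Fin n) ℝ} {a' b' : E →L[ℝ] Matrix (Fin n) (Fin n) ℝ}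
    (ha : HasStrictFDerivAt a a' 0) (hb : HasStrictFDerivAt b b' 0) (ha0 : a 0 = 1)
    (hb0 : b 0 = 1) : HasStrictFDerivAt (fun e => a e * b e) (a' + b') 0 := by
  refine (ha.mul' hb).congr_fderiv ?_
  refine ContinuousLinearMap.ext fun e => ?_
  change a 0 * b' e + a' e * b 0 = a' e + b' e
  rw [ha0, hb0, one_mul, mul_one, add_comm]

/-- A subspace of the Lie algebra, regarded as a subspace of the space of matrices. -/
def matSubmodule (S : Submodule ℝ (lieAlg G)) : Submodule ℝ (Matrix (Fin n) (Fin n) ℝ) :=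
  S.map (lieAlg G).toSubmodule.subtype

/-- The element of the Lie algebra underlying an element of `matSubmodule S`. -/
def matSubmodule.lift {S : Submodule ℝ (lieAlg G)} (x : matSubmodule S) : S :=
  ⟨⟨x, by obtain ⟨y, -, hy⟩ := x.2; rw [← hy]; exact y.2⟩, by
    obtain ⟨y, hyS, hy⟩ := x.2
    have e : y = ⟨(x : Matrix (Fin n) (Fin n) ℝ), by rw [← hy]; exact y.2⟩ := Subtype.ext hy
    exact e ▸ hyS⟩

lemma matSubmodule.coe_lift {S : Submodule ℝ (lieAlg G)} (x : matSubmodule S) :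
    ((matSubmodule.lift x : lieAlg G) : Matrix (Fin n) (Fin n) ℝ) = x := rfl

lemma matSubmodule.continuous_lift {S : Submodule ℝ (lieAlg G)} :
    Continuous (matSubmodule.lift : matSubmodule S → S) :=
  Continuous.subtype_mk (Continuous.subtype_mk continuous_subtype_val _) _

/-- Near `1`, a closed linear group is covered by its exponential map. -/
lemma expG_image_mem_nhds (hG : IsClosed (G : Set (GL (Fin n) ℝ))) {O : Set (lieAlg G)}
    (hO : O ∈ 𝓝 0) : expG hG '' O ∈ 𝓝 (1 : G) := by
  let f : matSubmodule (⊤ : Submodule ℝ (lieAlg G)) → G :=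
    fun x => expG hG (matSubmodule.lift x : lieAlg G)
  have hlift0 : ((matSubmodule.lift (0 : matSubmodule (⊤ : Submodule ℝ (lieAlg G)))) : lieAlg G)
    = 0 := rfl
  have hf0 : f 0 = 1 := by simp only [f, hlift0, expG_zero]
  have hf : HasStrictFDerivAt (fun x => toMat (f x))
      (matSubmodule (⊤ : Submodule ℝ (lieAlg G))).subtypeL 0 := by
    simp only [f, toMat_expG]
    exact hasStrictFDerivAt_exp_clm (matSubmodule (⊤ : Submodule ℝ (lieAlg G))).subtypeL
  have hU : {x : matSubmodule (⊤ : Submodule ℝ (lieAlg G)) |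
      (matSubmodule.lift x : lieAlg G) ∈ O} ∈ 𝓝 0 :=
    (continuous_subtype_val.comp matSubmodule.continuous_lift).continuousAt.preimage_mem_nhds
      (by simpa [hlift0] using hO)
  refine mem_of_superset (image_mem_nhds_one hG hf0 hf
    (fun X hX => ⟨⟨X, ⟨X, hX⟩, trivial, rfl⟩, rfl⟩) hU) ?_
  rintro _ ⟨x, hx, rfl⟩
  exact ⟨_, hx, rfl⟩

/-- Near `1`, the group `G` is covered by the products `exp Y · exp v · exp Z` with `Y ∈ 𝔨`, small
`v ∈ 𝔞` and `Z ∈ 𝔫`. -/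
lemma CartanData.iwasawa_mem_nhds (D : CartanData G) (hG : IsClosed (G : Set (GL (Fin n) ℝ)))
    {O : Set D.𝔞} (hO : O ∈ 𝓝 0) :
    {g : G | ∃ Y ∈ D.𝔨, ∃ v ∈ O, ∃ Z ∈ D.𝔫, g = expG hG Y * expG hG (v : D.𝔞) * expG hG Z} ∈
      𝓝 (1 : G) := by
  -- The parameters are taken as subspaces of the matrices, where a norm is at hand. The
  -- differential at `0` is the sum of the inclusions, onto by `iwasawa_lieAlg`.
  let E := matSubmodule D.𝔨 × matSubmodule D.𝔞 × matSubmodule D.𝔫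
  let f : E → G := fun e => expG hG (matSubmodule.lift e.1 : lieAlg G) *
    expG hG (matSubmodule.lift e.2.1 : lieAlg G) * expG hG (matSubmodule.lift e.2.2 : lieAlg G)
  have hlift0 : ∀ S : Submodule ℝ (lieAlg G), matSubmodule.lift (0 : matSubmodule S) = 0 :=
    fun S => rfl
  have hf0 : f 0 = 1 := by
    change expG hG 0 * expG hG 0 * expG hG 0 = 1
    rw [expG_zero, mul_one, mul_one]
  let L1 : E →L[ℝ] Matrix (Fin n) (Fin n) ℝ :=
    (matSubmodule D.𝔨).subtypeL.comp (ContinuousLinearMap.fst ℝ _ _)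
  let L2 : E →L[ℝ] Matrix (Fin n) (Fin n) ℝ := (matSubmodule D.𝔞).subtypeL.comp
    ((ContinuousLinearMap.fst ℝ _ _).comp (ContinuousLinearMap.snd ℝ _ _))
  let L3 : E →L[ℝ] Matrix (Fin n) (Fin n) ℝ := (matSubmodule D.𝔫).subtypeL.comp
    ((ContinuousLinearMap.snd ℝ _ _).comp (ContinuousLinearMap.snd ℝ _ _))
  have hL0 : ∀ L : E →L[ℝ] Matrix (Fin n) (Fin n) ℝ, NormedSpace.exp (L 0) = 1 := fun L => by
    rw [map_zero, NormedSpace.exp_zero]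
  have hf : HasStrictFDerivAt (fun x => toMat (f x)) (L1 + L2 + L3) 0 := by
    simp only [f, toMat_mul, toMat_expG]
    exact hasStrictFDerivAt_mul_one (hasStrictFDerivAt_mul_one (hasStrictFDerivAt_exp_clm L1)
      (hasStrictFDerivAt_exp_clm L2) (hL0 L1) (hL0 L2)) (hasStrictFDerivAt_exp_clm L3)
      (by change NormedSpace.exp (L1 0) * NormedSpace.exp (L2 0) = 1; rw [hL0, hL0, one_mul])
      (hL0 L3)
  have hU : {e : E | matSubmodule.lift e.2.1 ∈ O} ∈ 𝓝 0 := by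
    have hc : Continuous fun e : E => matSubmodule.lift e.2.1 :=
      matSubmodule.continuous_lift.comp (continuous_fst.comp continuous_snd)
    exact hc.continuousAt.preimage_mem_nhds hO
  refine mem_of_superset (image_mem_nhds_one hG hf0 hf (fun X hX => ?_) hU) ?_
  · have hX' : (⟨X, hX⟩ : lieAlg G) ∈ D.𝔨 ⊔ D.𝔞 ⊔ D.𝔫 := by
      rw [D.iwasawa_lieAlg]
      trivial
    obtain ⟨W, hW, Z, hZ, hWZ⟩ := Submodule.mem_sup.1 hX'
    obtain ⟨Y, hY, v, hv, rfl⟩ := Submodule.mem_sup.1 hW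
    exact ⟨(⟨Y, Y, hY, rfl⟩, ⟨v, v, hv, rfl⟩, ⟨Z, Z, hZ, rfl⟩), congrArg Subtype.val hWZ⟩
  · rintro _ ⟨e, he, rfl⟩
    exact ⟨_, (matSubmodule.lift e.1).2, _, he, _, (matSubmodule.lift e.2.2).2, rfl⟩

end LocalProduct

namespace CartanData

variable (D : CartanData G) (hG : IsClosed (G : Set (GL (Fin n) ℝ)))

lemma expG_mem_K {Y : lieAlg G} (hY : Y ∈ D.𝔨) : expG hG Y ∈ D.K := by
  obtain ⟨k, hk, hkY⟩ := (D.θ_fixed_iff Y).1 hY 1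
  rw [one_smul] at hkY
  rwa [← eq_expG hG hkY]

lemma expG_mem_N {Z : lieAlg G} (hZ : Z ∈ D.𝔫) : expG hG Z ∈ D.N :=
  Subgroup.subset_closure ⟨Z, hZ, toMat_expG hG Z⟩

open scoped Pointwise in
/-- The Iwasawa decomposition `G = K A N`. -/
lemma exists_iwasawa [ConnectedSpace G] (g : G) :
    ∃ k ∈ D.K, ∃ v : D.𝔞, ∃ u ∈ D.N, g = k * expG hG v * u := by
  let S : Set G := {g | ∃ k ∈ D.K, ∃ v : D.𝔞, ∃ u ∈ D.N, g = k * expG hG v * u}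
  let R : Set G := {g | ∃ v : D.𝔞, ∃ u ∈ D.N, g = expG hG v * u}
  have hRinv : ∀ s ∈ R, s⁻¹ ∈ R := by
    rintro _ ⟨v, u, hu, rfl⟩
    obtain ⟨u', hu', h⟩ := D.expG_mul_comm_N hG (-v) (D.N.inv_mem hu)
    exact ⟨-v, u', hu', by rw [mul_inv_rev, ← h, Submodule.coe_neg, expG_neg]⟩
  have hSR : ∀ s ∈ S, ∀ r ∈ R, s * r ∈ S := by
    rintro _ ⟨k, hk, v, u, hu, rfl⟩ _ ⟨w, t, ht, rfl⟩
    obtain ⟨u', hu', h⟩ := D.expG_mul_comm_N hG w hu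
    refine ⟨k, hk, v + w, u' * t, D.N.mul_mem hu' ht, ?_⟩
    rw [expG_𝔞_add, mul_assoc (k * expG hG v), ← mul_assoc u, h]
    simp only [mul_assoc]
  have hKS : ∀ k ∈ D.K, ∀ s ∈ S, k * s ∈ S := by
    rintro k hk _ ⟨k', hk', v, u, hu, rfl⟩
    exact ⟨k * k', D.K.mul_mem hk hk', v, u, hu, by simp only [mul_assoc]⟩
  have hS1 : S ∈ 𝓝 (1 : G) := by
    refine mem_of_superset (D.iwasawa_mem_nhds hG (O := Set.univ) univ_mem) ?_
    rintro _ ⟨Y, hY, v, -, Z, hZ, rfl⟩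
    exact ⟨_, D.expG_mem_K hG hY, v, _, D.expG_mem_N hG hZ, rfl⟩
  -- `S = KAN` contains a neighbourhood of `1` and is stable under `K` on the left and `AN` on the
  -- right.
  have hopen : IsOpen S := by
    rw [isOpen_iff_mem_nhds]
    rintro _ ⟨k, hk, v, u, hu, rfl⟩
    have hc : Continuous fun x : G => k⁻¹ * x * (expG hG v * u)⁻¹ := by fun_prop
    have : (fun x : G => k⁻¹ * x * (expG hG v * u)⁻¹) ⁻¹' S ∈ 𝓝 (k * expG hG v * u) := by
      refine hc.continuousAt.preimage_mem_nhds ?_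
      convert hS1 using 2
      group
    refine mem_of_superset this fun x hx => ?_
    have h1 := hKS k hk _ (hSR _ hx _ ⟨v, u, hu, rfl⟩)
    convert h1 using 1
    group
  -- Compactness of `K` reduces the claim to limits `s` of `R = AN`. For `r ∈ R` close to `s`, `s
  -- r⁻¹` is near `1`, hence in `S`, and then `s = (s r⁻¹) r ∈ S`. Closedness of `AN` itself is not
  -- needed.
  have hclosed : IsClosed S := by
    have hSeq : S = (D.K : Set G) * R := by
      ext g
      constructor
      · rintro ⟨k, hk, v, u, hu, rfl⟩
        exact ⟨k, hk, _, ⟨v, u, hu, rfl⟩, by simp only [mul_assoc]⟩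
      · rintro ⟨k, hk, _, ⟨v, u, hu, rfl⟩, rfl⟩
        exact ⟨k, hk, v, u, hu, by simp only [mul_assoc]⟩
    have hcl : closure S ⊆ (D.K : Set G) * closure R := by
      rw [hSeq]
      exact closure_minimal (Set.mul_subset_mul_left subset_closure)
        (isClosed_closure.mul_left_of_isCompact D.isCompact_K)
    refine isClosed_of_closure_subset fun g hg => ?_
    obtain ⟨k, hk, s, hs, rfl⟩ := hcl hg
    refine hKS k hk s ?_
    have hc : Continuous fun x : G => s * x⁻¹ := by fun_prop
    have hnhds : (fun x : G => s * x⁻¹) ⁻¹' S ∈ 𝓝 s :=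
      hc.continuousAt.preimage_mem_nhds (by simpa using hS1)
    obtain ⟨r, hr, hrR⟩ := mem_closure_iff_nhds.1 hs _ hnhds
    simpa using hSR _ hr _ hrR
  have huniv : S = Set.univ := IsClopen.eq_univ ⟨hclosed, hopen⟩ ⟨1, mem_of_mem_nhds hS1⟩
  exact huniv.ge (Set.mem_univ g)

/-! ### The Iwasawa cocycle: equivariance and continuity. -/

lemma H_of_mem_K (hG : IsClosed (G : Set (GL (Fin n) ℝ))) {k : G} (hk : k ∈ D.K) : D.H k = 0 :=
  D.H_eq hG hk D.N.one_mem (by simp [expG_zero])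

variable [ConnectedSpace G]

lemma exists_iwasawa_H (g : G) : ∃ k ∈ D.K, ∃ u ∈ D.N, g = k * expG hG (D.H g) * u := by
  obtain ⟨k, hk, v, u, hu, h⟩ := D.exists_iwasawa hG g
  exact ⟨k, hk, u, hu, by rwa [D.H_eq hG hk hu h]⟩

lemma H_K_mul (hG : IsClosed (G : Set (GL (Fin n) ℝ))) {k : G} (hk : k ∈ D.K) (g : G) :
    D.H (k * g) = D.H g := by
  obtain ⟨k', hk', u, hu, h⟩ := D.exists_iwasawa_H hG g
  exact D.H_eq hG (D.K.mul_mem hk hk') hu (by rw [mul_assoc, mul_assoc, ← mul_assoc k', ← h])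

lemma H_mul_exp_mul (x : G) (v : D.𝔞) {u : G} (hu : u ∈ D.N) :
    D.H (x * (expG hG v * u)) = D.H x + v := by
  obtain ⟨k, hk, t, ht, h⟩ := D.exists_iwasawa_H hG x
  obtain ⟨t', ht', h'⟩ := D.expG_mul_comm_N hG v ht
  refine D.H_eq hG hk (D.N.mul_mem ht' hu) ?_
  rw [expG_𝔞_add]
  calc x * (expG hG v * u) = k * expG hG (D.H x) * (t * expG hG v) * u := by
        nth_rewrite 1 [h]
        simp only [mul_assoc]
    _ = _ := by rw [h']; simp only [mul_assoc]

lemma H_mul_M (hG : IsClosed (G : Set (GL (Fin n) ℝ))) (x : G) {m : G} (hm : m ∈ D.M) :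
    D.H (x * m) = D.H x := by
  obtain ⟨k, hk, t, ht, h⟩ := D.exists_iwasawa_H hG x
  have ht' : m⁻¹ * t * m ∈ D.N := by
    have := D.conj_mem_N hG (D.M.inv_mem hm).2 ht
    rwa [inv_inv] at this
  have hcomm : expG hG (D.H x) * m = m * expG hG (D.H x) := by
    have h1 : Ad hG m (D.H x : lieAlg G) = (D.H x : lieAlg G) := Subtype.ext (by
      rw [coe_Ad, hm.2 _ (D.H x).2, mul_assoc, toMat_mul_inv, mul_one])
    have := conj_expG hG m (D.H x : lieAlg G)
    rw [h1] at this
    exact (mul_inv_eq_iff_eq_mul.1 this).symm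
  refine D.H_eq hG (D.K.mul_mem hk hm.1) ht' ?_
  calc x * m = k * expG hG (D.H x) * t * m := by rw [← h]
    _ = k * (expG hG (D.H x) * m) * (m⁻¹ * t * m) := by group
    _ = _ := by rw [hcomm]; simp only [mul_assoc]

/-- The difference `H x - H y` is unchanged when `x`, `y` are multiplied on the right by the same
element of `P`. -/
lemma H_sub_H_mul_P (hG : IsClosed (G : Set (GL (Fin n) ℝ))) (x y : G) {p : G} (hp : p ∈ D.P) :
    D.H (x * p) - D.H (y * p) = D.H x - D.H y := by
  let Q : Subgroup G :=
    { carrier := {p | ∀ x y, D.H (x * p) - D.H (y * p) = D.H x - D.H y}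
      mul_mem' := fun {a b} ha hb x y => by rw [← mul_assoc, ← mul_assoc, hb, ha]
      one_mem' := fun x y => by rw [mul_one, mul_one]
      inv_mem' := fun {a} ha x y => by
        rw [← ha (x * a⁻¹) (y * a⁻¹), inv_mul_cancel_right, inv_mul_cancel_right] }
  have hle : D.P ≤ Q := by
    refine sup_le (sup_le ?_ ?_) ?_
    · intro m hm x y
      rw [D.H_mul_M hG x hm, D.H_mul_M hG y hm]
    · refine (Subgroup.closure_le _).2 ?_
      rintro a ⟨X, hX, ha⟩ x y
      have hexp := eq_expG hG ha
      have h1 : ∀ z, D.H (z * a) = D.H z + ⟨X, hX⟩ := fun z => by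
        have := D.H_mul_exp_mul hG z ⟨X, hX⟩ D.N.one_mem
        rwa [mul_one, ← hexp] at this
      rw [h1, h1, add_sub_add_right_eq_sub]
    · intro u hu x y
      have h1 : ∀ z, D.H (z * u) = D.H z := fun z => by
        have := D.H_mul_exp_mul hG z 0 hu
        rwa [ZeroMemClass.coe_zero, expG_zero, one_mul, add_zero] at this
      rw [h1, h1]
  exact hle hp x y

/-- The cocycle relation: `H (x g) - H g = H (x k)` for the `K`-part `k` of `g`. -/
lemma exists_H_mul_eq (hG : IsClosed (G : Set (GL (Fin n) ℝ))) (g : G) :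
    ∃ k ∈ D.K, ∀ x, D.H (x * g) = D.H (x * k) + D.H g := by
  obtain ⟨k, hk, u, hu, h⟩ := D.exists_iwasawa_H hG g
  refine ⟨k, hk, fun x => ?_⟩
  rw [← D.H_mul_exp_mul hG (x * k) (D.H g) hu]
  nth_rewrite 1 [h]
  simp only [mul_assoc]

/-- At `1` this is the local product decomposition. Elsewhere the cocycle relation gives `H x = H
(k⁻¹ x g⁻¹ k) + H g` with `k` the `K`-part of `g`, which moves the question from `g` to `1`. -/
lemma continuous_H (hG : IsClosed (G : Set (GL (Fin n) ℝ))) : Continuous D.H := by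
  have h1 : ContinuousAt D.H 1 := by
    rw [ContinuousAt, D.H_of_mem_K hG D.K.one_mem]
    intro O hO
    refine mem_map.2 (mem_of_superset (D.iwasawa_mem_nhds hG hO) ?_)
    rintro _ ⟨Y, hY, v, hv, Z, hZ, rfl⟩
    change D.H _ ∈ O
    rwa [D.H_eq hG (D.expG_mem_K hG hY) (D.expG_mem_N hG hZ) rfl]
  rw [continuous_iff_continuousAt]
  intro g
  obtain ⟨k, hk, hkg⟩ := D.exists_H_mul_eq hG g
  have heq : D.H = fun x => D.H (k⁻¹ * (x * g⁻¹) * k) + D.H g := by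
    ext1 x
    rw [mul_assoc, D.H_K_mul hG (D.K.inv_mem hk), ← hkg, inv_mul_cancel_right]
  rw [heq]
  have hc : Continuous fun x : G => k⁻¹ * (x * g⁻¹) * k := by fun_prop
  refine ContinuousAt.add (ContinuousAt.comp (g := D.H) ?_ hc.continuousAt) continuousAt_const
  simpa using h1

end CartanData

end Smearing

namespace Smearing

open Filter

variable {n : ℕ} {G : Subgroup (GL (Fin n) ℝ)}

namespace CartanData

variable (D : CartanData G)

/-! ### Small Riemannian balls -/

lemma continuous_pNorm : Continuous D.pNorm := by
  refine Real.continuous_sqrt.comp ?_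
  have hq : Continuous fun X : lieAlg G => killingForm ℝ (lieAlg G) X X := by
    let b := Module.finBasis ℝ (lieAlg G)
    have h : (fun X : lieAlg G => killingForm ℝ (lieAlg G) X X) =
        fun X => ∑ i, b.repr X i * killingForm ℝ (lieAlg G) (b i) X := by
      ext X
      have e := congrArg (fun Y => killingForm ℝ (lieAlg G) Y X) (b.sum_repr X)
      simp only [map_sum, LinearMap.sum_apply, map_smul, LinearMap.smul_apply, smul_eq_mul] at e
      exact e.symm
    rw [h]
    refine continuous_finsetSum _ fun i _ => Continuous.mul ?_ ?_
    · exact LinearMap.continuous_of_finiteDimensional (b.coord i)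
    · exact LinearMap.continuous_of_finiteDimensional (killingForm ℝ (lieAlg G) (b i))
  have hL : Continuous fun Z : lieAlg G => (1 / 2 : ℝ) • (Z - D.θ Z) := by
    have : Continuous D.θ :=
      LinearMap.continuous_of_finiteDimensional (D.θ : lieAlg G →ₗ[ℝ] lieAlg G)
    fun_prop
  exact hq.comp hL

lemma pNorm_nonneg (X : lieAlg G) : 0 ≤ D.pNorm X := Real.sqrt_nonneg _

lemma dist_le_of_isCurveLength {x y : D.X} {L : ℝ} (h : D.IsCurveLength x y L) : D.dist x y ≤ L := by
  refine csInf_le ⟨0, ?_⟩ h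
  rintro _ ⟨c, u, -, -, -, -, rfl⟩
  exact intervalIntegral.integral_nonneg zero_le_one fun t _ => D.pNorm_nonneg _

-- The curve `t ↦ g exp ((1 - t) X)` has constant logarithmic derivative `-X`. It ends at `g`, which
-- gives the order of arguments used in `oneNeighborhood` without appeal to symmetry of the
-- distance.
open scoped Matrix.Norms.Operator in
lemma dist_expG_le (hG : IsClosed (G : Set (GL (Fin n) ℝ))) (g : G) (X : lieAlg G) :
    D.dist (D.toX (g * expG hG X)) (D.toX g) ≤ D.pNorm (-X) := by
  refine D.dist_le_of_isCurveLength
    ⟨fun t => g * expG hG ((1 - t) • X), fun _ => -X, continuous_const, fun t i j => ?_, ?_, ?_, ?_⟩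
  · have h1 := hasDerivAt_exp_smul_const (𝕂 := ℝ) (X : Matrix (Fin n) (Fin n) ℝ) (1 - t)
    have h2 : HasDerivAt (fun s : ℝ => 1 - s) (-1) t := by
      simpa using (hasDerivAt_id t).const_sub 1
    have h3 := HasDerivAt.scomp (g₁ := fun u : ℝ =>
      NormedSpace.exp (u • (X : Matrix (Fin n) (Fin n) ℝ))) t h1 h2
    let Λ : Matrix (Fin n) (Fin n) ℝ →L[ℝ] ℝ := LinearMap.toContinuousLinearMap
      ((Matrix.entryLinearMap ℝ ℝ i j).comp (LinearMap.mulLeft ℝ (toMat g)))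
    have h4 := Λ.hasFDerivAt.comp_hasDerivAt t h3
    have hΛ : ∀ Y, Λ Y = (toMat g * Y) i j := fun Y => rfl
    simp only [Function.comp_def, hΛ] at h4
    have e1 : ∀ s : ℝ, toMat (g * expG hG ((1 - s) • X)) =
        toMat g * NormedSpace.exp ((1 - s) • (X : Matrix (Fin n) (Fin n) ℝ)) := fun s => by
      rw [toMat_mul, toMat_expG]
      rfl
    have e2 : ((-X : lieAlg G) : Matrix (Fin n) (Fin n) ℝ) = -(X : Matrix (Fin n) (Fin n) ℝ) := rfl
    simp only [e1, e2]
    have e3 : (toMat g * NormedSpace.exp ((1 - t) • (X : Matrix (Fin n) (Fin n) ℝ)) *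
        -(X : Matrix (Fin n) (Fin n) ℝ)) i j =
        Λ ((-1 : ℝ) • (NormedSpace.exp ((1 - t) • (X : Matrix (Fin n) (Fin n) ℝ)) * X)) := by
      rw [hΛ, neg_smul, one_smul, mul_neg, mul_neg, mul_assoc]
    rw [e3]
    exact h4
  · simp
  · simp [expG_zero]
  · simp

/-- There is a relatively compact open neighbourhood of `1` in `G` which moves all points of `X`
by less than one, when acting on the right. -/
lemma exists_nhds_dist_lt_one (hG : IsClosed (G : Set (GL (Fin n) ℝ))) [LocallyCompactSpace G] :
    ∃ B C : Set G, IsOpen B ∧ (1 : G) ∈ B ∧ B ⊆ C ∧ IsCompact C ∧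
      ∀ b ∈ B, ∀ g, D.dist (D.toX (g * b)) (D.toX g) < 1 := by
  obtain ⟨C, hC, hC1⟩ := exists_compact_mem_nhds (1 : G)
  have hO : {X : lieAlg G | D.pNorm (-X) < 1} ∈ 𝓝 0 := by
    refine (isOpen_lt (D.continuous_pNorm.comp continuous_neg) continuous_const).mem_nhds ?_
    simp [pNorm]
  have h1 := inter_mem (expG_image_mem_nhds hG hO) hC1
  obtain ⟨B, hB, hBo, h1B⟩ := mem_nhds_iff.1 h1
  refine ⟨B, C, hBo, h1B, fun b hb => (hB hb).2, hC, fun b hb g => ?_⟩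
  obtain ⟨X, hX, rfl⟩ := (hB hb).1
  exact (D.dist_expG_le hG g X).trans_lt hX

/-! ### The Busemann map -/

lemma isOpenQuotientMap_toX : IsOpenQuotientMap D.toX :=
  QuotientGroup.isOpenQuotientMap_mk

lemma isOpenQuotientMap_plus : IsOpenQuotientMap D.plus :=
  QuotientGroup.isOpenQuotientMap_mk

/-- The projection `G → G/M`. -/
def toGM (g : G) : D.GM := (QuotientGroup.mk g : G ⧸ D.M)

lemma isOpenQuotientMap_toGM : IsOpenQuotientMap D.toGM :=
  QuotientGroup.isOpenQuotientMap_mk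

lemma smul_toX (g h : G) : g • D.toX h = D.toX (g * h) := rfl

lemma smul_plus (g h : G) : g • D.plus h = D.plus (g * h) := rfl

lemma toX_mul_K (g : G) {k : G} (hk : k ∈ D.K) : D.toX (g * k) = D.toX g :=
  QuotientGroup.mk_mul_of_mem g hk

lemma plus_mul_P (g : G) {p : G} (hp : p ∈ D.P) : D.plus (g * p) = D.plus g :=
  QuotientGroup.mk_mul_of_mem g hp

lemma toGM_mul_M (g : G) {m : G} (hm : m ∈ D.M) : D.toGM (g * m) = D.toGM g :=
  QuotientGroup.mk_mul_of_mem g hm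

lemma exists_repX_eq (g : G) : ∃ k ∈ D.K, D.repX (D.toX g) = g * k := by
  obtain ⟨k, hk⟩ := QuotientGroup.mk_out_eq_mul D.K g
  exact ⟨k, k.2, hk⟩

lemma exists_repF_eq (g : G) : ∃ p ∈ D.P, D.repF (D.plus g) = g * p := by
  obtain ⟨k, hk⟩ := QuotientGroup.mk_out_eq_mul D.P g
  exact ⟨k, k.2, hk⟩

lemma exists_repGM_eq (g : G) : ∃ m : D.M, D.repGM (D.toGM g) = g * m :=
  QuotientGroup.mk_out_eq_mul D.M g

lemma toGM_repGM (q : D.GM) : D.toGM (D.repGM q) = q :=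
  Quotient.out_eq (s := QuotientGroup.leftRel D.M) q

lemma M_le_P : D.M ≤ D.P := le_sup_left.trans le_sup_left

/-- `w₀` normalizes `𝔞`, hence also its centralizer in `K`. This is what makes `g⁻` well defined on
`G/M`. -/
lemma conj_w₀_mem_M {m : G} (hm : m ∈ D.M) : D.w₀⁻¹ * m * D.w₀ ∈ D.M := by
  refine ⟨D.K.mul_mem (D.K.mul_mem (D.K.inv_mem D.w₀_mem) hm.1) D.w₀_mem, fun X hX => ?_⟩
  obtain ⟨u, hu⟩ := D.w₀_normalizes ⟨X, hX⟩
  simp only at hu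
  have h1 : toMat D.w₀ * (X : Matrix (Fin n) (Fin n) ℝ) = (u : lieAlg G) * toMat D.w₀ := by
    rw [← hu, mul_assoc, toMat_inv_mul, mul_one]
  have h2 : (X : Matrix (Fin n) (Fin n) ℝ) * toMat D.w₀⁻¹ = toMat D.w₀⁻¹ * (u : lieAlg G) := by
    rw [← hu, mul_assoc, ← mul_assoc (toMat D.w₀⁻¹), toMat_inv_mul, one_mul]
  rw [toMat_mul, toMat_mul, mul_assoc, h1, mul_assoc, ← mul_assoc (toMat m), hm.2 _ u.2,
    ← mul_assoc, ← mul_assoc, ← h2]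
  simp only [mul_assoc]

lemma minus_eq_plus (g : G) : D.minus g = D.plus (g * D.w₀) := rfl

lemma minus_mul_M (g : G) {m : G} (hm : m ∈ D.M) : D.minus (g * m) = D.minus g := by
  have : g * m * D.w₀ = g * D.w₀ * (D.w₀⁻¹ * m * D.w₀) := by group
  rw [minus_eq_plus, minus_eq_plus, this, D.plus_mul_P _ (D.M_le_P (D.conj_w₀_mem_M hm))]

lemma busemann_add (ξ : D.F) (x y z : D.X) :
    D.busemann ξ x y + D.busemann ξ y z = D.busemann ξ x z := by
  simp [busemann]

lemma neg_busemann (ξ : D.F) (x y : D.X) : -D.busemann ξ x y = D.busemann ξ y x := by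
  simp [busemann]

/-- The chosen representatives drop out: `H` is left `K`-invariant, and differences of values of `H`
are unchanged by a common right factor in `P`. -/
lemma busemann_plus [ConnectedSpace G]
    (hG : IsClosed (G : Set (GL (Fin n) ℝ))) (h g g' : G) :
    D.busemann (D.plus h) (D.toX g) (D.toX g') = D.H (g⁻¹ * h) - D.H (g'⁻¹ * h) := by
  obtain ⟨k, hk, e1⟩ := D.exists_repX_eq g
  obtain ⟨k', hk', e2⟩ := D.exists_repX_eq g'
  obtain ⟨p, hp, e3⟩ := D.exists_repF_eq h
  rw [busemann, e1, e2, e3, mul_inv_rev, mul_inv_rev, mul_assoc, mul_assoc,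
    D.H_K_mul hG (D.K.inv_mem hk), D.H_K_mul hG (D.K.inv_mem hk'), ← mul_assoc, ← mul_assoc,
    D.H_sub_H_mul_P hG _ _ hp]

lemma busemann_smul [ConnectedSpace G]
    (hG : IsClosed (G : Set (GL (Fin n) ℝ))) (g : G) (ξ : D.F) (x y : D.X) :
    D.busemann (g • ξ) (g • x) (g • y) = D.busemann ξ x y := by
  obtain ⟨h, rfl⟩ := D.isOpenQuotientMap_plus.surjective ξ
  obtain ⟨a, rfl⟩ := D.isOpenQuotientMap_toX.surjective x
  obtain ⟨b, rfl⟩ := D.isOpenQuotientMap_toX.surjective y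
  rw [smul_plus, smul_toX, smul_toX, D.busemann_plus hG, D.busemann_plus hG]
  simp [mul_assoc]

lemma continuous_busemann [ConnectedSpace G]
    (hG : IsClosed (G : Set (GL (Fin n) ℝ))) (x : D.X) :
    Continuous fun p : D.F × D.X => D.busemann p.1 x p.2 := by
  obtain ⟨a, rfl⟩ := D.isOpenQuotientMap_toX.surjective x
  rw [(D.isOpenQuotientMap_plus.prodMap D.isOpenQuotientMap_toX).isQuotientMap.continuous_iff]
  have hH := D.continuous_H hG
  have : (fun p : D.F × D.X => D.busemann p.1 (D.toX a) p.2) ∘ Prod.map D.plus D.toX =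
      fun p : G × G => D.H (a⁻¹ * p.1) - D.H (p.2⁻¹ * p.1) := by
    ext1 p
    exact D.busemann_plus hG _ _ _
  rw [this]
  fun_prop

/-- If `k` is the `K`-part of `g⁻¹h`, the cocycle relation gives `β_{hP}(gb o, g o) = H (b⁻¹ k)`,
which depends only on `b` and `k`; the bound is therefore uniform in `g` and `ξ`. -/
lemma exists_isCompact_busemann_mem [ConnectedSpace G]
    (hG : IsClosed (G : Set (GL (Fin n) ℝ))) {C : Set G}
    (hC : IsCompact C) : ∃ C₀ : Set D.𝔞, IsCompact C₀ ∧ ∀ b ∈ C, ∀ (g : G) (ξ : D.F),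
      D.busemann ξ (D.toX (g * b)) (D.toX g) ∈ C₀ := by
  have hH := D.continuous_H hG
  refine ⟨(fun p : G × G => D.H (p.1⁻¹ * p.2)) '' (C ×ˢ (D.K : Set G)),
    (hC.prod D.isCompact_K).image (by fun_prop), fun b hb g ξ => ?_⟩
  obtain ⟨h, rfl⟩ := D.isOpenQuotientMap_plus.surjective ξ
  obtain ⟨k, hk, hkg⟩ := D.exists_H_mul_eq hG (g⁻¹ * h)
  refine ⟨(b, k), ⟨hb, hk⟩, ?_⟩
  rw [D.busemann_plus hG, mul_inv_rev, mul_assoc, hkg]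
  simp

/-! ### Hopf coordinates -/

lemma hopf_toGM (g : G) : hopf D (D.toGM g) =
    (D.plus g, D.minus g, D.busemann (D.minus g) D.o (D.toX g)) := by
  obtain ⟨m, hm⟩ := D.exists_repGM_eq g
  rw [hopf, hm, D.plus_mul_P _ (D.M_le_P m.2), D.minus_mul_M _ m.2, D.toX_mul_K _ m.2.1]

lemma continuous_hopf [ConnectedSpace G]
    (hG : IsClosed (G : Set (GL (Fin n) ℝ))) : Continuous (hopf D) := by
  rw [D.isOpenQuotientMap_toGM.isQuotientMap.continuous_iff]
  have h1 : Continuous D.plus := D.isOpenQuotientMap_plus.continuous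
  have h2 : Continuous D.minus := h1.comp (continuous_mul_const D.w₀)
  have h3 : Continuous D.toX := D.isOpenQuotientMap_toX.continuous
  have : hopf D ∘ D.toGM = fun g => (D.plus g, D.minus g,
      D.busemann (D.minus g) D.o (D.toX g)) := funext D.hopf_toGM
  rw [this]
  have h4 : Continuous fun g => D.busemann (D.minus g) D.o (D.toX g) :=
    Continuous.comp (g := fun p : D.F × D.X => D.busemann p.1 D.o p.2)
      (f := fun g => (D.minus g, D.toX g)) (D.continuous_busemann hG D.o) (h2.prodMk h3)
  exact h1.prodMk (h2.prodMk h4)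

/-- The density of the Bowen-Margulis-Sullivan measure in Hopf coordinates. -/
def bmsDensity (ψ₁ ψ₂ : Module.Dual ℝ D.𝔞) (q : D.GM) : ℝ :=
  ψ₁ (D.busemann (D.plus (D.repGM q)) D.o (D.toX (D.repGM q))) +
    ψ₂ (D.busemann (D.minus (D.repGM q)) D.o (D.toX (D.repGM q)))

lemma bmsDensity_toGM (ψ₁ ψ₂ : Module.Dual ℝ D.𝔞) (g : G) : D.bmsDensity ψ₁ ψ₂ (D.toGM g) =
    ψ₁ (D.busemann (D.plus g) D.o (D.toX g)) + ψ₂ (D.busemann (D.minus g) D.o (D.toX g)) := by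
  obtain ⟨m, hm⟩ := D.exists_repGM_eq g
  rw [bmsDensity, hm, D.plus_mul_P _ (D.M_le_P m.2), D.minus_mul_M _ m.2, D.toX_mul_K _ m.2.1]

lemma continuous_dual (ψ : Module.Dual ℝ D.𝔞) : Continuous ψ :=
  LinearMap.continuous_of_finiteDimensional ψ

lemma continuous_bmsDensity [ConnectedSpace G]
    (hG : IsClosed (G : Set (GL (Fin n) ℝ))) (ψ₁ ψ₂ : Module.Dual ℝ D.𝔞) :
    Continuous (D.bmsDensity ψ₁ ψ₂) := by
  rw [D.isOpenQuotientMap_toGM.isQuotientMap.continuous_iff]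
  have h1 : Continuous D.plus := D.isOpenQuotientMap_plus.continuous
  have h2 : Continuous D.minus := h1.comp (continuous_mul_const D.w₀)
  have h3 : Continuous D.toX := D.isOpenQuotientMap_toX.continuous
  have : D.bmsDensity ψ₁ ψ₂ ∘ D.toGM = fun g => ψ₁ (D.busemann (D.plus g) D.o (D.toX g)) +
      ψ₂ (D.busemann (D.minus g) D.o (D.toX g)) := funext (D.bmsDensity_toGM ψ₁ ψ₂)
  rw [this]
  have hb : ∀ f : G → D.F, Continuous f → Continuous fun g => D.busemann (f g) D.o (D.toX g) :=
    fun f hf => Continuous.comp (g := fun p : D.F × D.X => D.busemann p.1 D.o p.2)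
      (f := fun g => (f g, D.toX g)) (D.continuous_busemann hG D.o) (hf.prodMk h3)
  exact ((D.continuous_dual ψ₁).comp (hb _ h1)).add ((D.continuous_dual ψ₂).comp (hb _ h2))

/-- The action of `g ∈ G` on `G/M`. -/
def smulGM (g : G) : D.GM ≃ₜ D.GM := (Homeomorph.smul g : G ⧸ D.M ≃ₜ G ⧸ D.M)

lemma smulGM_toGM (g h : G) : D.smulGM g (D.toGM h) = D.toGM (g * h) := rfl

/-- The added terms come from `β_{γξ}(o, γgo) = β_{γξ}(o, γo) + β_ξ(o, go)`. They are the logarithm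
of the Jacobian of `γ` in Hopf coordinates. -/
lemma bmsDensity_smulGM [ConnectedSpace G]
    (hG : IsClosed (G : Set (GL (Fin n) ℝ))) (ψ₁ ψ₂ : Module.Dual ℝ D.𝔞)
    (γ : G) (q : D.GM) : D.bmsDensity ψ₁ ψ₂ (D.smulGM γ q) = D.bmsDensity ψ₁ ψ₂ q +
      (ψ₁ (D.busemann (hopf D (D.smulGM γ q)).1 D.o (γ • D.o)) +
        ψ₂ (D.busemann (hopf D (D.smulGM γ q)).2.1 D.o (γ • D.o))) := by
  obtain ⟨g, rfl⟩ := D.isOpenQuotientMap_toGM.surjective q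
  have h : ∀ ξ : D.F, D.busemann (γ • ξ) D.o (D.toX (γ * g)) =
      D.busemann (γ • ξ) D.o (γ • D.o) + D.busemann ξ D.o (D.toX g) := fun ξ => by
    rw [← D.busemann_smul hG γ ξ D.o, busemann_add, smul_toX]
  have hp : D.plus (γ * g) = γ • D.plus g := rfl
  have hm : D.minus (γ * g) = γ • D.minus g := by
    rw [minus_eq_plus, mul_assoc]
    rfl
  rw [smulGM_toGM, bmsDensity_toGM, bmsDensity_toGM, hopf_toGM, hp, hm, h, h, map_add, map_add]
  ring

/-- The action of `γ ∈ G` in Hopf coordinates. -/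
def hopfAction (γ : G) (p : D.F × D.F × D.𝔞) : D.F × D.F × D.𝔞 :=
  (γ • p.1, γ • p.2.1, D.busemann (γ • p.2.1) D.o (γ • D.o) + p.2.2)

lemma hopf_smulGM [ConnectedSpace G]
    (hG : IsClosed (G : Set (GL (Fin n) ℝ))) (γ : G) (q : D.GM) :
    hopf D (D.smulGM γ q) = D.hopfAction γ (hopf D q) := by
  obtain ⟨g, rfl⟩ := D.isOpenQuotientMap_toGM.surjective q
  have hm : D.minus (γ * g) = γ • D.minus g := by
    rw [minus_eq_plus, mul_assoc]
    rfl
  rw [smulGM_toGM, hopf_toGM, hopf_toGM, hopfAction, hm,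
    ← D.busemann_smul hG γ (D.minus g) D.o, busemann_add]
  rfl

end CartanData

end Smearing

namespace Smearing

open Filter

/-! ### Pullbacks of measures -/

section Comap

variable {α β : Type*} [MeasurableSpace α] [MeasurableSpace β] {f : α → β} {μ : Measure β}

/-- `Measure.comap` takes the value zero unless the map is injective with null-measurable images.
This and the other pullback lemmas treat that default case too, so they apply without knowing that
the Hopf map is injective. -/
lemma sFinite_comap (f : α → β) (μ : Measure β) [SFinite μ] : SFinite (μ.comap f) := by
  by_cases hf : Function.Injective f ∧ ∀ s, MeasurableSet s → NullMeasurableSet (f '' s) μ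
  · have hi : ∀ i s, MeasurableSet s → NullMeasurableSet (f '' s) (sfiniteSeq μ i) :=
      fun i s hs => (hf.2 s hs).mono (sfiniteSeq_le μ i)
    have heq : μ.comap f = Measure.sum fun i => (sfiniteSeq μ i).comap f := by
      ext s hs
      rw [Measure.comap_apply₀ f μ hf.1 hf.2 hs.nullMeasurableSet, Measure.sum_apply _ hs]
      nth_rewrite 1 [← sum_sfiniteSeq μ]
      rw [Measure.sum_apply₀]
      · exact tsum_congr fun i =>
          (Measure.comap_apply₀ f _ hf.1 (hi i) hs.nullMeasurableSet).symm
      · rw [sum_sfiniteSeq]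
        exact hf.2 s hs
    have hfin : ∀ i, IsFiniteMeasure ((sfiniteSeq μ i).comap f) := fun i =>
      ⟨(Measure.comap_apply_le f _ MeasurableSet.univ.nullMeasurableSet).trans_lt
        (measure_lt_top _ _)⟩
    rw [heq]
    infer_instance
  · rw [Measure.comap_undef hf]
    infer_instance

lemma map_comap_le (hf : Measurable f) : (μ.comap f).map f ≤ μ := by
  refine Measure.le_iff.2 fun s hs => ?_
  rw [Measure.map_apply hf hs]
  exact (Measure.comap_apply_le f μ (hf hs).nullMeasurableSet).trans
    (measure_mono (Set.image_preimage_subset f s))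

lemma image_nullMeasurableSet_map (e : α ≃ᵐ α) (T : β ≃ᵐ β) (h : ∀ x, f (e x) = T (f x))
    (hf : ∀ s, MeasurableSet s → NullMeasurableSet (f '' s) μ) {s : Set α} (hs : MeasurableSet s) :
    NullMeasurableSet (f '' s) (μ.map T) := by
  have h1 : f '' s = T.symm ⁻¹' (f '' (e ⁻¹' s)) := by
    ext y
    constructor
    · rintro ⟨x, hx, rfl⟩
      refine ⟨e.symm x, by simpa using hx, ?_⟩
      rw [T.eq_symm_apply, ← h, e.apply_symm_apply]
    · rintro ⟨x, hx, hxy⟩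
      refine ⟨e x, hx, ?_⟩
      rw [h, hxy, T.apply_symm_apply]
  rw [h1]
  refine (hf _ (e.measurable hs)).preimage ⟨T.symm.measurable, ?_⟩
  rw [Measure.map_map T.symm.measurable T.measurable]
  simp [Measure.AbsolutelyContinuous.rfl]

/-- When `f` intertwines `e` and `T`, images under `f` are carried along by `T`; hence the two
pullbacks are also degenerate at the same time. -/
lemma map_comap_equiv (e : α ≃ᵐ α) (T : β ≃ᵐ β) (h : ∀ x, f (e x) = T (f x)) :
    (μ.comap f).map e = (μ.map T).comap f := by
  by_cases hf : Function.Injective f ∧ ∀ s, MeasurableSet s → NullMeasurableSet (f '' s) μ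
  · ext s hs
    rw [e.map_apply, Measure.comap_apply₀ f μ hf.1 hf.2 (e.measurable hs).nullMeasurableSet,
      Measure.comap_apply₀ f _ hf.1 (fun s hs => image_nullMeasurableSet_map e T h hf.2 hs)
        hs.nullMeasurableSet, T.map_apply]
    congr 1
    ext y
    constructor
    · rintro ⟨x, hx, rfl⟩
      exact ⟨e x, hx, h x⟩
    · rintro ⟨x, hx, hxy⟩
      refine ⟨e.symm x, by simpa using hx, ?_⟩
      refine T.injective ?_
      rw [← hxy, ← h, e.apply_symm_apply]
  · have hf' : ¬ (Function.Injective f ∧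
        ∀ s, MeasurableSet s → NullMeasurableSet (f '' s) (μ.map T)) := fun h' => hf ⟨h'.1, by
      have := fun s hs => image_nullMeasurableSet_map (μ := μ.map T) (f := f) e.symm T.symm
        (fun x => by rw [T.eq_symm_apply, ← h, e.apply_symm_apply]) h'.2 (s := s) hs
      simpa using this⟩
    rw [Measure.comap_undef hf, Measure.comap_undef hf', Measure.map_zero]

/-- Nonvanishing of `J` makes `μ` and `μ.withDensity J` mutually absolutely continuous, so that both
pullbacks are degenerate together. -/
lemma comap_withDensity (hf : Measurable f) {J : β → ℝ≥0∞} (hJ : Measurable J)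
    (hJ0 : ∀ y, J y ≠ 0) : (μ.withDensity J).comap f = (μ.comap f).withDensity (J ∘ f) := by
  by_cases h : Function.Injective f ∧ ∀ s, MeasurableSet s → NullMeasurableSet (f '' s) μ
  · have h' : ∀ s, MeasurableSet s → NullMeasurableSet (f '' s) (μ.withDensity J) :=
      fun s hs => (h.2 s hs).mono_ac (withDensity_absolutelyContinuous μ J)
    ext s hs
    rw [Measure.comap_apply₀ f _ h.1 h' hs.nullMeasurableSet, withDensity_apply _ hs,
      withDensity_apply₀ _ (h.2 s hs)]
    have hres : ((μ.comap f).restrict s).map f = μ.restrict (f '' s) := by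
      ext t ht
      rw [Measure.map_apply hf ht, Measure.restrict_apply (hf ht), Measure.restrict_apply ht,
        Measure.comap_apply₀ f μ h.1 h.2 ((hf ht).inter hs).nullMeasurableSet,
        Set.image_preimage_inter]
    rw [← hres, lintegral_map hJ hf]
    rfl
  · have h' : ¬ (Function.Injective f ∧
        ∀ s, MeasurableSet s → NullMeasurableSet (f '' s) (μ.withDensity J)) := fun h' =>
      h ⟨h'.1, fun s hs => (h'.2 s hs).mono_ac (withDensity_absolutelyContinuous' hJ.aemeasurable
        (Eventually.of_forall hJ0))⟩
    rw [Measure.comap_undef h, Measure.comap_undef h', withDensity_zero_left]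

end Comap

/-! ### Unfolding -/

section Unfolding

lemma LeftQuot.continuous_mk (Γ : Type*) [Group Γ] {Y : Type*} [MulAction Γ Y]
    [TopologicalSpace Y] : Continuous (LeftQuot.mk Γ : Y → LeftQuot Γ Y) :=
  continuous_quotient_mk'

lemma LeftQuot.mk_eq_mk {Γ : Type*} [Group Γ] {Y : Type*} [MulAction Γ Y] [TopologicalSpace Y]
    {x y : Y} : LeftQuot.mk Γ x = LeftQuot.mk Γ y ↔ ∃ γ : Γ, γ • y = x :=
  Quotient.eq (r := MulAction.orbitRel Γ Y)

lemma LeftQuot.mk_smul {Γ : Type*} [Group Γ] {Y : Type*} [MulAction Γ Y] [TopologicalSpace Y]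
    (γ : Γ) (y : Y) : LeftQuot.mk Γ (γ • y) = LeftQuot.mk Γ y :=
  LeftQuot.mk_eq_mk.2 ⟨γ, rfl⟩

/-- A Borel set which meets each orbit exactly once. -/
lemma exists_measurableSet_injOn_mk (Γ : Type*) [Group Γ] [Countable Γ] {X : Type*}
    [MulAction Γ X] [TopologicalSpace X] [SecondCountableTopology X] [MeasurableSpace X]
    [BorelSpace X] [ContinuousConstSMul Γ X]
    (h : ∀ x : X, ∃ V ∈ 𝓝 x, ∀ γ : Γ, ∀ v ∈ V, γ • v ∈ V → γ • v = v) :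
    ∃ F : Set X, MeasurableSet F ∧ Set.InjOn (LeftQuot.mk Γ) F ∧ ∀ x, ∃ γ : Γ, γ • x ∈ F := by
  rcases isEmpty_or_nonempty X with hX | hX
  · exact ⟨∅, MeasurableSet.empty, Set.injOn_empty _, fun x => (IsEmpty.false x).elim⟩
  choose V' hV' hinj' using h
  choose V hVV' hVo hxV using fun x => mem_nhds_iff.1 (hV' x)
  have hinj : ∀ x, ∀ γ : Γ, ∀ v ∈ V x, γ • v ∈ V x → γ • v = v :=
    fun x γ v hv hγ => hinj' x γ v (hVV' x hv) (hVV' x hγ)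
  obtain ⟨s, hs, hcov⟩ := TopologicalSpace.countable_cover_nhds
    (fun x => (hVo x).mem_nhds (hxV x))
  have hsne : s.Nonempty := by
    obtain ⟨x⟩ := hX
    obtain ⟨i, hi, -⟩ := Set.mem_iUnion₂.1 (hcov.ge (Set.mem_univ x))
    exact ⟨i, hi⟩
  obtain ⟨u, rfl⟩ := hs.exists_eq_range hsne
  -- `W i` is the saturation of the `i`-th small set. The domain takes from each small set only the
  -- orbits not met by an earlier one, so every orbit is represented at its least index.
  let W : ℕ → Set X := fun i => ⋃ γ : Γ, (fun x => γ • x) ⁻¹' V (u i)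
  have hW : ∀ i, IsOpen (W i) := fun i =>
    isOpen_iUnion fun γ => (hVo _).preimage (continuous_const_smul γ)
  have hWinv : ∀ i (γ : Γ) x, γ • x ∈ W i → x ∈ W i := fun i γ x hx => by
    obtain ⟨γ', hγ'⟩ := Set.mem_iUnion.1 hx
    exact Set.mem_iUnion.2 ⟨γ' * γ, by simpa [mul_smul] using hγ'⟩
  refine ⟨⋃ i, V (u i) \ ⋃ j ∈ Set.Iio i, W j, ?_, ?_, fun x => ?_⟩
  · exact MeasurableSet.iUnion fun i => (hVo _).measurableSet.diff
      (MeasurableSet.biUnion (Set.to_countable _) fun j _ => (hW j).measurableSet)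
  · intro x hx y hy hxy
    obtain ⟨γ, rfl⟩ := LeftQuot.mk_eq_mk.1 hxy
    obtain ⟨i, hi, hi'⟩ := Set.mem_iUnion.1 hx
    obtain ⟨j, hj, hj'⟩ := Set.mem_iUnion.1 hy
    rcases lt_trichotomy i j with hij | rfl | hij
    · exact (hj' (Set.mem_biUnion hij (Set.mem_iUnion.2 ⟨γ, hi⟩))).elim
    · exact hinj _ γ y hj hi
    · exact (hi' (Set.mem_biUnion hij (Set.mem_iUnion.2 ⟨γ⁻¹, by simpa using hj⟩))).elim
  · have hex : ∃ i, x ∈ W i := by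
      obtain ⟨_, ⟨i, rfl⟩, hi⟩ := Set.mem_iUnion₂.1 (hcov.ge (Set.mem_univ x))
      exact ⟨i, Set.mem_iUnion.2 ⟨1, by simpa using hi⟩⟩
    classical
    obtain ⟨γ, hγ⟩ := Set.mem_iUnion.1 (Nat.find_spec hex)
    refine ⟨γ, Set.mem_iUnion.2 ⟨Nat.find hex, hγ, fun hcon => ?_⟩⟩
    obtain ⟨j, hj, hjW⟩ := Set.mem_iUnion₂.1 hcon
    exact Nat.find_min hex hj (hWinv j γ x hjW)

variable {G X : Type*} [Group G] [TopologicalSpace G] [IsTopologicalGroup G]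
  [TopologicalSpace X] [MulAction G X] [ContinuousSMul G X]

lemma isOpen_inv_smul_mem {V : Set X} (hV : IsOpen V) :
    IsOpen {p : G × X | p.1⁻¹ • p.2 ∈ V} :=
  hV.preimage (continuous_fst.inv.smul continuous_snd)

variable [MeasurableSpace G] [BorelSpace G]
  [SecondCountableTopology X] [MeasurableSpace X] [BorelSpace X]

/-- The mass of `A ⊆ G` is recovered from the sets `{g ∈ A | x ∈ g V}`, `x ∈ X`. -/
lemma lintegral_measure_inv_smul_mem {μ : Measure G} [SFinite μ] {vol : Measure X} [SFinite vol]
    (hvol : ∀ g : G, vol.map (fun x => g • x) = vol) {V : Set X} (hV : IsOpen V) {A : Set G}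
    (hA : MeasurableSet A) :
    ∫⁻ x, μ {g | g ∈ A ∧ g⁻¹ • x ∈ V} ∂vol = vol V * μ A := by
  let S : Set (G × X) := {p | p.1 ∈ A ∧ p.1⁻¹ • p.2 ∈ V}
  have hS : MeasurableSet S := (measurable_fst hA).inter (isOpen_inv_smul_mem hV).measurableSet
  have h1 := Measure.prod_apply (μ := μ) (ν := vol) hS
  rw [Measure.prod_apply_symm hS] at h1
  refine h1.trans ?_
  have h2 : ∀ g, vol (Prod.mk g ⁻¹' S) = A.indicator (fun _ => vol V) g := fun g => by
    by_cases hg : g ∈ A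
    · rw [Set.indicator_of_mem hg, ← hvol g⁻¹,
        Measure.map_apply (continuous_const_smul g⁻¹).measurable hV.measurableSet, hvol g⁻¹]
      congr 1
      ext x
      simp [S, hg]
    · rw [Set.indicator_of_notMem hg]
      have : Prod.mk g ⁻¹' S = ∅ := by
        ext x
        simp [S, hg]
      rw [this, measure_empty]
  simp_rw [h2]
  rw [lintegral_indicator hA, setLIntegral_const]

/-- Unfolding: if `ΓF = X`, the mass of `S ⊆ Γ\G` for the measure induced by `μ` is bounded by an
integral over `F`. -/
lemma inducedMeasure_le_lintegral {Γ : Subgroup G} [Countable Γ] {μ : Measure G} [SFinite μ]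
    (hμ : ∀ γ : Γ, μ.map (fun g => (γ : G) * g) = μ) {vol : Measure X} [SFinite vol]
    (hvol : ∀ g : G, vol.map (fun x => g • x) = vol) {V : Set X} (hV : IsOpen V)
    (hV0 : vol V ≠ 0) (hVtop : vol V ≠ ∞) {F : Set X} (hF : MeasurableSet F)
    (hcov : ∀ x : X, ∃ γ : Γ, γ • x ∈ F) {S : Set (LeftQuot Γ G)} (hS : MeasurableSet S) :
    vol V * inducedMeasure Γ μ S ≤
      ∫⁻ x in F, μ {g | LeftQuot.mk Γ g ∈ S ∧ g⁻¹ • x ∈ V} ∂vol := by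
  have hmk : Measurable (LeftQuot.mk Γ : G → LeftQuot Γ G) := (LeftQuot.continuous_mk Γ).measurable
  let Z : Set (X × G) := {p | p.2⁻¹ • p.1 ∈ V}
  have hZ : MeasurableSet Z :=
    (hV.preimage (continuous_snd.inv.smul continuous_fst)).measurableSet
  -- As a function of `S` the right-hand side is a measure. The induced measure is a supremum of
  -- measures, so it suffices to bound each competitor `B`.
  let R : Measure (LeftQuot Γ G) :=
    (((vol.restrict F).prod μ).restrict Z).map fun p => LeftQuot.mk Γ p.2
  have hR : ∀ S, MeasurableSet S →
      R S = ∫⁻ x in F, μ {g | LeftQuot.mk Γ g ∈ S ∧ g⁻¹ • x ∈ V} ∂vol := fun S hS => by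
    have hm : Measurable fun p : X × G => LeftQuot.mk Γ p.2 := hmk.comp measurable_snd
    rw [Measure.map_apply hm hS, Measure.restrict_apply (hm hS),
      Measure.prod_apply ((hm hS).inter hZ)]
    rfl
  suffices h : inducedMeasure Γ μ ≤ (vol V)⁻¹ • R by
    rw [← hR S hS]
    calc vol V * inducedMeasure Γ μ S ≤ vol V * ((vol V)⁻¹ * R S) := by
          gcongr
          exact h S
      _ = R S := by rw [← mul_assoc, ENNReal.mul_inv_cancel hV0 hVtop, one_mul]
  refine iSup_le fun B => Measure.le_iff.2 fun S hS => ?_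
  obtain ⟨B, hB, hBinj⟩ := B
  rw [Measure.map_apply hmk hS, Measure.restrict_apply (hmk hS), Measure.smul_apply, smul_eq_mul,
    hR S hS]
  set A : Set G := LeftQuot.mk Γ ⁻¹' S ∩ B with hAdef
  have hA : MeasurableSet A := (hmk hS).inter hB
  rw [mul_comm, ← div_eq_mul_inv,
    ENNReal.le_div_iff_mul_le (Or.inl hV0) (Or.inl hVtop), mul_comm,
    ← lintegral_measure_inv_smul_mem hvol hV hA]
  have hφ : Measurable fun x => μ {g | g ∈ A ∧ g⁻¹ • x ∈ V} :=
    measurable_measure_prodMk_left (ν := μ) (s := {p : X × G | p.2 ∈ A ∧ p.2⁻¹ • p.1 ∈ V})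
      ((measurable_snd hA).inter hZ)
  have hpre : (⋃ γ : Γ, (fun x : X => γ • x) ⁻¹' F) = Set.univ := by
    rw [Set.eq_univ_iff_forall]
    exact fun x => Set.mem_iUnion.2 (hcov x)
  -- Invariance of `μ` trades the translate of `x` for the translate `γA` of `A`.
  have htrans : ∀ (γ : Γ) (x : X), μ {g | g ∈ A ∧ g⁻¹ • (γ⁻¹ • x) ∈ V} =
      μ {g | (γ : G)⁻¹ * g ∈ A ∧ g⁻¹ • x ∈ V} := fun γ x => by
    conv_rhs => rw [← hμ γ]
    rw [Measure.map_apply (measurable_const_mul _)]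
    · congr 1
      ext g
      simp only [Set.mem_ofPred_eq, Set.mem_preimage, inv_mul_cancel_left, mul_inv_rev, mul_smul]
      rfl
    · have := (isOpen_inv_smul_mem (G := G) hV).preimage (Continuous.prodMk_left x)
      exact ((measurable_const_mul _) hA).inter this.measurableSet
  calc ∫⁻ x, μ {g | g ∈ A ∧ g⁻¹ • x ∈ V} ∂vol
      = ∫⁻ x in ⋃ γ : Γ, (fun x : X => γ • x) ⁻¹' F, μ {g | g ∈ A ∧ g⁻¹ • x ∈ V} ∂vol := by
        rw [hpre, setLIntegral_univ]
    _ ≤ ∑' γ : Γ, ∫⁻ x in (fun x : X => γ • x) ⁻¹' F, μ {g | g ∈ A ∧ g⁻¹ • x ∈ V} ∂vol :=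
        lintegral_iUnion_le _ _
    _ = ∑' γ : Γ, ∫⁻ x in F, μ {g | g ∈ A ∧ g⁻¹ • (γ⁻¹ • x) ∈ V} ∂vol := by
        refine tsum_congr fun γ => ?_
        have hmp : MeasurePreserving (fun x : X => γ • x) vol vol :=
          ⟨(continuous_const_smul (γ : G)).measurable, hvol γ⟩
        have hm2 : Measurable fun x : X => γ⁻¹ • x :=
          (continuous_const_smul ((γ⁻¹ : Γ) : G)).measurable
        have := hmp.setLIntegral_comp_preimage hF (hφ.comp hm2)
        simp only [Function.comp, inv_smul_smul] at this
        exact this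
    _ = ∫⁻ x in F, ∑' γ : Γ, μ {g | (γ : G)⁻¹ * g ∈ A ∧ g⁻¹ • x ∈ V} ∂vol := by
        rw [lintegral_tsum]
        · simp_rw [htrans]
        · intro γ
          simp_rw [← htrans]
          have hm2 : Measurable fun x : X => γ⁻¹ • x :=
            (continuous_const_smul ((γ⁻¹ : Γ) : G)).measurable
          exact (hφ.comp hm2).aemeasurable
    _ ≤ ∫⁻ x in F, μ {g | LeftQuot.mk Γ g ∈ S ∧ g⁻¹ • x ∈ V} ∂vol := by
        refine lintegral_mono fun x => ?_
        have hVx : MeasurableSet {g : G | g⁻¹ • x ∈ V} :=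
          (hV.preimage (continuous_inv.smul continuous_const)).measurableSet
        -- The translates `γA` are disjoint, since the projection is injective on `B` and `Γ` acts
        -- freely on `G`; all of them lie over `S`.
        rw [← measure_iUnion]
        · refine measure_mono (Set.iUnion_subset fun γ => ?_)
          rintro g ⟨hgA, hgV⟩
          refine ⟨?_, hgV⟩
          have h1 : LeftQuot.mk Γ (γ⁻¹ • g) ∈ S := hgA.1
          rwa [LeftQuot.mk_smul] at h1
        · intro γ γ' hne
          refine Set.disjoint_left.2 ?_
          rintro g ⟨hg, -⟩ ⟨hg', -⟩
          refine hne (Subtype.ext (inv_injective ?_))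
          have h1 : LeftQuot.mk Γ (γ⁻¹ • g) = LeftQuot.mk Γ (γ'⁻¹ • g) := by
            rw [LeftQuot.mk_smul, LeftQuot.mk_smul]
          exact mul_right_cancel (hBinj hg.2 hg'.2 h1)
        · exact fun γ => ((measurable_const_mul _) hA).inter hVx

end Unfolding

end Smearing

namespace Smearing

open Filter

variable {n : ℕ} {G : Subgroup (GL (Fin n) ℝ)}

/-! ### Topology of the homogeneous spaces -/

section Topology

open scoped Matrix.Norms.Operator

lemma isOpenEmbedding_coe_GL :
    IsOpenEmbedding (fun g : GL (Fin n) ℝ => (g : Matrix (Fin n) (Fin n) ℝ)) :=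
  Units.isOpenEmbedding_val (R := Matrix (Fin n) (Fin n) ℝ)

end Topology

instance : PolishSpace (Matrix (Fin n) (Fin n) ℝ) :=
  inferInstanceAs (PolishSpace (Fin n → Fin n → ℝ))

instance : PolishSpace (GL (Fin n) ℝ) := by
  have h := isOpenEmbedding_coe_GL (n := n)
  have : PolishSpace (Set.range fun g : GL (Fin n) ℝ => (g : Matrix (Fin n) (Fin n) ℝ)) :=
    h.isOpen_range.polishSpace
  exact h.isEmbedding.toHomeomorph.isClosedEmbedding.polishSpace

instance : LocallyCompactSpace (GL (Fin n) ℝ) := by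
  have : LocallyCompactSpace (Matrix (Fin n) (Fin n) ℝ) :=
    inferInstanceAs (LocallyCompactSpace (Fin n → Fin n → ℝ))
  exact isOpenEmbedding_coe_GL.locallyCompactSpace

instance : SecondCountableTopology (Matrix (Fin n) (Fin n) ℝ) :=
  inferInstanceAs (SecondCountableTopology (Fin n → Fin n → ℝ))

instance : SecondCountableTopology (GL (Fin n) ℝ) :=
  isOpenEmbedding_coe_GL.isEmbedding.secondCountableTopology

instance : SecondCountableTopology G := TopologicalSpace.Subtype.secondCountableTopology _

lemma polishSpace_of_isClosed (hG : IsClosed (G : Set (GL (Fin n) ℝ))) : PolishSpace G :=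
  hG.isClosedEmbedding_subtypeVal.polishSpace

lemma locallyCompactSpace_of_isClosed (hG : IsClosed (G : Set (GL (Fin n) ℝ))) :
    LocallyCompactSpace G :=
  hG.isClosedEmbedding_subtypeVal.locallyCompactSpace

namespace CartanData

variable (D : CartanData G)

instance : SecondCountableTopology D.X := inferInstanceAs (SecondCountableTopology (G ⧸ D.K))
instance : SecondCountableTopology D.F := inferInstanceAs (SecondCountableTopology (G ⧸ D.P))
instance : SecondCountableTopology D.GM := inferInstanceAs (SecondCountableTopology (G ⧸ D.M))
instance : ContinuousSMul G D.X := inferInstanceAs (ContinuousSMul G (G ⧸ D.K))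

instance : T2Space D.X := by
  have : IsClosed (D.K : Set G) := D.isCompact_K.isClosed
  exact inferInstanceAs (T2Space (G ⧸ D.K))

instance : T2Space D.GM := by
  have : IsClosed (D.M : Set G) :=
    (isCompact_iff_compactSpace.mpr (inferInstanceAs (CompactSpace D.M))).isClosed
  exact inferInstanceAs (T2Space (G ⧸ D.M))

instance [LocallyCompactSpace G] : LocallyCompactSpace D.X :=
  inferInstanceAs (LocallyCompactSpace (G ⧸ D.K))

instance : LocallyCompactSpace D.𝔞 := by
  have h : IsClosedEmbedding fun v : D.𝔞 => ((v : lieAlg G) : Matrix (Fin n) (Fin n) ℝ) := by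
    have : IsClosedEmbedding ((lieAlg G).toSubmodule.subtype ∘ₗ D.𝔞.subtype) :=
      LinearMap.isClosedEmbedding_of_injective (LinearMap.ker_eq_bot.2
        (Subtype.val_injective.comp Subtype.val_injective))
    exact this
  have : LocallyCompactSpace (Matrix (Fin n) (Fin n) ℝ) :=
    inferInstanceAs (LocallyCompactSpace (Fin n → Fin n → ℝ))
  exact h.locallyCompactSpace

instance : SecondCountableTopology (lieAlg G) :=
  TopologicalSpace.Subtype.secondCountableTopology _

instance : SecondCountableTopology D.𝔞 := TopologicalSpace.Subtype.secondCountableTopology _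

lemma exists_isCompact_toX_image [LocallyCompactSpace G] {L : Set D.X} (hL : IsCompact L) :
    ∃ C : Set G, IsCompact C ∧ L ⊆ D.toX '' C := by
  choose C hC hC1 using fun g : G => exists_compact_mem_nhds g
  obtain ⟨t, ht⟩ := hL.elim_finite_subcover (fun g : G => D.toX '' interior (C g))
    (fun g => D.isOpenQuotientMap_toX.isOpenMap _ isOpen_interior) (fun x _ => by
      obtain ⟨g, rfl⟩ := D.isOpenQuotientMap_toX.surjective x
      exact Set.mem_iUnion.2 ⟨g, g, mem_interior_iff_mem_nhds.2 (hC1 g), rfl⟩)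
  refine ⟨⋃ g ∈ t, C g, t.isCompact_biUnion fun g _ => hC g, ht.trans ?_⟩
  rw [Set.image_iUnion₂]
  exact Set.iUnion₂_mono fun g _ => Set.image_mono interior_subset

/-- If `γL` meets `L'`, then `γ` lies in the compact set `C' K C⁻¹`, which contains only finitely
many elements of a discrete subgroup. -/
lemma properlyDiscontinuousSMul [LocallyCompactSpace G] (Γ : Subgroup G)
    (hΓ : DiscreteTopology Γ) : ProperlyDiscontinuousSMul Γ D.X := by
  refine ⟨fun {L L'} hL hL' => ?_⟩
  obtain ⟨C, hC, hLC⟩ := D.exists_isCompact_toX_image hL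
  obtain ⟨C', hC', hLC'⟩ := D.exists_isCompact_toX_image hL'
  have hcpt : IsCompact ((fun p : G × G × G => p.1 * p.2.1 * p.2.2⁻¹) ''
      (C' ×ˢ (D.K : Set G) ×ˢ C)) :=
    (hC'.prod (D.isCompact_K.prod hC)).image (by fun_prop)
  have hfin := Subgroup.tendsto_coe_cofinite_of_discrete Γ
    (isDiscrete_iff_discreteTopology.mpr hΓ) hcpt.compl_mem_cocompact
  rw [mem_map, mem_cofinite, ← Set.preimage_compl, compl_compl] at hfin
  refine hfin.subset ?_
  rintro γ ⟨_, ⟨x, hx, rfl⟩, hx'⟩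
  obtain ⟨c, hc, rfl⟩ := hLC hx
  obtain ⟨c', hc', hcc'⟩ := hLC' hx'
  have h1 : D.toX c' = D.toX (γ * c) := hcc'
  have h2 : c'⁻¹ * (γ * c) ∈ D.K := QuotientGroup.eq.1 h1
  exact ⟨(c', c'⁻¹ * (γ * c), c), ⟨hc', h2, hc⟩, by simp only; group⟩

/-- A torsion-free discrete group acts freely on `X`. -/
lemma eq_one_of_smul_eq [LocallyCompactSpace G] {Γ : Subgroup G} (hΓ : DiscreteTopology Γ)
    (hΓ' : ∀ γ : Γ, IsOfFinOrder γ → γ = 1) {γ : Γ} {x : D.X} (h : γ • x = x) : γ = 1 := by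
  have := D.properlyDiscontinuousSMul Γ hΓ
  have hfin : Finite (MulAction.stabilizer Γ x) :=
    ProperlyDiscontinuousSMul.finite_stabilizer' Γ x
  have h1 := isOfFinOrder_of_finite (⟨γ, h⟩ : MulAction.stabilizer Γ x)
  exact hΓ' γ ((MulAction.stabilizer Γ x).subtype.isOfFinOrder h1)

lemma exists_nhds_smul_mem_imp_eq [LocallyCompactSpace G] {Γ : Subgroup G}
    (hΓ : DiscreteTopology Γ) (hΓ' : ∀ γ : Γ, IsOfFinOrder γ → γ = 1) (x : D.X) :
    ∃ V ∈ 𝓝 x, ∀ γ : Γ, ∀ v ∈ V, γ • v ∈ V → γ • v = v := by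
  have := D.properlyDiscontinuousSMul Γ hΓ
  obtain ⟨V, hV, h⟩ := ProperlyDiscontinuousSMul.exists_nhds_image_smul_eq_self Γ x
  refine ⟨V, hV, fun γ v hv hγ => ?_⟩
  rw [D.eq_one_of_smul_eq hΓ hΓ' (h γ ⟨_, ⟨v, hv, rfl⟩, hγ⟩), one_smul]

/-- By transitivity and second countability, countably many translates of `V` cover `X`. -/
lemma measure_ne_zero_of_isOpen {vol : Measure D.X} (hvol : vol ≠ 0)
    (hinv : ∀ g : G, vol.map (fun x => g • x) = vol) {V : Set D.X} (hV : IsOpen V)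
    (hne : V.Nonempty) : vol V ≠ 0 := by
  intro h0
  obtain ⟨_, hxV⟩ := hne
  obtain ⟨a, rfl⟩ := D.isOpenQuotientMap_toX.surjective ‹D.X›
  have hopen : ∀ g : G, IsOpen ((fun x : D.X => g • x) ⁻¹' V) :=
    fun g => hV.preimage (continuous_const_smul g)
  have hzero : ∀ g : G, vol ((fun x : D.X => g • x) ⁻¹' V) = 0 := fun g => by
    rw [← Measure.map_apply (continuous_const_smul g).measurable hV.measurableSet, hinv, h0]
  have hcov : ∀ x : D.X, ∃ g : G, (fun x : D.X => g • x) ⁻¹' V ∈ 𝓝 x := fun x => by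
    obtain ⟨b, rfl⟩ := D.isOpenQuotientMap_toX.surjective x
    refine ⟨a * b⁻¹, (hopen _).mem_nhds ?_⟩
    simpa [smul_toX] using hxV
  choose g hg using hcov
  obtain ⟨s, hs, hsu⟩ := TopologicalSpace.countable_cover_nhds hg
  refine hvol (Measure.measure_univ_eq_zero.1 ?_)
  rw [← hsu]
  exact (measure_biUnion_null_iff hs).2 fun x _ => hzero (g x)

end CartanData

instance {Γ Y : Type*} [Group Γ] [MulAction Γ Y] [TopologicalSpace Y] [ContinuousConstSMul Γ Y]
    [SecondCountableTopology Y] : SecondCountableTopology (LeftQuot Γ Y) :=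
  ContinuousConstSMul.secondCountableTopology (Γ := Γ) (T := Y)

end Smearing

namespace Smearing

open Filter

variable {n : ℕ} {G : Subgroup (GL (Fin n) ℝ)} {D : CartanData G} {Γ : Subgroup G}
  {ψ ψ₁ ψ₂ : Module.Dual ℝ D.𝔞}

/-! ### Conformal densities -/

/-- The density of `ν_x` with respect to `ν_o`. -/
def conformalFactor (ψ : Module.Dual ℝ D.𝔞) (x : D.X) (ξ : D.F) : ℝ≥0∞ :=
  ENNReal.ofReal (Real.exp (ψ (D.busemann ξ D.o x)))

lemma continuous_conformalFactor [ConnectedSpace G] (hG : IsClosed (G : Set (GL (Fin n) ℝ)))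
    (ψ : Module.Dual ℝ D.𝔞) :
    Continuous fun p : D.F × D.X => conformalFactor ψ p.2 p.1 :=
  ENNReal.continuous_ofReal.comp (Real.continuous_exp.comp
    ((D.continuous_dual ψ).comp (D.continuous_busemann hG D.o)))

lemma measurable_conformalFactor [ConnectedSpace G] (hG : IsClosed (G : Set (GL (Fin n) ℝ)))
    (ψ : Module.Dual ℝ D.𝔞) (x : D.X) : Measurable (conformalFactor ψ x) :=
  ((continuous_conformalFactor hG ψ).comp (Continuous.prodMk_left x)).measurable

namespace ConformalDensity

lemma meas_eq (ν : ConformalDensity D Γ ψ) (x : D.X) :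
    ν.meas x = (ν.meas D.o).withDensity (conformalFactor ψ x) := by
  rw [ν.density x D.o]
  congr 1
  ext ξ
  rw [conformalFactor, ← map_neg, D.neg_busemann]

lemma E_mk (ν : ConformalDensity D Γ ψ) (x : D.X) :
    ν.E (LeftQuot.mk Γ x) = ∫⁻ ξ, conformalFactor ψ x ξ ∂ν.meas D.o := by
  change ν.meas x Set.univ = _
  rw [ν.meas_eq x, withDensity_apply _ MeasurableSet.univ, Measure.restrict_univ]

lemma lintegral_smul [ConnectedSpace G] (hG : IsClosed (G : Set (GL (Fin n) ℝ)))
    (ν : ConformalDensity D Γ ψ) (γ : Γ) {f : D.F → ℝ≥0∞} (hf : Measurable f) :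
    ∫⁻ ξ, f ((γ : G) • ξ) ∂ν.meas D.o =
      ∫⁻ ξ, conformalFactor ψ ((γ : G) • D.o) ξ * f ξ ∂ν.meas D.o := by
  have hm : Measurable fun ξ : D.F => (γ : G) • ξ := (continuous_const_smul (γ : G)).measurable
  rw [← lintegral_map hf hm, ν.equivariant γ D.o, ν.meas_eq ((γ : G) • D.o),
    lintegral_withDensity_eq_lintegral_mul _ (measurable_conformalFactor hG ψ _) hf]
  rfl

/-- `E_ν` is a Borel function. -/
lemma measurable_E [ConnectedSpace G] (hG : IsClosed (G : Set (GL (Fin n) ℝ)))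
    (hΓ : DiscreteTopology Γ) (ν : ConformalDensity D Γ ψ) : Measurable ν.E := by
  have := polishSpace_of_isClosed hG
  have := locallyCompactSpace_of_isClosed hG
  have := D.properlyDiscontinuousSMul Γ hΓ
  have : T2Space (LeftQuot Γ D.X) :=
    inferInstanceAs (T2Space (Quotient (MulAction.orbitRel Γ D.X)))
  have := ν.finite D.o
  have hc : Continuous fun g : G => LeftQuot.mk Γ (D.toX g) :=
    (LeftQuot.continuous_mk Γ).comp D.isOpenQuotientMap_toX.continuous
  have hs : Function.Surjective fun g : G => LeftQuot.mk Γ (D.toX g) :=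
    (Quotient.mk_surjective (s := MulAction.orbitRel Γ D.X)).comp
      D.isOpenQuotientMap_toX.surjective
  -- Measurability may be tested after the Borel surjection from the Polish space `G`, where `E_ν`
  -- becomes an integral with a continuous kernel.
  rw [← hc.measurable.measurable_comp_iff_of_surjective hs]
  have h1 : ν.E ∘ (fun g : G => LeftQuot.mk Γ (D.toX g)) =
      fun g => ∫⁻ ξ, conformalFactor ψ (D.toX g) ξ ∂ν.meas D.o := funext fun g => ν.E_mk _
  rw [h1]
  refine Measurable.lintegral_prod_right' (f := fun p : G × D.F =>
    conformalFactor ψ (D.toX p.1) p.2) ?_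
  exact ((continuous_conformalFactor hG ψ).comp (continuous_snd.prodMk
    (D.isOpenQuotientMap_toX.continuous.comp continuous_fst))).measurable

end ConformalDensity

/-! ### Invariance of the Bowen-Margulis-Sullivan measure -/

section Invariance

/-- The measure `ν_o ⊗ ν̄_o ⊗ dv` in Hopf coordinates. -/
def hopfMeasure (ℓ : Measure D.𝔞) (ν : ConformalDensity D Γ ψ₁) (ν' : ConformalDensity D Γ ψ₂) :
    Measure (D.F × D.F × D.𝔞) :=
  (ν.meas D.o).prod ((ν'.meas D.o).prod ℓ)

lemma lintegral_hopfMeasure (ℓ : Measure D.𝔞) [SFinite ℓ] (ν : ConformalDensity D Γ ψ₁)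
    (ν' : ConformalDensity D Γ ψ₂) {f : D.F × D.F × D.𝔞 → ℝ≥0∞} (hf : Measurable f) :
    ∫⁻ p, f p ∂hopfMeasure ℓ ν ν' =
      ∫⁻ ξ, ∫⁻ η, ∫⁻ v, f (ξ, η, v) ∂ℓ ∂ν'.meas D.o ∂ν.meas D.o := by
  have := ν.finite D.o
  have := ν'.finite D.o
  rw [hopfMeasure, lintegral_prod _ hf.aemeasurable]
  refine lintegral_congr fun ξ => ?_
  exact lintegral_prod (fun y => f (ξ, y)) (hf.comp measurable_prodMk_left).aemeasurable

lemma continuous_hopfAction [ConnectedSpace G] (hG : IsClosed (G : Set (GL (Fin n) ℝ)))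
    (γ : G) : Continuous (D.hopfAction γ) := by
  have h1 : Continuous fun p : D.F × D.F × D.𝔞 => γ • p.2.1 :=
    (continuous_fst.comp continuous_snd).const_smul γ
  have h2 : Continuous fun p : D.F × D.F × D.𝔞 => D.busemann (γ • p.2.1) D.o (γ • D.o) :=
    Continuous.comp (g := fun p : D.F × D.X => D.busemann p.1 D.o p.2)
      (f := fun p : D.F × D.F × D.𝔞 => (γ • p.2.1, γ • D.o)) (D.continuous_busemann hG D.o)
      (h1.prodMk continuous_const)
  exact (continuous_fst.const_smul γ).prodMk
    (h1.prodMk (h2.add (continuous_snd.comp continuous_snd)))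

lemma hopfAction_hopfAction [ConnectedSpace G] (hG : IsClosed (G : Set (GL (Fin n) ℝ)))
    (g h : G) (p : D.F × D.F × D.𝔞) :
    D.hopfAction g (D.hopfAction h p) = D.hopfAction (g * h) p := by
  simp only [CartanData.hopfAction, smul_smul, ← add_assoc]
  rw [← D.busemann_smul hG g (h • p.2.1) D.o, smul_smul, smul_smul, D.busemann_add]

lemma hopfAction_one (p : D.F × D.F × D.𝔞) : D.hopfAction 1 p = p := by
  simp [CartanData.hopfAction, CartanData.busemann]

/-- The action of `γ` in Hopf coordinates as a measurable equivalence. -/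
def hopfEquiv [ConnectedSpace G] (hG : IsClosed (G : Set (GL (Fin n) ℝ)))
    (γ : G) : (D.F × D.F × D.𝔞) ≃ᵐ (D.F × D.F × D.𝔞) where
  toFun := D.hopfAction γ
  invFun := D.hopfAction γ⁻¹
  left_inv p := by rw [hopfAction_hopfAction hG, inv_mul_cancel, hopfAction_one]
  right_inv p := by rw [hopfAction_hopfAction hG, mul_inv_cancel, hopfAction_one]
  measurable_toFun := (continuous_hopfAction hG γ).measurable
  measurable_invFun := (continuous_hopfAction hG γ⁻¹).measurable

/-- The Jacobian of the action in Hopf coordinates. -/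
def hopfJacobian (ψ₁ ψ₂ : Module.Dual ℝ D.𝔞) (x : D.X) (p : D.F × D.F × D.𝔞) : ℝ≥0∞ :=
  conformalFactor ψ₁ x p.1 * conformalFactor ψ₂ x p.2.1

lemma measurable_hopfJacobian [ConnectedSpace G] (hG : IsClosed (G : Set (GL (Fin n) ℝ)))
    (ψ₁ ψ₂ : Module.Dual ℝ D.𝔞) (x : D.X) :
    Measurable (hopfJacobian ψ₁ ψ₂ x) :=
  ((measurable_conformalFactor hG ψ₁ x).comp measurable_fst).mul
    ((measurable_conformalFactor hG ψ₂ x).comp (measurable_fst.comp measurable_snd))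

/-- For fixed boundary points `γ` translates `𝔞`, which preserves `ℓ`; on each boundary factor `γ_*
ν_o = ν_{γo}` contributes its conformal factor. -/
lemma map_hopfEquiv [ConnectedSpace G] (hG : IsClosed (G : Set (GL (Fin n) ℝ)))
    (ℓ : Measure D.𝔞) [SFinite ℓ] [ℓ.IsAddLeftInvariant]
    (ν : ConformalDensity D Γ ψ₁) (ν' : ConformalDensity D Γ ψ₂) (γ : Γ) :
    (hopfMeasure ℓ ν ν').map (hopfEquiv hG (γ : G)) =
      (hopfMeasure ℓ ν ν').withDensity (hopfJacobian ψ₁ ψ₂ ((γ : G) • D.o)) := by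
  have := ν.finite D.o
  have := ν'.finite D.o
  refine Measure.ext_of_lintegral _ fun f hf => ?_
  have hJ := measurable_hopfJacobian hG ψ₁ ψ₂ ((γ : G) • D.o)
  rw [lintegral_map_equiv, lintegral_withDensity_eq_lintegral_mul _ hJ hf,
    lintegral_hopfMeasure (f := fun p => f (hopfEquiv hG (γ : G) p)) _ _ _
      (hf.comp (hopfEquiv hG (γ : G)).measurable),
    lintegral_hopfMeasure _ _ _ (hJ.mul hf)]
  have hF : Measurable fun q : D.F × D.F => ∫⁻ v, f (q.1, q.2, v) ∂ℓ :=
    Measurable.lintegral_prod_right' (f := fun r : (D.F × D.F) × D.𝔞 => f (r.1.1, r.1.2, r.2))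
      (hf.comp (by fun_prop))
  have hc2 := measurable_conformalFactor hG ψ₂ ((γ : G) • D.o)
  have hF2 : Measurable fun ξ : D.F => ∫⁻ η,
      conformalFactor ψ₂ ((γ : G) • D.o) η * ∫⁻ v, f (ξ, η, v) ∂ℓ ∂ν'.meas D.o :=
    Measurable.lintegral_prod_right' (f := fun r : D.F × D.F =>
      conformalFactor ψ₂ ((γ : G) • D.o) r.2 * ∫⁻ v, f (r.1, r.2, v) ∂ℓ)
      ((hc2.comp measurable_snd).mul hF)
  have hL : ∀ ξ η, ∫⁻ v, f (hopfEquiv hG (γ : G) (ξ, η, v)) ∂ℓ =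
      ∫⁻ v, f ((γ : G) • ξ, (γ : G) • η, v) ∂ℓ := fun ξ η =>
    lintegral_add_left_eq_self (fun v => f ((γ : G) • ξ, (γ : G) • η, v))
      (D.busemann ((γ : G) • η) D.o ((γ : G) • D.o))
  simp_rw [hL]
  have h1 : ∀ ξ : D.F, ∫⁻ η, ∫⁻ v, f (ξ, (γ : G) • η, v) ∂ℓ ∂ν'.meas D.o =
      ∫⁻ η, conformalFactor ψ₂ ((γ : G) • D.o) η * ∫⁻ v, f (ξ, η, v) ∂ℓ ∂ν'.meas D.o :=
    fun ξ => ν'.lintegral_smul hG γ (hF.comp measurable_prodMk_left)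
  simp_rw [h1]
  rw [ν.lintegral_smul hG γ hF2]
  refine lintegral_congr fun ξ => ?_
  refine (lintegral_const_mul _ (hc2.mul (hF.comp measurable_prodMk_left))).symm.trans ?_
  refine lintegral_congr fun η => ?_
  refine (mul_assoc _ _ _).symm.trans ?_
  exact (lintegral_const_mul _ (hf.comp (by fun_prop))).symm

lemma bmsGM_eq (ℓ : Measure D.𝔞) (ν : ConformalDensity D Γ ψ₁) (ν' : ConformalDensity D Γ ψ₂) :
    bmsGM ℓ ν ν' = ((hopfMeasure ℓ ν ν').comap (hopf D)).withDensity
      fun q => ENNReal.ofReal (Real.exp (D.bmsDensity ψ₁ ψ₂ q)) := rfl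

/-- The measure on `G/M` is `Γ`-invariant. -/
lemma map_smulGM_bmsGM [ConnectedSpace G] (hG : IsClosed (G : Set (GL (Fin n) ℝ)))
    (ℓ : Measure D.𝔞) [SFinite ℓ] [ℓ.IsAddLeftInvariant]
    (ν : ConformalDensity D Γ ψ₁) (ν' : ConformalDensity D Γ ψ₂) (γ : Γ) :
    (bmsGM ℓ ν ν').map (D.smulGM (γ : G)) = bmsGM ℓ ν ν' := by
  set e := (D.smulGM (γ : G)).toMeasurableEquiv with he
  set τ := (hopfMeasure ℓ ν ν').comap (hopf D) with hτ
  have hρ : Measurable fun q => ENNReal.ofReal (Real.exp (D.bmsDensity ψ₁ ψ₂ q)) :=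
    (ENNReal.continuous_ofReal.comp
      (Real.continuous_exp.comp (D.continuous_bmsDensity hG ψ₁ ψ₂))).measurable
  have hh : Measurable (hopf D) := (D.continuous_hopf hG).measurable
  have hJ := measurable_hopfJacobian hG ψ₁ ψ₂ ((γ : G) • D.o)
  have hJ0 : ∀ p, hopfJacobian ψ₁ ψ₂ ((γ : G) • D.o) p ≠ 0 := fun p =>
    mul_ne_zero (ENNReal.ofReal_pos.2 (Real.exp_pos _)).ne'
      (ENNReal.ofReal_pos.2 (Real.exp_pos _)).ne'
  have hτe : τ.map e = τ.withDensity (hopfJacobian ψ₁ ψ₂ ((γ : G) • D.o) ∘ hopf D) := by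
    rw [hτ, map_comap_equiv e (hopfEquiv hG (γ : G)) (fun q => D.hopf_smulGM hG γ q),
      map_hopfEquiv, comap_withDensity hh hJ hJ0]
  -- The Jacobian exactly compensates the change of the density under `γ`.
  have hfac : ∀ q, ENNReal.ofReal (Real.exp (D.bmsDensity ψ₁ ψ₂ q)) =
      hopfJacobian ψ₁ ψ₂ ((γ : G) • D.o) (hopf D q) *
        ENNReal.ofReal (Real.exp (D.bmsDensity ψ₁ ψ₂ (e.symm q))) := fun q => by
    have h1 := D.bmsDensity_smulGM hG ψ₁ ψ₂ γ (e.symm q)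
    have h2 : D.smulGM (γ : G) (e.symm q) = q := e.apply_symm_apply q
    rw [h2] at h1
    rw [h1, hopfJacobian, conformalFactor, conformalFactor, ← ENNReal.ofReal_mul (Real.exp_nonneg _),
      ← ENNReal.ofReal_mul (by positivity), ← Real.exp_add, ← Real.exp_add]
    congr 2
    ring
  ext s hs
  have hs' : MeasurableSet (e ⁻¹' s) := e.measurable hs
  change (bmsGM ℓ ν ν').map e s = _
  rw [e.map_apply, bmsGM_eq, withDensity_apply _ hs', withDensity_apply _ hs]
  have hpre : ∫⁻ q in e ⁻¹' s, ENNReal.ofReal (Real.exp (D.bmsDensity ψ₁ ψ₂ q)) ∂τ =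
      ∫⁻ q in s, ENNReal.ofReal (Real.exp (D.bmsDensity ψ₁ ψ₂ (e.symm q))) ∂τ.map e := by
    rw [e.restrict_map, lintegral_map_equiv]
    simp
  rw [hpre, hτe, restrict_withDensity hs]
  refine (lintegral_withDensity_eq_lintegral_mul _ (hJ.comp hh)
    (hρ.comp e.symm.measurable)).trans ?_
  exact lintegral_congr fun q => (hfac q).symm

/-- The Haar probability measure on the fibre `gM`. -/
def fibreMeasure (D : CartanData G) (q : D.GM) : Measure G :=
  (Measure.haarMeasure (⊤ : TopologicalSpace.PositiveCompacts D.M)).map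
    fun m : D.M => D.repGM q * (m : G)

/-- Left invariance of Haar measure on `M` makes the choice of representative irrelevant. -/
lemma fibreMeasure_toGM (g : G) : fibreMeasure D (D.toGM g) =
    (Measure.haarMeasure (⊤ : TopologicalSpace.PositiveCompacts D.M)).map
      fun m : D.M => g * (m : G) := by
  obtain ⟨m₀, hm₀⟩ := D.exists_repGM_eq g
  have hm1 : Measurable fun m : D.M => g * (m : G) := by fun_prop
  rw [fibreMeasure, hm₀]
  conv_rhs => rw [← map_mul_left_eq_self
    (Measure.haarMeasure (⊤ : TopologicalSpace.PositiveCompacts D.M)) m₀]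
  rw [Measure.map_map hm1 (measurable_const_mul m₀)]
  congr 1
  ext1 m
  simp [mul_assoc]

lemma isProbabilityMeasure_fibreMeasure (q : D.GM) : IsProbabilityMeasure (fibreMeasure D q) := by
  have : IsProbabilityMeasure
      (Measure.haarMeasure (⊤ : TopologicalSpace.PositiveCompacts D.M)) :=
    ⟨by simpa using Measure.haarMeasure_self (K₀ := (⊤ : TopologicalSpace.PositiveCompacts D.M))⟩
  have hm : Measurable fun m : D.M => D.repGM q * (m : G) := by fun_prop
  exact Measure.isProbabilityMeasure_map hm.aemeasurable

lemma measurable_fibreMeasure (hG : IsClosed (G : Set (GL (Fin n) ℝ)))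
    : Measurable (fibreMeasure D) := by
  have := polishSpace_of_isClosed hG
  rw [← D.isOpenQuotientMap_toGM.continuous.measurable.measurable_comp_iff_of_surjective
    D.isOpenQuotientMap_toGM.surjective]
  have h1 : fibreMeasure D ∘ D.toGM = fun g =>
    (Measure.haarMeasure (⊤ : TopologicalSpace.PositiveCompacts D.M)).map
      fun m : D.M => g * (m : G) := funext fibreMeasure_toGM
  rw [h1]
  refine Measure.measurable_of_measurable_coe _ fun s hs => ?_
  have h2 : ∀ g : G, (Measure.haarMeasure (⊤ : TopologicalSpace.PositiveCompacts D.M)).map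
      (fun m : D.M => g * (m : G)) s =
      Measure.haarMeasure (⊤ : TopologicalSpace.PositiveCompacts D.M)
        (Prod.mk g ⁻¹' ((fun p : G × D.M => p.1 * (p.2 : G)) ⁻¹' s)) := fun g => by
    rw [Measure.map_apply (by fun_prop) hs]
    rfl
  simp_rw [h2]
  exact measurable_measure_prodMk_left ((by fun_prop : Measurable _) hs)

lemma bmsG_eq (ℓ : Measure D.𝔞) (ν : ConformalDensity D Γ ψ₁) (ν' : ConformalDensity D Γ ψ₂) :
    bmsG ℓ ν ν' = (bmsGM ℓ ν ν').bind (fibreMeasure D) := rfl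

lemma bmsG_apply (hG : IsClosed (G : Set (GL (Fin n) ℝ)))
    (ℓ : Measure D.𝔞) (ν : ConformalDensity D Γ ψ₁) (ν' : ConformalDensity D Γ ψ₂)
    {s : Set G} (hs : MeasurableSet s) :
    bmsG ℓ ν ν' s = ∫⁻ q, fibreMeasure D q s ∂bmsGM ℓ ν ν' := by
  rw [bmsG_eq, Measure.bind_apply hs (measurable_fibreMeasure hG).aemeasurable]

lemma sFinite_bmsG (hG : IsClosed (G : Set (GL (Fin n) ℝ)))
    (ℓ : Measure D.𝔞) [SFinite ℓ] (ν : ConformalDensity D Γ ψ₁)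
    (ν' : ConformalDensity D Γ ψ₂) : SFinite (bmsG ℓ ν ν') := by
  have := ν.finite D.o
  have := ν'.finite D.o
  have : SFinite (hopfMeasure ℓ ν ν') := by
    rw [hopfMeasure]
    infer_instance
  have := sFinite_comap (hopf D) (hopfMeasure ℓ ν ν')
  have : SFinite (bmsGM ℓ ν ν') := by
    rw [bmsGM_eq]
    infer_instance
  let κ : ProbabilityTheory.Kernel D.GM G := ⟨fibreMeasure D, measurable_fibreMeasure hG⟩
  have : ProbabilityTheory.IsMarkovKernel κ := ⟨isProbabilityMeasure_fibreMeasure⟩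
  exact inferInstanceAs (SFinite ((bmsGM ℓ ν ν').bind κ))

/-- The Bowen-Margulis-Sullivan measure on `G` is left `Γ`-invariant. -/
lemma map_mul_left_bmsG [ConnectedSpace G] (hG : IsClosed (G : Set (GL (Fin n) ℝ)))
    (ℓ : Measure D.𝔞) [SFinite ℓ] [ℓ.IsAddLeftInvariant]
    (ν : ConformalDensity D Γ ψ₁) (ν' : ConformalDensity D Γ ψ₂) (γ : Γ) :
    (bmsG ℓ ν ν').map (fun g => (γ : G) * g) = bmsG ℓ ν ν' := by
  ext s hs
  have hm : Measurable fun g : G => (γ : G) * g := measurable_const_mul _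
  have hfib : ∀ q, fibreMeasure D q ((fun g => (γ : G) * g) ⁻¹' s) =
      fibreMeasure D (D.smulGM (γ : G) q) s := fun q => by
    obtain ⟨g, rfl⟩ := D.isOpenQuotientMap_toGM.surjective q
    rw [D.smulGM_toGM, fibreMeasure_toGM, fibreMeasure_toGM,
      Measure.map_apply (by fun_prop) (hm hs), Measure.map_apply (by fun_prop) hs]
    simp only [← Set.preimage_comp, Function.comp_def, mul_assoc]
  rw [Measure.map_apply hm hs, bmsG_apply hG _ _ _ (hm hs), bmsG_apply hG _ _ _ hs]
  simp_rw [hfib]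
  conv_rhs => rw [← map_smulGM_bmsGM hG ℓ ν ν' γ]
  exact (lintegral_map_equiv (fun q => fibreMeasure D q s)
    (D.smulGM (γ : G)).toMeasurableEquiv).symm

end Invariance

end Smearing

namespace Smearing

open Filter

variable {n : ℕ} {G : Subgroup (GL (Fin n) ℝ)} {D : CartanData G} {Γ : Subgroup G}
  {ψ₁ ψ₂ : Module.Dual ℝ D.𝔞}

/-! ### The smearing estimate -/

lemma fibreMeasure_eq_zero {s : Set G} (hs : MeasurableSet s) {q : D.GM} (hq : q ∉ D.toGM '' s) :
    fibreMeasure D q s = 0 := by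
  rw [fibreMeasure, Measure.map_apply (by fun_prop) hs]
  refine measure_mono_null (fun m hm => (hq ⟨_, hm, ?_⟩).elim) measure_empty
  rw [D.toGM_mul_M _ m.2, D.toGM_repGM]

/-- An upper bound, in Hopf coordinates, for the part of the Bowen-Margulis-Sullivan measure
carried by the flats passing near `x`. -/
def nearDensity (ψ₁ ψ₂ : Module.Dual ℝ D.𝔞) (L : Set D.𝔞) (x : D.X) (p : D.F × D.F × D.𝔞) :
    ℝ≥0∞ :=
  hopfJacobian ψ₁ ψ₂ x p * L.indicator 1 (-D.busemann p.2.1 D.o x + p.2.2)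

lemma measurable_nearDensity [ConnectedSpace G] (hG : IsClosed (G : Set (GL (Fin n) ℝ)))
    {L : Set D.𝔞} (hL : IsCompact L) (x : D.X) : Measurable (nearDensity ψ₁ ψ₂ L x) := by
  refine (measurable_hopfJacobian hG ψ₁ ψ₂ x).mul
    ((measurable_one.indicator hL.measurableSet).comp ?_)
  have h1 : Continuous fun p : D.F × D.F × D.𝔞 => D.busemann p.2.1 D.o x :=
    Continuous.comp (g := fun p : D.F × D.X => D.busemann p.1 D.o p.2)
      (f := fun p : D.F × D.F × D.𝔞 => (p.2.1, x)) (D.continuous_busemann hG D.o)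
      ((continuous_fst.comp continuous_snd).prodMk continuous_const)
  exact (h1.neg.add (continuous_snd.comp continuous_snd)).measurable

/-- The `v`-integral is `ℓ L` by translation invariance; the boundary integrals of the conformal
factors are `|ν_x|` and `|ν̄_x|`. -/
lemma lintegral_nearDensity [ConnectedSpace G] (hG : IsClosed (G : Set (GL (Fin n) ℝ)))
    (ℓ : Measure D.𝔞) [SFinite ℓ] [ℓ.IsAddLeftInvariant] (ν : ConformalDensity D Γ ψ₁)
    (ν' : ConformalDensity D Γ ψ₂) {L : Set D.𝔞} (hL : IsCompact L) (x : D.X) :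
    ∫⁻ p, nearDensity ψ₁ ψ₂ L x p ∂hopfMeasure ℓ ν ν' =
      ν.E (LeftQuot.mk Γ x) * ν'.E (LeftQuot.mk Γ x) * ℓ L := by
  rw [lintegral_hopfMeasure _ _ _ (measurable_nearDensity hG hL x)]
  have h1 : ∀ ξ η, ∫⁻ v, nearDensity ψ₁ ψ₂ L x (ξ, η, v) ∂ℓ =
      conformalFactor ψ₁ x ξ * (conformalFactor ψ₂ x η * ℓ L) := fun ξ η => by
    simp only [nearDensity, hopfJacobian]
    refine (lintegral_const_mul _ ((measurable_one.indicator hL.measurableSet).comp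
      (measurable_const_add _))).trans ?_
    simp only [Function.comp_def]
    rw [lintegral_add_left_eq_self (fun v => L.indicator 1 v),
      lintegral_indicator_one hL.measurableSet, mul_assoc]
  have hc1 := measurable_conformalFactor hG ψ₁ x
  have hc2 := measurable_conformalFactor hG ψ₂ x
  simp_rw [h1, lintegral_const_mul _ (hc2.mul_const (ℓ L)), lintegral_mul_const _ hc2,
    lintegral_mul_const _ hc1, ← ν'.E_mk, ← ν.E_mk, mul_assoc]

/-- The fibre over `q` has no mass unless it contains some `g` with `x ∈ g B o`. Then `β(o, go) =
β(o, x) + β(x, go)` at `g⁺` and `g⁻`: the first summand gives the conformal factor at `x`, and the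
second lies in `L`, where `ψ₁` and `ψ₂` are at most `c₁` and `c₂`. -/
lemma density_mul_fibreMeasure_le {B : Set G} (hB : IsOpen B) {L : Set D.𝔞}
    (hBL : ∀ b ∈ B, ∀ (g : G) (ξ : D.F), D.busemann ξ (D.toX (g * b)) (D.toX g) ∈ L)
    {c₁ c₂ : ℝ} (h₁ : ∀ v ∈ L, ψ₁ v ≤ c₁) (h₂ : ∀ v ∈ L, ψ₂ v ≤ c₂) (x : D.X) (q : D.GM) :
    ENNReal.ofReal (Real.exp (D.bmsDensity ψ₁ ψ₂ q)) *
        fibreMeasure D q {g | g⁻¹ • x ∈ D.toX '' B} ≤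
      ENNReal.ofReal (Real.exp (c₁ + c₂)) * nearDensity ψ₁ ψ₂ L x (hopf D q) := by
  have hS : IsOpen {g : G | g⁻¹ • x ∈ D.toX '' B} :=
    (D.isOpenQuotientMap_toX.isOpenMap _ hB).preimage (continuous_inv.smul continuous_const)
  by_cases hq : q ∈ D.toGM '' {g : G | g⁻¹ • x ∈ D.toX '' B}
  swap
  · rw [fibreMeasure_eq_zero hS.measurableSet hq, mul_zero]
    exact zero_le
  obtain ⟨g, ⟨b, hb, hgb⟩, rfl⟩ := hq
  have hx : x = D.toX (g * b) := by rw [← D.smul_toX, hgb, smul_inv_smul]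
  have := isProbabilityMeasure_fibreMeasure (D.toGM g)
  refine (mul_le_of_le_one_right' prob_le_one).trans ?_
  have e1 := D.busemann_add (D.plus g) D.o x (D.toX g)
  have e2 := D.busemann_add (D.minus g) D.o x (D.toX g)
  have m1 : D.busemann (D.plus g) x (D.toX g) ∈ L := by
    rw [hx]
    exact hBL b hb g _
  have m2 : D.busemann (D.minus g) x (D.toX g) ∈ L := by
    rw [hx]
    exact hBL b hb g _
  rw [nearDensity, hopfJacobian, D.hopf_toGM, D.bmsDensity_toGM]
  simp only
  rw [← e2, neg_add_cancel_left, Set.indicator_of_mem m2, Pi.one_apply, mul_one, conformalFactor,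
    conformalFactor, ← ENNReal.ofReal_mul (Real.exp_nonneg _), ← Real.exp_add,
    ← ENNReal.ofReal_mul (Real.exp_nonneg _), ← Real.exp_add, ← e1, map_add, map_add]
  refine ENNReal.ofReal_le_ofReal (Real.exp_le_exp.2 ?_)
  linarith [h₁ _ m1, h₂ _ m2]

/-- The Bowen-Margulis-Sullivan measure of the set of `g ∈ G` for which `g o` is near `x` is
bounded by a multiple of `|ν_x| |ν̄_x|`. -/
lemma bmsG_inv_smul_mem_le [ConnectedSpace G] (hG : IsClosed (G : Set (GL (Fin n) ℝ)))
    (ℓ : Measure D.𝔞) [SFinite ℓ] [ℓ.IsAddLeftInvariant] (ν : ConformalDensity D Γ ψ₁)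
    (ν' : ConformalDensity D Γ ψ₂) {B : Set G} (hB : IsOpen B) {L : Set D.𝔞} (hL : IsCompact L)
    (hBL : ∀ b ∈ B, ∀ (g : G) (ξ : D.F), D.busemann ξ (D.toX (g * b)) (D.toX g) ∈ L)
    {c₁ c₂ : ℝ} (h₁ : ∀ v ∈ L, ψ₁ v ≤ c₁) (h₂ : ∀ v ∈ L, ψ₂ v ≤ c₂) (x : D.X) :
    bmsG ℓ ν ν' {g | g⁻¹ • x ∈ D.toX '' B} ≤ ENNReal.ofReal (Real.exp (c₁ + c₂)) * ℓ L *
      (ν.E (LeftQuot.mk Γ x) * ν'.E (LeftQuot.mk Γ x)) := by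
  have hS : IsOpen {g : G | g⁻¹ • x ∈ D.toX '' B} :=
    (D.isOpenQuotientMap_toX.isOpenMap _ hB).preimage (continuous_inv.smul continuous_const)
  have hρ : Measurable fun q => ENNReal.ofReal (Real.exp (D.bmsDensity ψ₁ ψ₂ q)) :=
    (ENNReal.continuous_ofReal.comp
      (Real.continuous_exp.comp (D.continuous_bmsDensity hG ψ₁ ψ₂))).measurable
  have hh : Measurable (hopf D) := (D.continuous_hopf hG).measurable
  have hJ := measurable_nearDensity (ψ₁ := ψ₁) (ψ₂ := ψ₂) hG hL x
  rw [bmsG_apply hG _ _ _ hS.measurableSet, bmsGM_eq]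
  refine (lintegral_withDensity_eq_lintegral_mul _ hρ ((Measure.measurable_coe
    hS.measurableSet).comp (measurable_fibreMeasure hG))).trans_le ?_
  calc _ ≤ ∫⁻ q, ENNReal.ofReal (Real.exp (c₁ + c₂)) * nearDensity ψ₁ ψ₂ L x (hopf D q)
        ∂(hopfMeasure ℓ ν ν').comap (hopf D) :=
        lintegral_mono fun q => density_mul_fibreMeasure_le hB hBL h₁ h₂ x q
    _ = ∫⁻ p, ENNReal.ofReal (Real.exp (c₁ + c₂)) * nearDensity ψ₁ ψ₂ L x p
        ∂((hopfMeasure ℓ ν ν').comap (hopf D)).map (hopf D) :=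
        (lintegral_map (hJ.const_mul _) hh).symm
    -- Pushing the pullback forward can only lose mass, so enlarging to all Hopf coordinates is
    -- harmless.
    _ ≤ ∫⁻ p, ENNReal.ofReal (Real.exp (c₁ + c₂)) * nearDensity ψ₁ ψ₂ L x p
        ∂hopfMeasure ℓ ν ν' := lintegral_mono' (map_comap_le hh) le_rfl
    _ = _ := by
        rw [lintegral_const_mul _ hJ, lintegral_nearDensity hG ℓ ν ν' hL x]
        ring

/-- The set of points of `Γ\X` near the projection of `S ⊆ Γ\G` is open. -/
lemma isOpen_setOf_exists_inv_smul_mem {V : Set D.X} (hV : IsOpen V) (S : Set (LeftQuot Γ G)) :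
    IsOpen {p : LeftQuot Γ D.X |
      ∃ (x : D.X) (g : G), LeftQuot.mk Γ x = p ∧ LeftQuot.mk Γ g ∈ S ∧ g⁻¹ • x ∈ V} := by
  have h1 : IsOpen {x : D.X | ∃ g : G, LeftQuot.mk Γ g ∈ S ∧ g⁻¹ • x ∈ V} := by
    have : {x : D.X | ∃ g : G, LeftQuot.mk Γ g ∈ S ∧ g⁻¹ • x ∈ V} =
        ⋃ g ∈ LeftQuot.mk Γ ⁻¹' S, (fun x : D.X => g⁻¹ • x) ⁻¹' V := by
      ext x
      simp
    rw [this]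
    exact isOpen_biUnion fun g _ => hV.preimage (continuous_const_smul _)
  have h2 : IsOpenMap (LeftQuot.mk Γ : D.X → LeftQuot Γ D.X) :=
    isOpenMap_quotient_mk'_mul (Γ := Γ) (T := D.X)
  convert h2 _ h1 using 1
  ext p
  constructor
  · rintro ⟨x, g, rfl, hg, hx⟩
    exact ⟨x, ⟨g, hg, hx⟩, rfl⟩
  · rintro ⟨x, ⟨g, hg, hx⟩, rfl⟩
    exact ⟨x, g, rfl, hg, hx⟩

lemma mem_oneNeighborhood {B : Set G}
    (hB : ∀ b ∈ B, ∀ g, D.dist (D.toX (g * b)) (D.toX g) < 1) {S : Set (LeftQuot Γ G)} {x : D.X}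
    {g : G} (hg : LeftQuot.mk Γ g ∈ S) (hx : g⁻¹ • x ∈ D.toX '' B) :
    LeftQuot.mk Γ x ∈ oneNeighborhood D Γ S := by
  obtain ⟨b, hb, hgb⟩ := hx
  refine ⟨x, g, rfl, hg, ?_⟩
  rw [show x = D.toX (g * b) by rw [← D.smul_toX, hgb, smul_inv_smul]]
  exact hB b hb g

/-- `F` is one of the competitors in the supremum defining the induced measure. -/
lemma setLIntegral_mk_le_inducedMeasure {Y : Type*} [MulAction Γ Y] [TopologicalSpace Y]
    [MeasurableSpace Y] [BorelSpace Y] {μ : Measure Y} {F : Set Y} (hF : MeasurableSet F)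
    (hinj : Set.InjOn (LeftQuot.mk Γ) F) {f : LeftQuot Γ Y → ℝ≥0∞} (hf : Measurable f) :
    ∫⁻ y in F, f (LeftQuot.mk Γ y) ∂μ ≤ ∫⁻ p, f p ∂inducedMeasure Γ μ := by
  rw [← lintegral_map hf (LeftQuot.continuous_mk Γ).measurable]
  exact lintegral_mono' (le_iSup (fun B : {B : Set Y // MeasurableSet B ∧
    Set.InjOn (LeftQuot.mk Γ) B} => (μ.restrict B.1).map (LeftQuot.mk Γ)) ⟨F, hF, hinj⟩) le_rfl

end Smearing

end

/-! ### Assembly of the smearing theorem. -/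

open Smearing

theorem mainTheorem6 {n : ℕ} (G : Subgroup (GL (Fin n) ℝ))
    (hG : Smearing.IsConnectedSemisimpleAlgebraic G) (D : Smearing.CartanData G)
    (Γ : Subgroup G) (hΓ : DiscreteTopology Γ) (hΓ' : ∀ γ : Γ, IsOfFinOrder γ → γ = 1)
    -- a Lebesgue measure on `𝔞`, in any normalization
    (ℓ : Measure D.𝔞) (hℓ : ℓ.IsAddHaarMeasure)
    -- the Riemannian volume of `X`, in any normalization: a nonzero `G`-invariant Radon measure
    (vol : Measure D.X) (hvol : vol ≠ 0) (hvol' : IsFiniteMeasureOnCompacts vol)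
    (hvol'' : ∀ g : G, vol.map (fun x => g • x) = vol)
    (ψ₁ ψ₂ : Module.Dual ℝ D.𝔞)
    (ν : Smearing.ConformalDensity D Γ ψ₁) (ν' : Smearing.ConformalDensity D Γ ψ₂) :
    ∃ c : ℝ, 0 < c ∧
      Smearing.bms ℓ ν ν' Set.univ ≤ ENNReal.ofReal c *
        ∫⁻ x in Smearing.oneNeighborhood D Γ (Smearing.bms ℓ ν ν').support,
          ν.E x * ν'.E x ∂(Smearing.inducedMeasure Γ vol) := by
  have hc : IsClosed (G : Set (GL (Fin n) ℝ)) := hG.isClosed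
  have : ConnectedSpace G := hG.connectedSpace
  have : LocallyCompactSpace G := locallyCompactSpace_of_isClosed hc
  have : Countable Γ := TopologicalSpace.separableSpace_iff_countable.1 inferInstance
  have := sFinite_bmsG hc ℓ ν ν'
  obtain ⟨B, C, hB, hB1, hBC, hC, hdist⟩ := D.exists_nhds_dist_lt_one hc
  obtain ⟨L, hL, hCL⟩ := D.exists_isCompact_busemann_mem hc hC
  obtain ⟨c₁, hc₁⟩ := hL.bddAbove_image (D.continuous_dual ψ₁).continuousOn
  obtain ⟨c₂, hc₂⟩ := hL.bddAbove_image (D.continuous_dual ψ₂).continuousOn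
  obtain ⟨F, hF, hinj, hcov⟩ := exists_measurableSet_injOn_mk Γ
    (D.exists_nhds_smul_mem_imp_eq hΓ hΓ')
  set V : Set D.X := D.toX '' B with hVdef
  have hV : IsOpen V := D.isOpenQuotientMap_toX.isOpenMap _ hB
  have hV0 : vol V ≠ 0 := D.measure_ne_zero_of_isOpen hvol hvol'' hV ⟨_, 1, hB1, rfl⟩
  have hVtop : vol V ≠ ∞ := ((measure_mono (Set.image_mono hBC)).trans_lt
    (hC.image D.isOpenQuotientMap_toX.continuous).measure_lt_top).ne
  set S := (bms ℓ ν ν').support with hSdef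
  have hS : MeasurableSet S := Measure.isClosed_support.measurableSet
  set κ : ℝ≥0∞ := ENNReal.ofReal (Real.exp (c₁ + c₂)) * ℓ L with hκ
  have hκtop : κ ≠ ∞ := ENNReal.mul_ne_top ENNReal.ofReal_ne_top hL.measure_lt_top.ne
  -- An open subset of the one-neighborhood that already contains every contributing point. It
  -- supplies the measurability needed for indicators, so none is required of the one-neighborhood.
  set N' : Set (LeftQuot Γ D.X) := {p |
    ∃ (x : D.X) (g : G), LeftQuot.mk Γ x = p ∧ LeftQuot.mk Γ g ∈ S ∧ g⁻¹ • x ∈ V} with hN'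
  have hN'm : MeasurableSet N' := (isOpen_setOf_exists_inv_smul_mem hV S).measurableSet
  have hN'N : N' ⊆ oneNeighborhood D Γ S := by
    rintro _ ⟨x, g, rfl, hg, hx⟩
    exact mem_oneNeighborhood hdist hg hx
  have hE : Measurable fun p => ν.E p * ν'.E p :=
    (ν.measurable_E hc hΓ).mul (ν'.measurable_E hc hΓ)
  set I := ∫⁻ x in oneNeighborhood D Γ S, ν.E x * ν'.E x ∂inducedMeasure Γ vol with hI
  have hpt : ∀ x : D.X, bmsG ℓ ν ν' {g | LeftQuot.mk Γ g ∈ S ∧ g⁻¹ • x ∈ V} ≤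
      N'.indicator (fun p => κ * (ν.E p * ν'.E p)) (LeftQuot.mk Γ x) := fun x => by
    by_cases hx : LeftQuot.mk Γ x ∈ N'
    · rw [Set.indicator_of_mem hx]
      exact (measure_mono fun g hg => hg.2).trans (bmsG_inv_smul_mem_le hc ℓ ν ν' hB hL
        (fun b hb => hCL b (hBC hb)) (fun v hv => hc₁ ⟨v, hv, rfl⟩)
        (fun v hv => hc₂ ⟨v, hv, rfl⟩) x)
    · rw [Set.indicator_of_notMem hx]
      refine (measure_mono_null (fun g hg => ?_) measure_empty).le
      exact (hx ⟨x, g, rfl, hg⟩).elim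
  have hmain : vol V * bms ℓ ν ν' Set.univ ≤ κ * I := by
    have : SecondCountableTopology (LeftQuot Γ G) :=
      ContinuousConstSMul.secondCountableTopology (Γ := Γ) (T := G)
    have : HereditarilyLindelofSpace (LeftQuot Γ G) :=
      SecondCountableTopology.toHereditarilyLindelof
    -- By second countability the complement of the support is null, so the whole mass lies over
    -- `S`.
    have huniv : bms ℓ ν ν' Set.univ = bms ℓ ν ν' S := by
      rw [← measure_add_measure_compl hS, Measure.measure_compl_support, add_zero]
    calc vol V * bms ℓ ν ν' Set.univ
        ≤ ∫⁻ x in F, bmsG ℓ ν ν' {g | LeftQuot.mk Γ g ∈ S ∧ g⁻¹ • x ∈ V} ∂vol := by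
          rw [huniv]
          exact inducedMeasure_le_lintegral (map_mul_left_bmsG hc ℓ ν ν') hvol'' hV hV0 hVtop hF
            hcov hS
      _ ≤ ∫⁻ x in F, N'.indicator (fun p => κ * (ν.E p * ν'.E p)) (LeftQuot.mk Γ x) ∂vol :=
          lintegral_mono hpt
      _ ≤ ∫⁻ p, N'.indicator (fun p => κ * (ν.E p * ν'.E p)) p ∂inducedMeasure Γ vol :=
          setLIntegral_mk_le_inducedMeasure hF hinj ((hE.const_mul κ).indicator hN'm)
      _ = κ * ∫⁻ p in N', ν.E p * ν'.E p ∂inducedMeasure Γ vol := by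
          rw [lintegral_indicator hN'm, lintegral_const_mul _ hE]
      _ ≤ κ * I := by
          gcongr
          exact lintegral_mono_set hN'N
  -- The summand `1` keeps the constant positive without showing that `κ` is nonzero.
  refine ⟨(κ / vol V).toReal + 1, by positivity, ?_⟩
  have hfin : κ / vol V ≠ ∞ := ENNReal.div_ne_top hκtop hV0
  calc bms ℓ ν ν' Set.univ ≤ κ * I / vol V := by
        rw [ENNReal.le_div_iff_mul_le (Or.inl hV0) (Or.inl hVtop), mul_comm]
        exact hmain
    _ = κ / vol V * I := by rw [ENNReal.mul_div_right_comm]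
    _ ≤ ENNReal.ofReal ((κ / vol V).toReal + 1) * I := by
        gcongr
        rw [ENNReal.ofReal_add ENNReal.toReal_nonneg zero_le_one, ENNReal.ofReal_toReal hfin]
        exact le_self_add
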